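/- **Conventions.** Algebras are associative over $\mathbb C$, possibly without unit, and $\otimes=\otimes_{\mathbb C}$. The product of an algebra $X$ is non-degenerate if $ax=0$ for all $x$, or $xa=0$ for all $x$, implies $a=0$. The multiplier algebra $M(X)$ consists of the pairs $m=(l,r)$ of linear maps $X\to X$ with $x\,l(y)=r(x)\,y$; write $mx=l(x)$ and $xm=r(x)$. A map $\varphi:X\to M(Y)$ is non-degenerate if $\varphi(X)Y=Y=Y\varphi(X)$ (linear spans). A linear map $\Delta:X\to M(X\otimes X)$ is called *coassociative* if $\Delta(x)(1\otimes y)$ and $(x\otimes1)\Delta(y)$ belong to $X\otimes X$ and $$(x\otimes1\otimes1)\,(\Delta\otimes\iota)\big(\Delta(y)(1\otimes z)\big)=(\iota\otimes\Delta)\big((x\otimes1)\Delta(y)\big)\,(1\otimes1\otimes z)$$ for all $x,y,z\in X$. A *regular multiplier Hopf algebra* is an algebra $A$ with non-degenerate product and a non-degenerate coassociative homomorphism $\Delta_A:A\to M(A\otimes A)$ such that $a\otimes a'\mapsto\Delta_A(a)(1\otimes a')$ and $a\otimes a'\mapsto(a\otimes1)\Delta_A(a')$ are bijections of $A\otimes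 A$, and such that the coproduct $\Delta_A$ followed by the flip has the same properties. Write $\Delta_A(a)=\sum a_{(1)}\otimes a_{(2)}$. **Data.** Let $A$ and $B$ be regular multiplier Hopf algebras. * $B$ is a right $A$-module algebra: there is a right action $b\triangleleft a$ of $A$ on $B$ with $B\triangleleft A=B$ (linear span) and $(bb')\triangleleft a=\sum(b\triangleleft a_{(1)})(b'\triangleleft a_{(2)})$. Define linear maps $R,R^{op}:B\otimes A\to A\otimes B$ by $$R(b\otimes a)=\sum a_{(1)}\otimes(b\triangleleft a_{(2)}),\qquad R^{op}(b\otimes a)=\sum a_{(2)}\otimes(b\triangleleft a_{(1)}).$$ The *smash product* $AB$ is the space $A\otimes B$, with $a\otimes b$ written $ab$, and with the product $(ab)(a'b')=\sum a\,a'_{(1)}\,(b\triangleleft a'_{(2)})\,b'$. The algebras $A$ and $B$ are mapped to $M(AB)$ in the obvious way. * $A$ is a left $B$-comodule coalgebra. That is, first, there is an injective linear map $\Gamma:A\to M_0(B\otimes A)$ with $(\iota\otimes\Gamma)\Gamma=(\Delta_B\otimes\iota)\Gamma$. Here $M_0(B\otimes A)$ is the space of pairs of linear maps $b\mapsto y(b\otimes1)$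 and $b\mapsto(b\otimes1)y$ from $B$ to $B\otimes A$ with $(b\otimes1)\big(y(b'\otimes1)\big)=\big((b\otimes1)y\big)(b'\otimes1)$. Define $T,T^{op}:A\otimes B\to B\otimes A$ by $$T(a\otimes b)=\Gamma(a)(b\otimes1),\qquad T^{op}(a\otimes b)=(b\otimes1)\Gamma(a).$$ Second, for all $a,a'\in A$ and $b\in B$, the elements $\big((\iota\otimes T)(\Delta_A(a)\otimes b)\big)(1\otimes1\otimes a')$ and $(1\otimes1\otimes a')\big((\iota\otimes T)(\Delta_A(a)\otimes b)\big)$ belong to $A\otimes B\otimes A$. Third, $$(\iota\otimes\Delta_A)T=(T\otimes\iota)(\iota\otimes T)(\Delta_A\otimes\iota)\quad\text{on }A\otimes B,$$ read after multiplying the third factor by an arbitrary $a'\in A$, on the right and on the left. Put $P=T^{op}\circ R^{op}:B\otimes A\to B\otimes A$, and let $P_{ij}$ be $P$ acting on the $i$-th and $j$-th factors. **Theorem.** Assume that 1. $P(\iota\otimes m_A)=(\iota\otimes m_A)P_{13}P_{12}$ on $B\otimes A\otimes A$, where $m_A$ is the product of $A$; 2. $(\Delta_B\otimes\iota)P=P_{23}P_{13}(\Delta_B\otimes\iota)$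 on $B\otimes A$, in the sense that $$(d\otimes1\otimes1)\big((\Delta_B\otimes\iota)P(b\otimes a)\big)=P_{23}\Big((d\otimes1\otimes1)\,P_{13}\big(\Delta_B(b)\otimes a\big)\Big)\quad\text{for all }a\in A,\ b,d\in B,$$ where $(d\otimes1\otimes1)P_{13}(\Delta_B(b)\otimes a)$ belongs to $B\otimes B\otimes A$; 3. $T\circ R=T^{op}\circ R^{op}$ on $B\otimes A$. Then the formula $\Delta_\#(ab)=\sum(a_{(1)}\otimes1)\,\Gamma(a_{(2)})\,\Delta_B(b)$ is well defined: there is a unique linear map $\Delta_\#:AB\to M(AB\otimes AB)$ such that $$(a'\otimes1)\,\Delta_\#(ab)\,(1\otimes b')=(\iota\otimes T\otimes\iota)\big((a'\otimes1)\Delta_A(a)\otimes\Delta_B(b)(1\otimes b')\big)\in AB\otimes AB$$ for all $a,a'\in A$ and $b,b'\in B$. Moreover $\Delta_\#$ is an algebra homomorphism, it is non-degenerate, that is $\Delta_\#(AB)(AB\otimes AB)=AB\otimes AB=(AB\otimes AB)\Delta_\#(AB)$, and it is coassociative in the above sense; in particular $\Delta_\#(x)(1\otimes y)$ and $(x\otimes1)\Delta_\#(y)$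 belong to $AB\otimes AB$ for all $x,y\in AB$. -/

import Mathlib

open scoped TensorProduct

noncomputable section

namespace Bicross

universe u v

set_option linter.unusedSectionVars false

/-! ### Algebras with non-degenerate product, multiplier algebras -/

section Multipliers

variable (X : Type u) [NonUnitalRing X] [Module ℂ X] [IsScalarTower ℂ X X] [SMulCommClass ℂ X X]

/-- The product of `X` is non-degenerate as a bilinear map. -/
structure NondegenerateProduct : Prop where
  left : ∀ a : X, (∀ b, a * b = 0) → a = 0
  right : ∀ a : X, (∀ b, b * a = 0) → a = 0

/-- The multiplier algebra `M(X)`: pairs `(l, r)` of linear maps with `x (l y) = (r x) y`, where `l` is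
left multiplication by the multiplier and `r` is right multiplication by it. The product is
`(l, r) (l', r') = (l ∘ l', r' ∘ r)`. (When the product of `X` is non-degenerate, `l (x y) = l x y`
and `r (x y) = x (r y)` follow.) -/
def multiplierSubalgebra : Subalgebra ℂ (Module.End ℂ X × (Module.End ℂ X)ᵐᵒᵖ) where
  carrier := {p | ∀ x y : X, x * p.1 y = p.2.unop x * y}
  mul_mem' := by
    intro p q hp hq x y
    simp only [Set.mem_ofPred_eq] at hp hq
    simp [hp, hq]
  add_mem' := by
    intro p q hp hq x y
    simp only [Set.mem_ofPred_eq] at hp hq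
    simp [hp, hq, mul_add, add_mul]
  algebraMap_mem' := by
    intro c x y
    simp [Prod.algebraMap_apply, MulOpposite.algebraMap_apply, Module.algebraMap_end_apply,
      mul_smul_comm, smul_mul_assoc]

/-- The multiplier algebra of `X`. -/
def Multiplier : Type u := multiplierSubalgebra X

instance : Ring (Multiplier X) := inferInstanceAs (Ring (multiplierSubalgebra X))

instance : Algebra ℂ (Multiplier X) := inferInstanceAs (Algebra ℂ (multiplierSubalgebra X))

variable {X}

namespace Multiplier

/-- Left multiplication by a multiplier: `m.left x = m x`. -/
def left (m : Multiplier X) : X →ₗ[ℂ] X := m.1.1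

/-- Right multiplication by a multiplier: `m.right x = x m`. -/
def right (m : Multiplier X) : X →ₗ[ℂ] X := m.1.2.unop

theorem central (m : Multiplier X) (x y : X) : x * m.left y = m.right x * y := m.2 x y

/-- The multiplier with given left and right multiplications. -/
def mk (l r : X →ₗ[ℂ] X) (h : ∀ x y, x * l y = r x * y) : Multiplier X :=
  ⟨(l, MulOpposite.op r), h⟩

@[ext] theorem ext {m n : Multiplier X} (hl : ∀ x, m.left x = n.left x)
    (hr : ∀ x, m.right x = n.right x) : m = n := by
  apply Subtype.ext
  refine Prod.ext (LinearMap.ext hl) (MulOpposite.unop_injective (LinearMap.ext hr))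

@[simp] theorem mk_left (l r : X →ₗ[ℂ] X) (h) : (mk l r h).left = l := rfl
@[simp] theorem mk_right (l r : X →ₗ[ℂ] X) (h) : (mk l r h).right = r := rfl
@[simp] theorem mul_left (m n : Multiplier X) (x : X) : (m * n).left x = m.left (n.left x) := rfl
@[simp] theorem mul_right (m n : Multiplier X) (x : X) : (m * n).right x = n.right (m.right x) := rfl
@[simp] theorem one_left (x : X) : (1 : Multiplier X).left x = x := rfl
@[simp] theorem one_right (x : X) : (1 : Multiplier X).right x = x := rfl

/-- An element of `X` as a multiplier. -/
def of (a : X) : Multiplier X :=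
  mk (LinearMap.mulLeft ℂ a) (LinearMap.mulRight ℂ a) fun x y => by simp [mul_assoc]

@[simp] theorem of_left (a x : X) : (of a).left x = a * x := rfl
@[simp] theorem of_right (a x : X) : (of a).right x = x * a := rfl

variable {Y : Type v} [NonUnitalRing Y] [Module ℂ Y] [IsScalarTower ℂ Y Y] [SMulCommClass ℂ Y Y]

/-- The multiplier `m ⊗ n` of `X ⊗ Y`. -/
def tmul (m : Multiplier X) (n : Multiplier Y) : Multiplier (X ⊗[ℂ] Y) :=
  mk (TensorProduct.map m.left n.left) (TensorProduct.map m.right n.right) fun x y => by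
    induction x with
    | zero => simp
    | add x x' hx hx' => simp [add_mul, hx, hx']
    | tmul a b =>
      induction y with
      | zero => simp
      | add y y' hy hy' => simp only [map_add, mul_add, hy, hy']
      | tmul c d => simp [m.central, n.central]

@[simp] theorem tmul_left (m : Multiplier X) (n : Multiplier Y) :
    (tmul m n).left = TensorProduct.map m.left n.left := rfl
@[simp] theorem tmul_right (m : Multiplier X) (n : Multiplier Y) :
    (tmul m n).right = TensorProduct.map m.right n.right := rfl

theorem comm_mul (s t : X ⊗[ℂ] Y) : TensorProduct.comm ℂ X Y (s * t) =
    TensorProduct.comm ℂ X Y s * TensorProduct.comm ℂ X Y t := by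
  induction s with
  | zero => simp
  | add x x' hx hx' => simp [add_mul, hx, hx']
  | tmul a b =>
    induction t with
    | zero => simp
    | add y y' hy hy' => simp only [map_add, mul_add, hy, hy']
    | tmul c d => simp

/-- The flip `M(X ⊗ X) → M(X ⊗ X)`, extending `x ⊗ y ↦ y ⊗ x`. -/
def flip : Multiplier (X ⊗[ℂ] X) →ₙₐ[ℂ] Multiplier (X ⊗[ℂ] X) where
  toFun m := mk
    ((TensorProduct.comm ℂ X X).toLinearMap ∘ₗ m.left ∘ₗ (TensorProduct.comm ℂ X X).toLinearMap)
    ((TensorProduct.comm ℂ X X).toLinearMap ∘ₗ m.right ∘ₗ (TensorProduct.comm ℂ X X).toLinearMap)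
    fun x y => by
      have h := congrArg (TensorProduct.comm ℂ X X)
        (m.central (TensorProduct.comm ℂ X X x) (TensorProduct.comm ℂ X X y))
      rw [comm_mul, comm_mul] at h
      simpa using h
  map_smul' c m := by
    apply ext <;> intro x
    · exact map_smul (TensorProduct.comm ℂ X X) c _
    · exact map_smul (TensorProduct.comm ℂ X X) c _
  map_zero' := by
    apply ext <;> intro x
    · exact map_zero (TensorProduct.comm ℂ X X)
    · exact map_zero (TensorProduct.comm ℂ X X)
  map_add' m n := by
    apply ext <;> intro x
    · exact map_add (TensorProduct.comm ℂ X X) _ _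
    · exact map_add (TensorProduct.comm ℂ X X) _ _
  map_mul' m n := by
    apply ext <;> intro x <;> simp

theorem flip_left (m : Multiplier (X ⊗[ℂ] X)) (x : X ⊗[ℂ] X) :
    (flip m).left x = TensorProduct.comm ℂ X X (m.left (TensorProduct.comm ℂ X X x)) := rfl
theorem flip_right (m : Multiplier (X ⊗[ℂ] X)) (x : X ⊗[ℂ] X) :
    (flip m).right x = TensorProduct.comm ℂ X X (m.right (TensorProduct.comm ℂ X X x)) := rfl

end Multiplier

variable {Y : Type v} [NonUnitalRing Y] [Module ℂ Y] [IsScalarTower ℂ Y Y] [SMulCommClass ℂ Y Y]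

/-- A map `φ : X → M(Y)` is non-degenerate: `φ(X) Y = Y` and `Y φ(X) = Y` (linear spans). -/
structure IsNondegenerate (φ : X → Multiplier Y) : Prop where
  left : Submodule.span ℂ {z : Y | ∃ x y, z = (φ x).left y} = ⊤
  right : Submodule.span ℂ {z : Y | ∃ x y, z = (φ x).right y} = ⊤

/-- `T(a ⊗ b) = Δ(a)(1 ⊗ b)`; in particular the right-hand side belongs to `X ⊗ X`. -/
def IsCanonical₁ (Δ : X → Multiplier (X ⊗[ℂ] X)) (T : X ⊗[ℂ] X →ₗ[ℂ] X ⊗[ℂ] X) : Prop :=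
  ∀ a b, Multiplier.of (T (a ⊗ₜ b)) = Δ a * Multiplier.tmul 1 (Multiplier.of b)

/-- `T(a ⊗ b) = (a ⊗ 1)Δ(b)`; in particular the right-hand side belongs to `X ⊗ X`. -/
def IsCanonical₂ (Δ : X → Multiplier (X ⊗[ℂ] X)) (T : X ⊗[ℂ] X →ₗ[ℂ] X ⊗[ℂ] X) : Prop :=
  ∀ a b, Multiplier.of (T (a ⊗ₜ b)) = Multiplier.tmul (Multiplier.of a) 1 * Δ b

/-- Coassociativity of `Δ : X → M(X ⊗ X)`: the elements `Δ(a)(1 ⊗ b)` and `(a ⊗ 1)Δ(b)` belong to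
`X ⊗ X`, and `(a ⊗ 1 ⊗ 1)(Δ ⊗ ι)(Δ(b)(1 ⊗ c)) = (ι ⊗ Δ)((a ⊗ 1)Δ(b))(1 ⊗ 1 ⊗ c)`. In terms of
`T₁(a ⊗ b) = Δ(a)(1 ⊗ b)` and `T₂(a ⊗ b) = (a ⊗ 1)Δ(b)` the latter reads
`(T₂ ⊗ ι)(ι ⊗ T₁) = (ι ⊗ T₁)(T₂ ⊗ ι)`. -/
def IsCoassociative (Δ : X → Multiplier (X ⊗[ℂ] X)) : Prop :=
  ∃ T₁ T₂ : X ⊗[ℂ] X →ₗ[ℂ] X ⊗[ℂ] X, IsCanonical₁ Δ T₁ ∧ IsCanonical₂ Δ T₂ ∧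
    ∀ a b c : X,
      TensorProduct.assoc ℂ X X X
          (T₂.rTensor X ((TensorProduct.assoc ℂ X X X).symm (a ⊗ₜ T₁ (b ⊗ₜ c)))) =
        T₁.lTensor X (TensorProduct.assoc ℂ X X X (T₂ (a ⊗ₜ b) ⊗ₜ c))

end Multipliers

/-! ### Regular multiplier Hopf algebras -/

section MultiplierHopf

variable {A : Type u} [NonUnitalRing A] [Module ℂ A] [IsScalarTower ℂ A A] [SMulCommClass ℂ A A]

/-- `(A, Δ)` is a multiplier Hopf algebra: `Δ` is a non-degenerate coassociative homomorphism and the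
maps `a ⊗ b ↦ Δ(a)(1 ⊗ b)` and `a ⊗ b ↦ (a ⊗ 1)Δ(b)` are bijections of `A ⊗ A`. -/
structure IsMultiplierHopf (Δ : A →ₙₐ[ℂ] Multiplier (A ⊗[ℂ] A)) : Prop where
  nondegenerate : IsNondegenerate Δ
  coassociative : IsCoassociative Δ
  bijective₁ : ∃ T : A ⊗[ℂ] A ≃ₗ[ℂ] A ⊗[ℂ] A, IsCanonical₁ Δ T.toLinearMap
  bijective₂ : ∃ T : A ⊗[ℂ] A ≃ₗ[ℂ] A ⊗[ℂ] A, IsCanonical₂ Δ T.toLinearMap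

variable (A) in
/-- A regular multiplier Hopf algebra structure on the algebra `A` with non-degenerate product: both
`(A, Δ)` and `(A, Δᵒᵖ)` are multiplier Hopf algebras. -/
structure RegularMultiplierHopf where
  nondegenerate : NondegenerateProduct A
  comul : A →ₙₐ[ℂ] Multiplier (A ⊗[ℂ] A)
  isMultiplierHopf : IsMultiplierHopf comul
  isMultiplierHopf_op : IsMultiplierHopf (Multiplier.flip.comp comul)

namespace RegularMultiplierHopf

variable (H : RegularMultiplierHopf A)

/-- `T₁(a ⊗ b) = Δ(a)(1 ⊗ b)`. -/
def T₁ : A ⊗[ℂ] A ≃ₗ[ℂ] A ⊗[ℂ] A := H.isMultiplierHopf.bijective₁.choose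

/-- `T₂(a ⊗ b) = (a ⊗ 1)Δ(b)`. -/
def T₂ : A ⊗[ℂ] A ≃ₗ[ℂ] A ⊗[ℂ] A := H.isMultiplierHopf.bijective₂.choose

/-- `T₃(a ⊗ b) = Δ(a)(b ⊗ 1)`, the flip of `Δᵒᵖ(a)(1 ⊗ b)`. -/
def T₃ : A ⊗[ℂ] A ≃ₗ[ℂ] A ⊗[ℂ] A :=
  H.isMultiplierHopf_op.bijective₁.choose.trans (TensorProduct.comm ℂ A A)

/-- `T₄(a ⊗ b) = (1 ⊗ a)Δ(b)`, the flip of `(a ⊗ 1)Δᵒᵖ(b)`. -/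
def T₄ : A ⊗[ℂ] A ≃ₗ[ℂ] A ⊗[ℂ] A :=
  H.isMultiplierHopf_op.bijective₂.choose.trans (TensorProduct.comm ℂ A A)

theorem T₁_spec (a b : A) :
    Multiplier.of (H.T₁ (a ⊗ₜ b)) = H.comul a * Multiplier.tmul 1 (Multiplier.of b) :=
  H.isMultiplierHopf.bijective₁.choose_spec a b

theorem T₂_spec (a b : A) :
    Multiplier.of (H.T₂ (a ⊗ₜ b)) = Multiplier.tmul (Multiplier.of a) 1 * H.comul b :=
  H.isMultiplierHopf.bijective₂.choose_spec a b

theorem flip_of (t : A ⊗[ℂ] A) :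
    Multiplier.flip (Multiplier.of t) = Multiplier.of (TensorProduct.comm ℂ A A t) := by
  apply Multiplier.ext <;> intro x
  · simp [Multiplier.flip_left, Multiplier.comm_mul]
  · simp [Multiplier.flip_right, Multiplier.comm_mul]

theorem flip_flip (m : Multiplier (A ⊗[ℂ] A)) : Multiplier.flip (Multiplier.flip m) = m := by
  apply Multiplier.ext <;> intro x
  · simp [Multiplier.flip_left]
  · simp [Multiplier.flip_right]

theorem flip_tmul (m n : Multiplier A) :
    Multiplier.flip (Multiplier.tmul m n) = Multiplier.tmul n m := by
  apply Multiplier.ext <;> intro x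
  · simp [Multiplier.flip_left, TensorProduct.map_comm]
  · simp [Multiplier.flip_right, TensorProduct.map_comm]

theorem T₃_spec (a b : A) :
    Multiplier.of (H.T₃ (a ⊗ₜ b)) = H.comul a * Multiplier.tmul (Multiplier.of b) 1 := by
  have h := H.isMultiplierHopf_op.bijective₁.choose_spec a b
  have h' := congrArg Multiplier.flip h
  rw [flip_of, map_mul, flip_tmul] at h'
  simpa [flip_flip, T₃] using h'

theorem T₄_spec (a b : A) :
    Multiplier.of (H.T₄ (a ⊗ₜ b)) = Multiplier.tmul 1 (Multiplier.of a) * H.comul b := by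
  have h := H.isMultiplierHopf_op.bijective₂.choose_spec a b
  have h' := congrArg Multiplier.flip h
  rw [flip_of, map_mul, flip_tmul] at h'
  simpa [flip_flip, T₄] using h'


/-! Elementary cancellation facts for tensor products over a field. -/

theorem eq_zero_of_lTensor_dual {V : Type*} {W : Type*} [AddCommGroup V] [Module ℂ V]
    [AddCommGroup W] [Module ℂ W] (z : V ⊗[ℂ] W)
    (h : ∀ f : W →ₗ[ℂ] ℂ, f.lTensor V z = 0) : z = 0 := by
  classical
  let b := Module.Basis.ofVectorSpace ℂ W
  apply (TensorProduct.equivFinsuppOfBasisRight (M := V) b).injective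
  ext i
  rw [TensorProduct.equivFinsuppOfBasisRight_apply, h]
  simp

theorem eq_of_rTensor {V V' W ι : Type*} [AddCommGroup V] [Module ℂ V]
    [AddCommGroup V'] [Module ℂ V'] [AddCommGroup W] [Module ℂ W] (f : ι → V →ₗ[ℂ] V')
    (hf : ∀ v, (∀ i, f i v = 0) → v = 0) {z z' : V ⊗[ℂ] W}
    (h : ∀ i, (f i).rTensor W z = (f i).rTensor W z') : z = z' := by
  rw [← sub_eq_zero]
  apply eq_zero_of_lTensor_dual
  intro g
  apply (TensorProduct.rid ℂ V).injective
  rw [map_zero]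
  apply hf
  intro i
  have h0 : (f i).rTensor W (z - z') = 0 := by rw [map_sub, h, sub_self]
  have key : ∀ y : V ⊗[ℂ] W, f i (TensorProduct.rid ℂ V (g.lTensor V y)) =
      TensorProduct.rid ℂ V' (g.lTensor V' ((f i).rTensor W y)) := by
    intro y
    induction y with
    | zero => simp
    | add y y' h h' => simp only [map_add, h, h']
    | tmul v w => simp
  rw [key, h0]
  simp

theorem eq_of_lTensor {V W W' ι : Type*} [AddCommGroup V] [Module ℂ V]
    [AddCommGroup W'] [Module ℂ W'] [AddCommGroup W] [Module ℂ W] (f : ι → W →ₗ[ℂ] W')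
    (hf : ∀ v, (∀ i, f i v = 0) → v = 0) {z z' : V ⊗[ℂ] W}
    (h : ∀ i, (f i).lTensor V z = (f i).lTensor V z') : z = z' := by
  apply (TensorProduct.comm ℂ V W).injective
  apply eq_of_rTensor f hf
  intro i
  have key : ∀ y : V ⊗[ℂ] W, (f i).rTensor V (TensorProduct.comm ℂ V W y) =
      TensorProduct.comm ℂ V W' ((f i).lTensor V y) := by
    intro y
    induction y with
    | zero => simp
    | add y y' h h' => simp only [map_add, h, h']
    | tmul v w => simp
  rw [key, key, h]

/-- A linear map defined by covering: if the maps `K i` are jointly injective and, for every `x` in a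
spanning set, there is a `z` with `K i z = F i x` for all `i`, then there is a linear map `f` with
`K i (f x) = F i x` for all `x` and `i`. -/
theorem exists_covered {V Z Z' ι : Type*} [AddCommGroup V] [Module ℂ V]
    [AddCommGroup Z] [Module ℂ Z] [AddCommGroup Z'] [Module ℂ Z']
    (K : ι → Z →ₗ[ℂ] Z') (F : ι → V →ₗ[ℂ] Z')
    (hK : ∀ z z', (∀ i, K i z = K i z') → z = z') (S : Set V) (hS : Submodule.span ℂ S = ⊤)
    (hF : ∀ x ∈ S, ∃ z, ∀ i, K i z = F i x) :
    ∃ f : V →ₗ[ℂ] Z, ∀ x i, K i (f x) = F i x := by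
  have h : ∀ x, ∃ z, ∀ i, K i z = F i x := by
    intro x
    have hx : x ∈ Submodule.span ℂ S := by rw [hS]; trivial
    induction hx using Submodule.span_induction with
    | mem x hx => exact hF x hx
    | zero => exact ⟨0, by simp⟩
    | add x y _ _ hx hy =>
      obtain ⟨z, hz⟩ := hx
      obtain ⟨z', hz'⟩ := hy
      exact ⟨z + z', by simp [hz, hz']⟩
    | smul c x _ hx =>
      obtain ⟨z, hz⟩ := hx
      exact ⟨c • z, by simp [hz]⟩
  choose f hf using h
  exact ⟨{ toFun := f
           map_add' := fun x y => hK _ _ fun i => by simp [hf]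
           map_smul' := fun c x => hK _ _ fun i => by simp [hf] }, fun x i => hf x i⟩

theorem mulLeft_cancel (H : RegularMultiplierHopf A) (v : A)
    (h : ∀ a, LinearMap.mulLeft ℂ a v = 0) : v = 0 := H.nondegenerate.right v h

theorem mulRight_cancel (H : RegularMultiplierHopf A) (v : A)
    (h : ∀ a, LinearMap.mulRight ℂ a v = 0) : v = 0 := H.nondegenerate.left v h

theorem of_injective (H : RegularMultiplierHopf A) {s t : A ⊗[ℂ] A}
    (h : Multiplier.of s = Multiplier.of t) : s = t := by
  apply eq_of_rTensor (fun a : A => LinearMap.mulLeft ℂ a) H.mulLeft_cancel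
  intro a
  apply eq_of_lTensor (fun a : A => LinearMap.mulLeft ℂ a) H.mulLeft_cancel
  intro b
  have key : ∀ y : A ⊗[ℂ] A, (LinearMap.mulLeft ℂ b).lTensor A ((LinearMap.mulLeft ℂ a).rTensor A y)
      = (a ⊗ₜ b) * y := by
    intro y
    induction y with
    | zero => simp
    | add y y' h h' => simp only [map_add, mul_add, h, h']
    | tmul v w => simp
  rw [key, key]
  exact congrArg (fun m => Multiplier.right m (a ⊗ₜ b)) h

theorem of_rTensor_mulLeft (a : A) (t : A ⊗[ℂ] A) :
    Multiplier.of ((LinearMap.mulLeft ℂ a).rTensor A t) =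
      Multiplier.tmul (Multiplier.of a) 1 * Multiplier.of t := by
  have key : ∀ x : A ⊗[ℂ] A, (LinearMap.mulLeft ℂ a).rTensor A t * x =
      TensorProduct.map (Multiplier.of a).left (1 : Multiplier A).left (t * x) := by
    intro x
    induction t with
    | zero => simp
    | add y y' h h' => simp only [map_add, add_mul, h, h']
    | tmul v w =>
      induction x with
      | zero => simp
      | add y y' h h' => simp only [map_add, mul_add, h, h']
      | tmul v' w' => simp [mul_assoc]
  have key' : ∀ x : A ⊗[ℂ] A, x * (LinearMap.mulLeft ℂ a).rTensor A t =
      TensorProduct.map (Multiplier.of a).right (1 : Multiplier A).right x * t := by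
    intro x
    clear key
    induction t with
    | zero => simp
    | add y y' h h' => simp only [map_add, mul_add, h, h']
    | tmul v w =>
      induction x with
      | zero => simp
      | add y y' h h' => simp only [map_add, add_mul, h, h']
      | tmul v' w' => simp [mul_assoc]
  apply Multiplier.ext <;> intro x
  · exact key x
  · exact key' x

theorem of_lTensor_mulLeft (a : A) (t : A ⊗[ℂ] A) :
    Multiplier.of ((LinearMap.mulLeft ℂ a).lTensor A t) =
      Multiplier.tmul 1 (Multiplier.of a) * Multiplier.of t := by
  have key : (LinearMap.mulLeft ℂ a).lTensor A t = TensorProduct.comm ℂ A A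
      ((LinearMap.mulLeft ℂ a).rTensor A (TensorProduct.comm ℂ A A t)) := by
    induction t with
    | zero => simp
    | add y y' h h' => simp only [map_add, h, h']
    | tmul v w => simp
  rw [key, ← flip_of, of_rTensor_mulLeft, map_mul, flip_tmul, flip_of]
  simp

theorem of_lTensor_mulRight (a : A) (t : A ⊗[ℂ] A) :
    Multiplier.of ((LinearMap.mulRight ℂ a).lTensor A t) =
      Multiplier.of t * Multiplier.tmul 1 (Multiplier.of a) := by
  have key : ∀ x : A ⊗[ℂ] A, (LinearMap.mulRight ℂ a).lTensor A t * x =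
      t * TensorProduct.map (1 : Multiplier A).left (Multiplier.of a).left x := by
    intro x
    induction t with
    | zero => simp
    | add y y' h h' => simp only [map_add, add_mul, h, h']
    | tmul v w =>
      induction x with
      | zero => simp
      | add y y' h h' => simp only [map_add, mul_add, h, h']
      | tmul v' w' => simp [mul_assoc]
  have key' : ∀ x : A ⊗[ℂ] A, x * (LinearMap.mulRight ℂ a).lTensor A t =
      TensorProduct.map (1 : Multiplier A).right (Multiplier.of a).right (x * t) := by
    intro x
    clear key
    induction t with
    | zero => simp
    | add y y' h h' => simp only [map_add, mul_add, h, h']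
    | tmul v w =>
      induction x with
      | zero => simp
      | add y y' h h' => simp only [map_add, add_mul, h, h']
      | tmul v' w' => simp [mul_assoc]
  apply Multiplier.ext <;> intro x
  · exact key x
  · exact key' x

theorem tmul_of_mul_tmul_of (p q : A) :
    Multiplier.tmul 1 (Multiplier.of q) * Multiplier.tmul (Multiplier.of p) 1 =
      Multiplier.of (p ⊗ₜ[ℂ] q) := by
  apply Multiplier.ext <;> intro y
  · induction y with
    | zero => simp
    | add y y' h h' => simp only [map_add, h, h']
    | tmul v w => simp
  · induction y with
    | zero => simp
    | add y y' h h' => simp only [map_add, h, h']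
    | tmul v w => simp

theorem tmul_of_mul_tmul_of' (p q : A) :
    Multiplier.tmul (Multiplier.of p) 1 * Multiplier.tmul 1 (Multiplier.of q) =
      Multiplier.of (p ⊗ₜ[ℂ] q) := by
  apply Multiplier.ext <;> intro y
  · induction y with
    | zero => simp
    | add y y' h h' => simp only [map_add, h, h']
    | tmul v w => simp
  · induction y with
    | zero => simp
    | add y y' h h' => simp only [map_add, h, h']
    | tmul v w => simp

/-- Both sides are `(a ⊗ e)Δ(x)`. -/
theorem T₄_T₂ (a e x : A) : (LinearMap.mulLeft ℂ a).rTensor A (H.T₄ (e ⊗ₜ x)) =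
    (LinearMap.mulLeft ℂ e).lTensor A (H.T₂ (a ⊗ₜ x)) := by
  apply H.of_injective
  rw [of_rTensor_mulLeft, of_lTensor_mulLeft, T₄_spec, T₂_spec, ← mul_assoc, ← mul_assoc,
    tmul_of_mul_tmul_of, tmul_of_mul_tmul_of']

/-- Both sides are `(1 ⊗ e)Δ(x)(1 ⊗ c)`. -/
theorem T₄_T₁ (e x c : A) : (LinearMap.mulRight ℂ c).lTensor A (H.T₄ (e ⊗ₜ x)) =
    (LinearMap.mulLeft ℂ e).lTensor A (H.T₁ (x ⊗ₜ c)) := by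
  apply H.of_injective
  rw [of_lTensor_mulRight, of_lTensor_mulLeft, T₄_spec, T₁_spec, mul_assoc]

/-- `t Δ(x)` for `t ∈ A ⊗ A`, where `(p ⊗ q)Δ(x) = (1 ⊗ q)((p ⊗ 1)Δ(x))`. -/
def mulComul (x : A) : A ⊗[ℂ] A →ₗ[ℂ] A ⊗[ℂ] A :=
  TensorProduct.lift
    ((LinearMap.llcomp ℂ A (A ⊗[ℂ] A) (A ⊗[ℂ] A)).flip
      (H.T₂.toLinearMap ∘ₗ (TensorProduct.mk ℂ A A).flip x) ∘ₗ
        (LinearMap.lTensorHom A ∘ₗ LinearMap.mul ℂ A)).flip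

@[simp] theorem mulComul_tmul (x p q : A) : H.mulComul x (p ⊗ₜ q) =
    (LinearMap.mulLeft ℂ q).lTensor A (H.T₂ (p ⊗ₜ x)) := rfl

theorem of_mulComul (x : A) (t : A ⊗[ℂ] A) :
    Multiplier.of (H.mulComul x t) = Multiplier.of t * H.comul x := by
  have hadd : ∀ s t : A ⊗[ℂ] A, Multiplier.of (s + t) = Multiplier.of s + Multiplier.of t := by
    intro s t
    apply Multiplier.ext <;> intro y
    · exact add_mul _ _ _
    · exact mul_add _ _ _
  have hzero : Multiplier.of (0 : A ⊗[ℂ] A) = 0 := by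
    apply Multiplier.ext <;> intro y
    · exact zero_mul _
    · exact mul_zero _
  induction t with
  | zero => rw [map_zero, hzero, zero_mul]
  | add s t hs ht => rw [map_add, hadd, hadd, hs, ht, add_mul]
  | tmul p q => rw [mulComul_tmul, of_lTensor_mulLeft, T₂_spec, ← mul_assoc, tmul_of_mul_tmul_of]

theorem T₂_mul (a x y : A) : H.T₂ (a ⊗ₜ (x * y)) = H.mulComul y (H.T₂ (a ⊗ₜ x)) := by
  apply H.of_injective
  rw [of_mulComul, T₂_spec, T₂_spec, map_mul, mul_assoc]

theorem coassoc_T₂_T₁ (a b c : A) :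
    TensorProduct.assoc ℂ A A A
        (H.T₂.toLinearMap.rTensor A ((TensorProduct.assoc ℂ A A A).symm (a ⊗ₜ H.T₁ (b ⊗ₜ c)))) =
      H.T₁.toLinearMap.lTensor A (TensorProduct.assoc ℂ A A A (H.T₂ (a ⊗ₜ b) ⊗ₜ c)) := by
  obtain ⟨S₁, S₂, h₁, h₂, h⟩ := H.isMultiplierHopf.coassociative
  have e₁ : S₁ = H.T₁.toLinearMap := TensorProduct.ext' fun a b =>
    H.of_injective ((h₁ a b).trans (H.T₁_spec a b).symm)
  have e₂ : S₂ = H.T₂.toLinearMap := TensorProduct.ext' fun a b =>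
    H.of_injective ((h₂ a b).trans (H.T₂_spec a b).symm)
  subst e₁ e₂
  exact h a b c

/-- Both sides are `(a ⊗ 1 ⊗ e)Δ⁽²⁾(x)`. -/
theorem coassoc_T₂_T₄ (a e x : A) :
    TensorProduct.assoc ℂ A A A
        ((H.T₂.toLinearMap ∘ₗ TensorProduct.mk ℂ A A a).rTensor A (H.T₄ (e ⊗ₜ x))) =
      (H.T₄.toLinearMap ∘ₗ TensorProduct.mk ℂ A A e).lTensor A (H.T₂ (a ⊗ₜ x)) := by
  apply eq_of_lTensor (fun c : A => (LinearMap.mulRight ℂ c).lTensor A)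
    (fun v hv => eq_of_lTensor (fun c : A => LinearMap.mulRight ℂ c) H.mulRight_cancel
      (fun c => by rw [hv c, map_zero]))
  intro c
  have h1 : ∀ y : A ⊗[ℂ] A, ((LinearMap.mulRight ℂ c).lTensor A).lTensor A
      (TensorProduct.assoc ℂ A A A
        ((H.T₂.toLinearMap ∘ₗ TensorProduct.mk ℂ A A a).rTensor A y)) =
      TensorProduct.assoc ℂ A A A
        ((H.T₂.toLinearMap ∘ₗ TensorProduct.mk ℂ A A a).rTensor A
          ((LinearMap.mulRight ℂ c).lTensor A y)) := by
    intro y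
    induction y with
    | zero => simp
    | add y y' h h' => simp only [map_add, h, h']
    | tmul v w =>
      simp only [LinearMap.rTensor_tmul, LinearMap.lTensor_tmul]
      generalize (H.T₂.toLinearMap ∘ₗ TensorProduct.mk ℂ A A a) v = z
      induction z with
      | zero => simp
      | add y y' h h' => simp only [map_add, TensorProduct.add_tmul, h, h']
      | tmul v' w' => simp
  have h2 : ∀ y : A ⊗[ℂ] A, ((LinearMap.mulLeft ℂ e).lTensor A).lTensor A
      (TensorProduct.assoc ℂ A A A
        ((H.T₂.toLinearMap ∘ₗ TensorProduct.mk ℂ A A a).rTensor A y)) =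
      TensorProduct.assoc ℂ A A A
        ((H.T₂.toLinearMap ∘ₗ TensorProduct.mk ℂ A A a).rTensor A
          ((LinearMap.mulLeft ℂ e).lTensor A y)) := by
    intro y
    induction y with
    | zero => simp
    | add y y' h h' => simp only [map_add, h, h']
    | tmul v w =>
      simp only [LinearMap.rTensor_tmul, LinearMap.lTensor_tmul]
      generalize (H.T₂.toLinearMap ∘ₗ TensorProduct.mk ℂ A A a) v = z
      induction z with
      | zero => simp
      | add y y' h h' => simp only [map_add, TensorProduct.add_tmul, h, h']
      | tmul v' w' => simp
  have h3 : ∀ y : A ⊗[ℂ] A, H.T₂.toLinearMap.rTensor A ((TensorProduct.assoc ℂ A A A).symm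
      (a ⊗ₜ y)) = (H.T₂.toLinearMap ∘ₗ TensorProduct.mk ℂ A A a).rTensor A y := by
    intro y
    induction y with
    | zero => simp
    | add y y' h h' => simp only [map_add, TensorProduct.tmul_add, h, h']
    | tmul v w => simp
  have h4 : ∀ y : A ⊗[ℂ] A, ((LinearMap.mulRight ℂ c).lTensor A).lTensor A
      ((H.T₄.toLinearMap ∘ₗ TensorProduct.mk ℂ A A e).lTensor A y) =
      ((LinearMap.mulLeft ℂ e).lTensor A).lTensor A
        (H.T₁.toLinearMap.lTensor A (TensorProduct.assoc ℂ A A A (y ⊗ₜ c))) := by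
    intro y
    induction y with
    | zero => simp
    | add y y' h h' => simp only [map_add, TensorProduct.add_tmul, h, h']
    | tmul v w =>
      simp only [LinearMap.lTensor_tmul, TensorProduct.assoc_tmul]
      congr 1
      exact H.T₄_T₁ e w c
  rw [h1, T₄_T₁, ← h2, ← h3, coassoc_T₂_T₁, h4]

end RegularMultiplierHopf

end MultiplierHopf

/-! ### Right module algebras and the twist maps -/

section ModuleAlgebra

variable {A : Type u} [NonUnitalRing A] [Module ℂ A] [IsScalarTower ℂ A A] [SMulCommClass ℂ A A]
variable {B : Type v} [NonUnitalRing B] [Module ℂ B] [IsScalarTower ℂ B B] [SMulCommClass ℂ B B]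

variable (B) in
/-- A right `A`-module algebra structure on `B`: a unital right action `b ◁ a` (written `act b a`) with
`b b' ◁ a = ∑ (b ◁ a₍₁₎)(b' ◁ a₍₂₎)`. Since `B` is spanned by the elements `b' ◁ e`, this formula is
stated for `b' ◁ e` in place of `b'`, so that the right-hand side is
`∑ (b ◁ a₍₁₎)(b' ◁ (e a₍₂₎))` with `∑ a₍₁₎ ⊗ e a₍₂₎ = (1 ⊗ e)Δ(a) ∈ A ⊗ A`. -/
structure RightModuleAlgebra (H : RegularMultiplierHopf A) where
  act : B →ₗ[ℂ] A →ₗ[ℂ] B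
  act_mul : ∀ b a a', act b (a * a') = act (act b a) a'
  unital : Submodule.span ℂ {z : B | ∃ b a, z = act b a} = ⊤
  mul_act : ∀ b b' e a, act (b * act b' e) a =
    LinearMap.mul' ℂ B (TensorProduct.map (act b) (act b') (H.T₄ (e ⊗ₜ a)))

namespace RightModuleAlgebra

variable {H : RegularMultiplierHopf A} (α : RightModuleAlgebra B H)

theorem span_act_tmul : Submodule.span ℂ {z : B ⊗[ℂ] A | ∃ b e a, z = α.act b e ⊗ₜ a} = ⊤ := by
  rw [eq_top_iff, ← TensorProduct.span_tmul_eq_top, Submodule.span_le]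
  rintro _ ⟨b, a, rfl⟩
  have hb : b ∈ Submodule.span ℂ {z : B | ∃ b a, z = α.act b a} := by rw [α.unital]; trivial
  induction hb using Submodule.span_induction with
  | mem x hx =>
    obtain ⟨b, e, rfl⟩ := hx
    exact Submodule.subset_span ⟨b, e, a, rfl⟩
  | zero => simp
  | add x y _ _ hx hy => rw [TensorProduct.add_tmul]; exact add_mem hx hy
  | smul c x _ hx => rw [← TensorProduct.smul_tmul']; exact Submodule.smul_mem _ c hx

theorem rTensor_mulLeft_cancel (H : RegularMultiplierHopf A) (z z' : A ⊗[ℂ] B)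
    (h : ∀ a : A, (LinearMap.mulLeft ℂ a).rTensor B z = (LinearMap.mulLeft ℂ a).rTensor B z') :
    z = z' :=
  RegularMultiplierHopf.eq_of_rTensor (fun a : A => LinearMap.mulLeft ℂ a) H.mulLeft_cancel h

theorem lTensor_act_act (b : B) (e : A) (t : A ⊗[ℂ] A) : (α.act (α.act b e)).lTensor A t =
    (α.act b).lTensor A ((LinearMap.mulLeft ℂ e).lTensor A t) := by
  induction t with
  | zero => simp
  | add y y' h h' => simp only [map_add, h, h']
  | tmul v w => simp [α.act_mul]

theorem rTensor_lTensor_act (b : B) (a : A) (t : A ⊗[ℂ] A) :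
    (LinearMap.mulLeft ℂ a).rTensor B ((α.act b).lTensor A t) =
    (α.act b).lTensor A ((LinearMap.mulLeft ℂ a).rTensor A t) := by
  induction t with
  | zero => simp
  | add y y' h h' => simp only [map_add, h, h']
  | tmul v w => simp

theorem exists_twist : ∃ R : B ⊗[ℂ] A →ₗ[ℂ] A ⊗[ℂ] B, ∀ (x : B ⊗[ℂ] A) (a' : A),
    (LinearMap.mulLeft ℂ a').rTensor B (R x) =
      TensorProduct.lift ((LinearMap.lTensorHom A ∘ₗ α.act).compl₂
        (H.T₂.toLinearMap ∘ₗ TensorProduct.mk ℂ A A a')) x := by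
  apply RegularMultiplierHopf.exists_covered (fun a' : A => (LinearMap.mulLeft ℂ a').rTensor B) _
    (rTensor_mulLeft_cancel H) _ α.span_act_tmul
  rintro _ ⟨b, e, a, rfl⟩
  refine ⟨(α.act b).lTensor A (H.T₄ (e ⊗ₜ a)), fun a' => ?_⟩
  rw [rTensor_lTensor_act, H.T₄_T₂]
  exact (α.lTensor_act_act b e _).symm

/-- The twist map `R(b ⊗ a) = ∑ a₍₁₎ ⊗ (b ◁ a₍₂₎)`, determined by `twist_spec`. -/
def twist : B ⊗[ℂ] A →ₗ[ℂ] A ⊗[ℂ] B := α.exists_twist.choose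

/-- `(a' ⊗ 1)R(b ⊗ a) = ∑ a' a₍₁₎ ⊗ (b ◁ a₍₂₎)`. -/
theorem twist_spec (a' : A) (b : B) (a : A) :
    (LinearMap.mulLeft ℂ a').rTensor B (α.twist (b ⊗ₜ a)) =
      (α.act b).lTensor A (H.T₂ (a' ⊗ₜ a)) :=
  α.exists_twist.choose_spec (b ⊗ₜ a) a'

theorem exists_twistOp : ∃ R : B ⊗[ℂ] A →ₗ[ℂ] A ⊗[ℂ] B, ∀ (x : B ⊗[ℂ] A) (a' : A),
    (LinearMap.mulLeft ℂ a').rTensor B (R x) =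
      TensorProduct.lift ((LinearMap.lTensorHom A ∘ₗ α.act).compl₂
        ((H.T₄.trans (TensorProduct.comm ℂ A A)).toLinearMap ∘ₗ TensorProduct.mk ℂ A A a')) x := by
  apply RegularMultiplierHopf.exists_covered (fun a' : A => (LinearMap.mulLeft ℂ a').rTensor B) _
    (rTensor_mulLeft_cancel H) _ α.span_act_tmul
  rintro _ ⟨b, e, a, rfl⟩
  refine ⟨(α.act b).lTensor A (TensorProduct.comm ℂ A A (H.T₂ (e ⊗ₜ a))), fun a' => ?_⟩
  have h1 : ∀ (c : A) (t : A ⊗[ℂ] A), (LinearMap.mulLeft ℂ c).rTensor A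
      (TensorProduct.comm ℂ A A t) =
      TensorProduct.comm ℂ A A ((LinearMap.mulLeft ℂ c).lTensor A t) := by
    intro c t
    induction t with
    | zero => simp
    | add y y' h h' => simp only [map_add, h, h']
    | tmul v w => simp
  have h2 : ∀ (c : A) (t : A ⊗[ℂ] A), (LinearMap.mulLeft ℂ c).lTensor A
      (TensorProduct.comm ℂ A A t) =
      TensorProduct.comm ℂ A A ((LinearMap.mulLeft ℂ c).rTensor A t) := by
    intro c t
    induction t with
    | zero => simp
    | add y y' h h' => simp only [map_add, h, h']
    | tmul v w => simp
  rw [rTensor_lTensor_act, h1, ← H.T₄_T₂, ← h2]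
  exact (α.lTensor_act_act b e _).symm

/-- The twist map for the opposite coproduct, `Rᵒᵖ(b ⊗ a) = ∑ a₍₂₎ ⊗ (b ◁ a₍₁₎)`, determined by
`twistOp_spec`. -/
def twistOp : B ⊗[ℂ] A →ₗ[ℂ] A ⊗[ℂ] B := α.exists_twistOp.choose

/-- `(a' ⊗ 1)Rᵒᵖ(b ⊗ a) = ∑ a' a₍₂₎ ⊗ (b ◁ a₍₁₎)`. -/
theorem twistOp_spec (a' : A) (b : B) (a : A) :
    (LinearMap.mulLeft ℂ a').rTensor B (α.twistOp (b ⊗ₜ a)) =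
      (α.act b).lTensor A (TensorProduct.comm ℂ A A (H.T₄ (a' ⊗ₜ a))) :=
  α.exists_twistOp.choose_spec (b ⊗ₜ a) a'

theorem twist_act (b : B) (e a : A) :
    α.twist (α.act b e ⊗ₜ a) = (α.act b).lTensor A (H.T₄ (e ⊗ₜ a)) := by
  apply rTensor_mulLeft_cancel H
  intro c
  rw [twist_spec, lTensor_act_act, rTensor_lTensor_act, H.T₄_T₂]

theorem twistOp_act (b : B) (e a : A) : α.twistOp (α.act b e ⊗ₜ a) =
    (α.act b).lTensor A (TensorProduct.comm ℂ A A (H.T₂ (e ⊗ₜ a))) := by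
  apply rTensor_mulLeft_cancel H
  intro c
  rw [twistOp_spec, lTensor_act_act, rTensor_lTensor_act]
  have h1 : ∀ (c : A) (t : A ⊗[ℂ] A), (LinearMap.mulLeft ℂ c).rTensor A
      (TensorProduct.comm ℂ A A t) =
      TensorProduct.comm ℂ A A ((LinearMap.mulLeft ℂ c).lTensor A t) := by
    intro c t
    induction t with
    | zero => simp
    | add y y' h h' => simp only [map_add, h, h']
    | tmul v w => simp
  have h2 : ∀ (c : A) (t : A ⊗[ℂ] A), (LinearMap.mulLeft ℂ c).lTensor A
      (TensorProduct.comm ℂ A A t) =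
      TensorProduct.comm ℂ A A ((LinearMap.mulLeft ℂ c).rTensor A t) := by
    intro c t
    induction t with
    | zero => simp
    | add y y' h h' => simp only [map_add, h, h']
    | tmul v w => simp
  rw [h1, ← H.T₄_T₂, h2]

theorem twistOp_surjective : Function.Surjective α.twistOp := by
  rw [← LinearMap.range_eq_top, eq_top_iff, ← TensorProduct.span_tmul_eq_top, Submodule.span_le]
  rintro _ ⟨x, b, rfl⟩
  have hb : b ∈ Submodule.span ℂ {z : B | ∃ b a, z = α.act b a} := by rw [α.unital]; trivial
  induction hb using Submodule.span_induction with
  | zero => simp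
  | add y z _ _ hy hz => rw [TensorProduct.tmul_add]; exact add_mem hy hz
  | smul c y _ hy => rw [TensorProduct.tmul_smul]; exact Submodule.smul_mem _ c hy
  | mem y hy =>
    obtain ⟨b, y, rfl⟩ := hy
    have key : ∀ t : A ⊗[ℂ] A, (α.act b).lTensor A (TensorProduct.comm ℂ A A (H.T₂ t)) =
        α.twistOp ((α.act b).rTensor A t) := by
      intro t
      induction t with
      | zero => simp
      | add y y' h h' => simp only [map_add, h, h']
      | tmul e a => rw [LinearMap.rTensor_tmul, twistOp_act]
    refine ⟨(α.act b).rTensor A (H.T₂.symm (y ⊗ₜ x)), ?_⟩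
    rw [← key]
    simp

/-- `x ⊗ y ↦ (1 ⊗ y)Rᵒᵖ(b ⊗ x)` on `A ⊗ B`. -/
def twistOpMul (b : B) : A ⊗[ℂ] B →ₗ[ℂ] A ⊗[ℂ] B :=
  (LinearMap.mul' ℂ B ∘ₗ (TensorProduct.comm ℂ B B).toLinearMap).lTensor A ∘ₗ
    (TensorProduct.assoc ℂ A B B).toLinearMap ∘ₗ
      (α.twistOp ∘ₗ TensorProduct.mk ℂ B A b).rTensor B

theorem twistOpMul_tmul (b y : B) (x : A) : α.twistOpMul b (x ⊗ₜ y) =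
    (LinearMap.mulLeft ℂ y).lTensor A (α.twistOp (b ⊗ₜ x)) := by
  simp only [twistOpMul, LinearMap.comp_apply, LinearMap.rTensor_tmul, TensorProduct.mk_apply]
  generalize α.twistOp (b ⊗ₜ x) = z
  induction z with
  | zero => simp
  | add y y' h h' => simp only [map_add, TensorProduct.add_tmul, h, h']
  | tmul v w => simp

/-- Both sides are `∑ a₍₃₎ ⊗ (b ◁ a₍₁₎)(b' ◁ a₍₂₎)`. -/
theorem twistOp_mul (b b' : B) (a : A) :
    α.twistOp ((b * b') ⊗ₜ a) = α.twistOpMul b' (α.twistOp (b ⊗ₜ a)) := by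
  have hlin : ∀ x y : B, α.twistOpMul (x + y) = α.twistOpMul x + α.twistOpMul y := by
    intro x y
    apply TensorProduct.ext'
    intro u v
    rw [LinearMap.add_apply]
    simp only [twistOpMul_tmul, TensorProduct.add_tmul, map_add]
  have hlin0 : α.twistOpMul 0 = 0 := by
    apply TensorProduct.ext'
    intro u v
    simp [twistOpMul_tmul]
  have hlins : ∀ (c : ℂ) (x : B), α.twistOpMul (c • x) = c • α.twistOpMul x := by
    intro c x
    apply TensorProduct.ext'
    intro u v
    rw [LinearMap.smul_apply]
    simp only [twistOpMul_tmul, ← TensorProduct.smul_tmul', map_smul]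
  have hb : b ∈ Submodule.span ℂ {z : B | ∃ b a, z = α.act b a} := by rw [α.unital]; trivial
  have hb' : b' ∈ Submodule.span ℂ {z : B | ∃ b a, z = α.act b a} := by rw [α.unital]; trivial
  induction hb' using Submodule.span_induction with
  | zero => simp [hlin0]
  | add x y _ _ hx hy =>
    simp only [mul_add, TensorProduct.add_tmul, map_add, hx, hy, hlin, LinearMap.add_apply]
  | smul c x _ hx =>
    simp only [mul_smul_comm, ← TensorProduct.smul_tmul', map_smul, hx, hlins, LinearMap.smul_apply]
  | mem x hx =>
  obtain ⟨b₀, e, rfl⟩ := hx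
  induction hb using Submodule.span_induction with
  | zero => simp
  | add x y _ _ hx hy => simp only [add_mul, TensorProduct.add_tmul, map_add, hx, hy]
  | smul c x _ hx => simp only [smul_mul_assoc, ← TensorProduct.smul_tmul', map_smul, hx]
  | mem x hx =>
  obtain ⟨b₁, f, rfl⟩ := hx
  apply rTensor_mulLeft_cancel H
  intro c
  rw [twistOp_spec, twistOp_act]
  have h0 : ∀ y : A, α.act (α.act b₁ f * α.act b₀ e) y =
      (LinearMap.mul' ℂ B ∘ₗ TensorProduct.map (α.act b₁) (α.act b₀))
        ((LinearMap.mulLeft ℂ e).lTensor A (H.T₂ (f ⊗ₜ y))) := by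
    intro y
    rw [α.mul_act, ← H.T₄_T₂]
    generalize H.T₄ (e ⊗ₜ y) = t
    induction t with
    | zero => simp
    | add y y' h h' => simp only [map_add, h, h']
    | tmul v w => simp [α.act_mul]
  have h1 : ∀ t : A ⊗[ℂ] A, (α.act (α.act b₁ f * α.act b₀ e)).lTensor A
      (TensorProduct.comm ℂ A A t) = TensorProduct.comm ℂ B A
        ((LinearMap.mul' ℂ B ∘ₗ TensorProduct.map (α.act b₁) (α.act b₀) ∘ₗ
          (LinearMap.mulLeft ℂ e).lTensor A).rTensor A
            ((TensorProduct.assoc ℂ A A A).symm (TensorProduct.assoc ℂ A A A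
              ((H.T₂.toLinearMap ∘ₗ TensorProduct.mk ℂ A A f).rTensor A t)))) := by
    intro t
    induction t with
    | zero => simp
    | add y y' h h' => simp only [map_add, h, h']
    | tmul y w =>
      rw [LinearEquiv.symm_apply_apply]
      simp only [TensorProduct.comm_tmul, LinearMap.lTensor_tmul, LinearMap.rTensor_tmul, h0]
      rfl
  have h2 : ∀ t : A ⊗[ℂ] A, (LinearMap.mulLeft ℂ c).rTensor B (α.twistOpMul (α.act b₀ e)
      ((α.act b₁).lTensor A (TensorProduct.comm ℂ A A t))) = TensorProduct.comm ℂ B A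
        ((LinearMap.mul' ℂ B ∘ₗ TensorProduct.map (α.act b₁) (α.act b₀) ∘ₗ
          (LinearMap.mulLeft ℂ e).lTensor A).rTensor A
            ((TensorProduct.assoc ℂ A A A).symm
              ((H.T₄.toLinearMap ∘ₗ TensorProduct.mk ℂ A A c).lTensor A t))) := by
    intro t
    induction t with
    | zero => simp
    | add y y' h h' => simp only [map_add, h, h']
    | tmul u x =>
      rw [TensorProduct.comm_tmul, LinearMap.lTensor_tmul, twistOpMul_tmul, LinearMap.lTensor_tmul]
      have h3 : ∀ z : A ⊗[ℂ] B, (LinearMap.mulLeft ℂ c).rTensor B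
          ((LinearMap.mulLeft ℂ (α.act b₁ u)).lTensor A z) =
          (LinearMap.mulLeft ℂ (α.act b₁ u)).lTensor A
            ((LinearMap.mulLeft ℂ c).rTensor B z) := by
        intro z
        induction z with
        | zero => simp
        | add y y' h h' => simp only [map_add, h, h']
        | tmul p q => simp
      rw [h3, twistOp_spec]
      simp only [LinearMap.comp_apply, LinearEquiv.coe_coe, TensorProduct.mk_apply]
      generalize H.T₄ (c ⊗ₜ x) = t
      induction t with
      | zero => simp
      | add y y' h h' => simp only [map_add, TensorProduct.tmul_add, h, h']
      | tmul p q => simp [α.act_mul]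
  rw [h1, h2, H.coassoc_T₂_T₄]

/-! ### The smash product -/

/-- `x ⊗ y ↦ (x ⊗ 1)R(y ⊗ a)` on `A ⊗ B`: right multiplication by `a ∈ A` in the smash product. -/
def mulRightA (a : A) : A ⊗[ℂ] B →ₗ[ℂ] A ⊗[ℂ] B :=
  (LinearMap.mul' ℂ A).rTensor B ∘ₗ (TensorProduct.assoc ℂ A A B).symm.toLinearMap ∘ₗ
    (α.twist ∘ₗ (TensorProduct.mk ℂ B A).flip a).lTensor A

/-- `u ⊗ v ↦ R(b ⊗ u)(1 ⊗ v)` on `A ⊗ B`: left multiplication by `b ∈ B` in the smash product. -/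
def mulLeftB (b : B) : A ⊗[ℂ] B →ₗ[ℂ] A ⊗[ℂ] B :=
  (LinearMap.mul' ℂ B).lTensor A ∘ₗ (TensorProduct.assoc ℂ A B B).toLinearMap ∘ₗ
    (α.twist ∘ₗ TensorProduct.mk ℂ B A b).rTensor B

theorem mulRightA_tmul (a x : A) (y : B) : α.mulRightA a (x ⊗ₜ y) =
    (LinearMap.mulLeft ℂ x).rTensor B (α.twist (y ⊗ₜ a)) := by
  simp only [mulRightA, LinearMap.comp_apply, LinearMap.lTensor_tmul, LinearMap.flip_apply,
    TensorProduct.mk_apply]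
  generalize α.twist (y ⊗ₜ a) = z
  induction z with
  | zero => simp
  | add y y' h h' => simp only [map_add, TensorProduct.tmul_add, h, h']
  | tmul v w => simp

theorem mulLeftB_tmul (b v : B) (u : A) : α.mulLeftB b (u ⊗ₜ v) =
    (LinearMap.mulRight ℂ v).lTensor A (α.twist (b ⊗ₜ u)) := by
  simp only [mulLeftB, LinearMap.comp_apply, LinearMap.rTensor_tmul, TensorProduct.mk_apply]
  generalize α.twist (b ⊗ₜ u) = z
  induction z with
  | zero => simp
  | add y y' h h' => simp only [map_add, TensorProduct.add_tmul, h, h']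
  | tmul v w => simp

theorem rTensor_mulRightA (c a : A) (z : A ⊗[ℂ] B) :
    (LinearMap.mulLeft ℂ c).rTensor B (α.mulRightA a z) =
      α.mulRightA a ((LinearMap.mulLeft ℂ c).rTensor B z) := by
  induction z with
  | zero => simp
  | add y y' h h' => simp only [map_add, h, h']
  | tmul v w =>
    rw [mulRightA_tmul, LinearMap.rTensor_tmul, mulRightA_tmul]
    generalize α.twist (w ⊗ₜ a) = z
    induction z with
    | zero => simp
    | add y y' h h' => simp only [map_add, h, h']
    | tmul v w => simp

/-- `R(ι ⊗ m_A) = (m_A ⊗ ι)(ι ⊗ R)(R ⊗ ι)`. -/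
theorem twist_mul_right (b : B) (a a' : A) :
    α.twist (b ⊗ₜ (a * a')) = α.mulRightA a' (α.twist (b ⊗ₜ a)) := by
  apply rTensor_mulLeft_cancel H
  intro c
  rw [twist_spec, rTensor_mulRightA, twist_spec, H.T₂_mul]
  generalize H.T₂ (c ⊗ₜ a) = t
  induction t with
  | zero => simp
  | add y y' h h' => simp only [map_add, h, h']
  | tmul p q =>
    rw [H.mulComul_tmul, ← lTensor_act_act, LinearMap.lTensor_tmul, mulRightA_tmul, twist_spec]

/-- `R(m_B ⊗ ι) = (ι ⊗ m_B)(R ⊗ ι)(ι ⊗ R)`. -/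
theorem twist_mul_left (b b' : B) (a : A) :
    α.twist ((b * b') ⊗ₜ a) = α.mulLeftB b (α.twist (b' ⊗ₜ a)) := by
  have hb : b' ∈ Submodule.span ℂ {z : B | ∃ b a, z = α.act b a} := by rw [α.unital]; trivial
  induction hb using Submodule.span_induction with
  | zero => simp
  | add x y _ _ hx hy => simp only [mul_add, TensorProduct.add_tmul, map_add, hx, hy]
  | smul c x _ hx => simp only [mul_smul_comm, ← TensorProduct.smul_tmul', map_smul, hx]
  | mem x hx =>
    obtain ⟨b₀, e, rfl⟩ := hx
    apply rTensor_mulLeft_cancel H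
    intro c
    have h1 : ∀ t : A ⊗[ℂ] A, (α.act (b * α.act b₀ e)).lTensor A t =
        (LinearMap.mul' ℂ B ∘ₗ TensorProduct.map (α.act b) (α.act b₀)).lTensor A
          ((H.T₄.toLinearMap ∘ₗ TensorProduct.mk ℂ A A e).lTensor A t) := by
      intro t
      induction t with
      | zero => simp
      | add y y' h h' => simp only [map_add, h, h']
      | tmul p q => simp [α.mul_act]
    have h2 : ∀ s : A ⊗[ℂ] A, (LinearMap.mulLeft ℂ c).rTensor B
        (α.mulLeftB b ((α.act b₀).lTensor A s)) =
        (LinearMap.mul' ℂ B ∘ₗ TensorProduct.map (α.act b) (α.act b₀)).lTensor A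
          (TensorProduct.assoc ℂ A A A
            ((H.T₂.toLinearMap ∘ₗ TensorProduct.mk ℂ A A c).rTensor A s)) := by
      intro s
      induction s with
      | zero => simp
      | add y y' h h' => simp only [map_add, h, h']
      | tmul u w =>
        rw [LinearMap.lTensor_tmul, mulLeftB_tmul, LinearMap.rTensor_tmul]
        have h3 : ∀ z : A ⊗[ℂ] B, (LinearMap.mulLeft ℂ c).rTensor B
            ((LinearMap.mulRight ℂ (α.act b₀ w)).lTensor A z) =
            (LinearMap.mulRight ℂ (α.act b₀ w)).lTensor A
              ((LinearMap.mulLeft ℂ c).rTensor B z) := by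
          intro z
          induction z with
          | zero => simp
          | add y y' h h' => simp only [map_add, h, h']
          | tmul p q => simp
        rw [h3, twist_spec]
        simp only [LinearMap.comp_apply, LinearEquiv.coe_coe, TensorProduct.mk_apply]
        generalize H.T₂ (c ⊗ₜ u) = t
        induction t with
        | zero => simp
        | add y y' h h' => simp only [map_add, TensorProduct.add_tmul, h, h']
        | tmul p q => simp
    rw [twist_spec, h1, twist_act, h2, H.coassoc_T₂_T₄]

/-- The multiplication `m = (m_A ⊗ m_B)(ι ⊗ R ⊗ ι)` of the smash product, i.e.
`(a # b)(a' # b') = ∑ a a'₍₁₎ # (b ◁ a'₍₂₎) b'`. -/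
def smashMul : (A ⊗[ℂ] B) ⊗[ℂ] (A ⊗[ℂ] B) →ₗ[ℂ] A ⊗[ℂ] B :=
  TensorProduct.map (LinearMap.mul' ℂ A) (LinearMap.mul' ℂ B) ∘ₗ
    (TensorProduct.assoc ℂ A A (B ⊗[ℂ] B)).symm.toLinearMap ∘ₗ
    (TensorProduct.assoc ℂ A B B).toLinearMap.lTensor A ∘ₗ
    (α.twist.rTensor B).lTensor A ∘ₗ
    (TensorProduct.assoc ℂ B A B).symm.toLinearMap.lTensor A ∘ₗ
    (TensorProduct.assoc ℂ A B (A ⊗[ℂ] B)).toLinearMap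

theorem smashMul_tmul (a a' : A) (b b' : B) : α.smashMul ((a ⊗ₜ b) ⊗ₜ (a' ⊗ₜ b')) =
    TensorProduct.map (LinearMap.mulLeft ℂ a) (LinearMap.mulRight ℂ b') (α.twist (b ⊗ₜ a')) := by
  simp only [smashMul, LinearMap.comp_apply, LinearEquiv.coe_coe, TensorProduct.assoc_tmul,
    TensorProduct.assoc_symm_tmul, LinearMap.lTensor_tmul, LinearMap.rTensor_tmul]
  generalize α.twist (b ⊗ₜ a') = z
  induction z with
  | zero => simp
  | add y y' h h' => simp only [map_add, TensorProduct.add_tmul, TensorProduct.tmul_add, h, h']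
  | tmul v w => simp

theorem smashMul_tmul_left (x : A) (y : B) (w : A ⊗[ℂ] B) :
    α.smashMul ((x ⊗ₜ y) ⊗ₜ w) = (LinearMap.mulLeft ℂ x).rTensor B (α.mulLeftB y w) := by
  induction w with
  | zero => simp
  | add y y' h h' => simp only [map_add, TensorProduct.tmul_add, h, h']
  | tmul u v =>
    rw [smashMul_tmul, mulLeftB_tmul]
    generalize α.twist (y ⊗ₜ u) = z
    induction z with
    | zero => simp
    | add y y' h h' => simp only [map_add, h, h']
    | tmul v w => simp

theorem smashMul_tmul_right (z : A ⊗[ℂ] B) (u : A) (v : B) :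
    α.smashMul (z ⊗ₜ (u ⊗ₜ v)) = (LinearMap.mulRight ℂ v).lTensor A (α.mulRightA u z) := by
  induction z with
  | zero => simp
  | add y y' h h' => simp only [map_add, TensorProduct.add_tmul, h, h']
  | tmul x y =>
    rw [smashMul_tmul, mulRightA_tmul]
    generalize α.twist (y ⊗ₜ u) = z
    induction z with
    | zero => simp
    | add y y' h h' => simp only [map_add, h, h']
    | tmul v w => simp

theorem smashMul_rTensor (a : A) (z w : A ⊗[ℂ] B) :
    α.smashMul ((LinearMap.mulLeft ℂ a).rTensor B z ⊗ₜ w) =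
      (LinearMap.mulLeft ℂ a).rTensor B (α.smashMul (z ⊗ₜ w)) := by
  induction z with
  | zero => simp
  | add y y' h h' => simp only [map_add, TensorProduct.add_tmul, h, h']
  | tmul x y =>
    rw [LinearMap.rTensor_tmul, smashMul_tmul_left, smashMul_tmul_left,
      ← LinearMap.rTensor_comp_apply]
    congr 2
    ext t
    simp

theorem smashMul_lTensor (b : B) (z w : A ⊗[ℂ] B) :
    α.smashMul (z ⊗ₜ (LinearMap.mulRight ℂ b).lTensor A w) =
      (LinearMap.mulRight ℂ b).lTensor A (α.smashMul (z ⊗ₜ w)) := by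
  induction w with
  | zero => simp
  | add y y' h h' => simp only [map_add, TensorProduct.tmul_add, h, h']
  | tmul u v =>
    rw [LinearMap.lTensor_tmul, smashMul_tmul_right, smashMul_tmul_right,
      ← LinearMap.lTensor_comp_apply]
    congr 2
    ext t
    simp [mul_assoc]

theorem smashMul_mulRightA (a : A) (z w : A ⊗[ℂ] B) :
    α.smashMul (z ⊗ₜ (LinearMap.mulLeft ℂ a).rTensor B w) =
      α.smashMul (α.mulRightA a z ⊗ₜ w) := by
  induction z with
  | zero => simp
  | add y y' h h' => simp only [map_add, TensorProduct.add_tmul, h, h']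
  | tmul x y =>
    induction w with
    | zero => simp
    | add y y' h h' => simp only [map_add, TensorProduct.tmul_add, h, h']
    | tmul u v =>
      rw [LinearMap.rTensor_tmul, smashMul_tmul_right, smashMul_tmul_right, mulRightA_tmul,
        mulRightA_tmul, ← rTensor_mulRightA, LinearMap.mulLeft_apply, twist_mul_right]

theorem smashMul_mulLeftB (b : B) (z w : A ⊗[ℂ] B) :
    α.smashMul (z ⊗ₜ α.mulLeftB b w) =
      α.smashMul ((LinearMap.mulRight ℂ b).lTensor A z ⊗ₜ w) := by
  induction z with
  | zero => simp
  | add y y' h h' => simp only [map_add, TensorProduct.add_tmul, h, h']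
  | tmul x y =>
    induction w with
    | zero => simp
    | add y y' h h' => simp only [map_add, TensorProduct.tmul_add, h, h']
    | tmul u v =>
      rw [LinearMap.lTensor_tmul, mulLeftB_tmul, smashMul_lTensor, smashMul_tmul_left,
        LinearMap.mulRight_apply, smashMul_tmul_left, mulLeftB_tmul, twist_mul_left]
      generalize α.mulLeftB y (α.twist (b ⊗ₜ u)) = t
      induction t with
      | zero => simp
      | add y y' h h' => simp only [map_add, h, h']
      | tmul v w => simp

theorem smashMul_assoc (x y z : A ⊗[ℂ] B) :
    α.smashMul (α.smashMul (x ⊗ₜ y) ⊗ₜ z) = α.smashMul (x ⊗ₜ α.smashMul (y ⊗ₜ z)) := by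
  induction y with
  | zero => simp
  | add y y' h h' => simp only [map_add, TensorProduct.add_tmul, TensorProduct.tmul_add, h, h']
  | tmul a b =>
    rw [smashMul_tmul_right, smashMul_tmul_left, smashMul_mulRightA, smashMul_mulLeftB]

/-- The smash product `A # B`, also denoted `AB`: the space `A ⊗ B` with the product
`(a # b)(a' # b') = ∑ a a'₍₁₎ # (b ◁ a'₍₂₎) b'`. -/
def Smash (_α : RightModuleAlgebra B H) : Type (max u v) := A ⊗[ℂ] B

instance : AddCommGroup α.Smash := inferInstanceAs (AddCommGroup (A ⊗[ℂ] B))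

instance : Module ℂ α.Smash := inferInstanceAs (Module ℂ (A ⊗[ℂ] B))

/-- The identification of the space `A ⊗ B` with `A # B`, sending `a ⊗ b` to `a # b`. -/
def toSmash : A ⊗[ℂ] B ≃ₗ[ℂ] α.Smash := LinearEquiv.refl ℂ (A ⊗[ℂ] B)

instance : NonUnitalRing α.Smash where
  __ := (inferInstance : AddCommGroup α.Smash)
  mul x y := α.toSmash (α.smashMul (α.toSmash.symm x ⊗ₜ α.toSmash.symm y))
  left_distrib x y z := by
    change α.toSmash _ = α.toSmash _ + α.toSmash _
    rw [map_add, TensorProduct.tmul_add, map_add, map_add]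
  right_distrib x y z := by
    change α.toSmash _ = α.toSmash _ + α.toSmash _
    rw [map_add, TensorProduct.add_tmul, map_add, map_add]
  zero_mul x := by
    change α.toSmash _ = _
    rw [map_zero, TensorProduct.zero_tmul, map_zero, map_zero]
  mul_zero x := by
    change α.toSmash _ = _
    rw [map_zero, TensorProduct.tmul_zero, map_zero, map_zero]
  mul_assoc x y z := congrArg α.toSmash (α.smashMul_assoc _ _ _)

theorem smash_mul_def (x y : α.Smash) :
    x * y = α.toSmash (α.smashMul (α.toSmash.symm x ⊗ₜ α.toSmash.symm y)) := rfl

instance : IsScalarTower ℂ α.Smash α.Smash where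
  smul_assoc c x y := by
    simp only [smul_eq_mul, smash_mul_def, map_smul, ← TensorProduct.smul_tmul']

instance : SMulCommClass ℂ α.Smash α.Smash where
  smul_comm c x y := by
    simp only [smul_eq_mul, smash_mul_def, map_smul, TensorProduct.tmul_smul]

/-- `π_A : A → M(A # B)`, with `π_A(a)(a' # b') = a a' # b'`. -/
def smashA (a : A) : Multiplier α.Smash :=
  Multiplier.mk (α.toSmash.conj ((LinearMap.mulLeft ℂ a).rTensor B)) (α.toSmash.conj (α.mulRightA a))
    fun x y => by
      simp only [smash_mul_def, LinearEquiv.conj_apply_apply, LinearEquiv.symm_apply_apply]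
      rw [smashMul_mulRightA]

/-- `π_B : B → M(A # B)`, with `(a' # b')π_B(b) = a' # b' b`. -/
def smashB (b : B) : Multiplier α.Smash :=
  Multiplier.mk (α.toSmash.conj (α.mulLeftB b)) (α.toSmash.conj ((LinearMap.mulRight ℂ b).lTensor A))
    fun x y => by
      simp only [smash_mul_def, LinearEquiv.conj_apply_apply, LinearEquiv.symm_apply_apply]
      rw [smashMul_mulLeftB]

end RightModuleAlgebra

end ModuleAlgebra

/-! ### Coactions and comodule coalgebras -/

section Comodule

variable {A : Type u} [NonUnitalRing A] [Module ℂ A] [IsScalarTower ℂ A A] [SMulCommClass ℂ A A]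
variable {B : Type v} [NonUnitalRing B] [Module ℂ B] [IsScalarTower ℂ B B] [SMulCommClass ℂ B B]

/-- The completion `M₀(B ⊗ V)` of the `B`-bimodule `B ⊗ V`: an element `y` is given by the pair of
linear maps `b ↦ y(b ⊗ 1)` and `b ↦ (b ⊗ 1)y` from `B` to `B ⊗ V`, subject to
`(b ⊗ 1)(y(b' ⊗ 1)) = ((b ⊗ 1)y)(b' ⊗ 1)`. -/
def CompletedModule (B : Type v) [NonUnitalRing B] [Module ℂ B] [IsScalarTower ℂ B B]
    [SMulCommClass ℂ B B] (V : Type u) [AddCommGroup V] [Module ℂ V] :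
    Submodule ℂ ((B →ₗ[ℂ] B ⊗[ℂ] V) × (B →ₗ[ℂ] B ⊗[ℂ] V)) where
  carrier := {y | ∀ b b' : B, (LinearMap.mulLeft ℂ b).rTensor V (y.1 b') =
    (LinearMap.mulRight ℂ b').rTensor V (y.2 b)}
  add_mem' := by
    intro y z hy hz b b'
    simp only [Set.mem_ofPred_eq] at hy hz
    simp [hy, hz]
  zero_mem' := by intro b b'; simp
  smul_mem' := by
    intro c y hy b b'
    simp only [Set.mem_ofPred_eq] at hy
    simp [hy]

/-- The cotwist map `T(a ⊗ b) = Γ(a)(b ⊗ 1)`. -/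
def cotwist (Γ : A →ₗ[ℂ] CompletedModule B A) : A ⊗[ℂ] B →ₗ[ℂ] B ⊗[ℂ] A :=
  TensorProduct.lift (LinearMap.fst ℂ _ _ ∘ₗ (CompletedModule B A).subtype ∘ₗ Γ)

/-- The opposite cotwist map `Tᵒᵖ(a ⊗ b) = (b ⊗ 1)Γ(a)`. -/
def cotwistOp (Γ : A →ₗ[ℂ] CompletedModule B A) : A ⊗[ℂ] B →ₗ[ℂ] B ⊗[ℂ] A :=
  TensorProduct.lift (LinearMap.snd ℂ _ _ ∘ₗ (CompletedModule B A).subtype ∘ₗ Γ)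

variable (A) in
/-- A left coaction of `B` on `A`: an injective linear map `Γ : A → M₀(B ⊗ A)` with
`(ι ⊗ Γ)Γ = (Δ_B ⊗ ι)Γ` in `M₀(B ⊗ B ⊗ A)`. The equality is stated after multiplication on the right by
`Δ(p)(q ⊗ 1) ⊗ 1` (these elements span `B ⊗ B ⊗ 1`), where
`(ι ⊗ Γ)Γ(a)(b ⊗ b' ⊗ 1) = (ι ⊗ T)(Γ(a)(b ⊗ 1) ⊗ b')` and
`(Δ ⊗ ι)Γ(a)(Δ(p)(q ⊗ 1) ⊗ 1) = (Δ ⊗ ι)(Γ(a)(p ⊗ 1))(q ⊗ 1 ⊗ 1)`, and similarly on the left by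
`(q ⊗ 1)Δ(p) ⊗ 1`. -/
structure LeftCoaction (K : RegularMultiplierHopf B) where
  coact : A →ₗ[ℂ] CompletedModule B A
  injective : Function.Injective coact
  coassoc_right : ∀ (a : A) (p q : B),
    (cotwist coact).lTensor B (TensorProduct.assoc ℂ B A B ((cotwist coact).rTensor B
        ((TensorProduct.assoc ℂ A B B).symm (a ⊗ₜ K.T₃ (p ⊗ₜ q))))) =
      TensorProduct.assoc ℂ B B A
        ((K.T₃.toLinearMap ∘ₗ (TensorProduct.mk ℂ B B).flip q).rTensor A (cotwist coact (a ⊗ₜ p)))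
  coassoc_left : ∀ (a : A) (p q : B),
    (cotwistOp coact).lTensor B (TensorProduct.assoc ℂ B A B ((cotwistOp coact).rTensor B
        ((TensorProduct.assoc ℂ A B B).symm (a ⊗ₜ K.T₂ (q ⊗ₜ p))))) =
      TensorProduct.assoc ℂ B B A
        ((K.T₂.toLinearMap ∘ₗ TensorProduct.mk ℂ B B q).rTensor A (cotwistOp coact (a ⊗ₜ p)))

/-- `w = ((ι ⊗ T)(Δ_A(a) ⊗ b))(1 ⊗ 1 ⊗ a')` with `w ∈ A ⊗ B ⊗ A`, where
`(c ⊗ 1 ⊗ 1)(ι ⊗ T)(Δ_A(a) ⊗ b) = (ι ⊗ T)((c ⊗ 1)Δ_A(a) ⊗ b)` for `c ∈ A`. -/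
def IsCoveredRight (H : RegularMultiplierHopf A) (T : A ⊗[ℂ] B →ₗ[ℂ] B ⊗[ℂ] A) (a : A) (b : B) (a' : A)
    (w : A ⊗[ℂ] (B ⊗[ℂ] A)) : Prop :=
  ∀ c : A, (LinearMap.mulLeft ℂ c).rTensor (B ⊗[ℂ] A) w =
    ((LinearMap.mulRight ℂ a').lTensor B).lTensor A
      (T.lTensor A (TensorProduct.assoc ℂ A A B (H.T₂ (c ⊗ₜ a) ⊗ₜ b)))

/-- `w = (1 ⊗ 1 ⊗ a')((ι ⊗ T)(Δ_A(a) ⊗ b))` with `w ∈ A ⊗ B ⊗ A`. -/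
def IsCoveredLeft (H : RegularMultiplierHopf A) (T : A ⊗[ℂ] B →ₗ[ℂ] B ⊗[ℂ] A) (a : A) (b : B) (a' : A)
    (w : A ⊗[ℂ] (B ⊗[ℂ] A)) : Prop :=
  ∀ c : A, (LinearMap.mulLeft ℂ c).rTensor (B ⊗[ℂ] A) w =
    ((LinearMap.mulLeft ℂ a').lTensor B).lTensor A
      (T.lTensor A (TensorProduct.assoc ℂ A A B (H.T₂ (c ⊗ₜ a) ⊗ₜ b)))

/-- A left `B`-comodule coalgebra `A`: a left coaction of `B` on `A` such that the elements
`((ι ⊗ T)(Δ_A(a) ⊗ b))(1 ⊗ 1 ⊗ a')` and `(1 ⊗ 1 ⊗ a')((ι ⊗ T)(Δ_A(a) ⊗ b))` belong to `A ⊗ B ⊗ A`, and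
`(T ⊗ ι)(ι ⊗ T)(Δ_A ⊗ ι) = (ι ⊗ Δ_A)T` on `A ⊗ B`, where this equality is read after multiplication of
the third factor by `a'`, on the right and on the left. -/
structure LeftComoduleCoalgebra (H : RegularMultiplierHopf A) (K : RegularMultiplierHopf B) extends
    LeftCoaction A K where
  covered_right : ∀ (a : A) (b : B) (a' : A), ∃ w, IsCoveredRight H (cotwist coact) a b a' w
  covered_left : ∀ (a : A) (b : B) (a' : A), ∃ w, IsCoveredLeft H (cotwist coact) a b a' w
  comul_right : ∀ (a : A) (b : B) (a' : A) (w : A ⊗[ℂ] (B ⊗[ℂ] A)),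
    IsCoveredRight H (cotwist coact) a b a' w →
      TensorProduct.assoc ℂ B A A
          ((cotwist coact).rTensor A ((TensorProduct.assoc ℂ A B A).symm w)) =
        (H.T₁.toLinearMap ∘ₗ (TensorProduct.mk ℂ A A).flip a').lTensor B (cotwist coact (a ⊗ₜ b))
  comul_left : ∀ (a : A) (b : B) (a' : A) (w : A ⊗[ℂ] (B ⊗[ℂ] A)),
    IsCoveredLeft H (cotwist coact) a b a' w →
      TensorProduct.assoc ℂ B A A
          ((cotwist coact).rTensor A ((TensorProduct.assoc ℂ A B A).symm w)) =
        (H.T₄.toLinearMap ∘ₗ TensorProduct.mk ℂ A A a').lTensor B (cotwist coact (a ⊗ₜ b))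

namespace LeftComoduleCoalgebra

variable {H : RegularMultiplierHopf A} {K : RegularMultiplierHopf B}

/-- `T(a ⊗ b) = Γ(a)(b ⊗ 1)`. -/
def T (γ : LeftComoduleCoalgebra H K) : A ⊗[ℂ] B →ₗ[ℂ] B ⊗[ℂ] A := cotwist γ.coact

/-- `Tᵒᵖ(a ⊗ b) = (b ⊗ 1)Γ(a)`. -/
def Top (γ : LeftComoduleCoalgebra H K) : A ⊗[ℂ] B →ₗ[ℂ] B ⊗[ℂ] A := cotwistOp γ.coact

theorem Top_mul (γ : LeftComoduleCoalgebra H K) (b : B) (z : A ⊗[ℂ] B) :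
    γ.Top ((LinearMap.mulLeft ℂ b).lTensor A z) =
      (LinearMap.mulLeft ℂ b).rTensor A (γ.Top z) := by
  induction z with
  | zero => simp
  | add y y' h h' => simp only [map_add, h, h']
  | tmul x y =>
    apply RegularMultiplierHopf.eq_of_rTensor (fun c : B => LinearMap.mulRight ℂ c) K.mulRight_cancel
    intro c
    have h := (γ.coact x).2 (b * y) c
    have h' := (γ.coact x).2 y c
    have hl : γ.Top ((LinearMap.mulLeft ℂ b).lTensor A (x ⊗ₜ y)) = (γ.coact x).1.2 (b * y) := rfl
    have hr : γ.Top (x ⊗ₜ y) = (γ.coact x).1.2 y := rfl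
    have hc : ∀ t : B ⊗[ℂ] A, (LinearMap.mulRight ℂ c).rTensor A ((LinearMap.mulLeft ℂ b).rTensor A t) =
        (LinearMap.mulLeft ℂ b).rTensor A ((LinearMap.mulRight ℂ c).rTensor A t) := by
      intro t
      induction t with
      | zero => simp
      | add y y' h h' => simp only [map_add, h, h']
      | tmul p q => simp [mul_assoc]
    have hm : ∀ t : B ⊗[ℂ] A, (LinearMap.mulLeft ℂ b).rTensor A ((LinearMap.mulLeft ℂ y).rTensor A t) =
        (LinearMap.mulLeft ℂ (b * y)).rTensor A t := by
      intro t
      induction t with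
      | zero => simp
      | add y y' h h' => simp only [map_add, h, h']
      | tmul p q => simp
    rw [hl, hr, hc, ← h, ← h', hm]

variable (γ : LeftComoduleCoalgebra H K) (α : RightModuleAlgebra B H)

/-- `P = Tᵒᵖ ∘ Rᵒᵖ`, i.e. `P(b ⊗ a) = ∑ ((b ◁ a₍₁₎) ⊗ 1)Γ(a₍₂₎)`. -/
def P : B ⊗[ℂ] A →ₗ[ℂ] B ⊗[ℂ] A := γ.Top ∘ₗ α.twistOp

/-- `P₁₂` on `B ⊗ A ⊗ A`. -/
def P₁₂ : B ⊗[ℂ] (A ⊗[ℂ] A) →ₗ[ℂ] B ⊗[ℂ] (A ⊗[ℂ] A) :=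
  (TensorProduct.assoc ℂ B A A).toLinearMap ∘ₗ (γ.P α).rTensor A ∘ₗ
    (TensorProduct.assoc ℂ B A A).symm.toLinearMap

/-- `P₁₃` on `B ⊗ A ⊗ A`. -/
def P₁₃ : B ⊗[ℂ] (A ⊗[ℂ] A) →ₗ[ℂ] B ⊗[ℂ] (A ⊗[ℂ] A) :=
  (TensorProduct.comm ℂ A A).toLinearMap.lTensor B ∘ₗ γ.P₁₂ α ∘ₗ
    (TensorProduct.comm ℂ A A).toLinearMap.lTensor B

/-- `P₂₃` on `B ⊗ B ⊗ A`. -/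
def P₂₃ : B ⊗[ℂ] (B ⊗[ℂ] A) →ₗ[ℂ] B ⊗[ℂ] (B ⊗[ℂ] A) := (γ.P α).lTensor B

/-- `P₁₃` on `B ⊗ B ⊗ A`. -/
def P₁₃B : B ⊗[ℂ] (B ⊗[ℂ] A) →ₗ[ℂ] B ⊗[ℂ] (B ⊗[ℂ] A) :=
  (TensorProduct.leftComm ℂ B B A).toLinearMap ∘ₗ γ.P₂₃ α ∘ₗ
    (TensorProduct.leftComm ℂ B B A).toLinearMap

/-- The linear map `(d ⊗ a) ⊗ b ↦ (d ⊗ 1 ⊗ 1) P₁₃(Δ_B(b)(1 ⊗ c) ⊗ a)`. -/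
def coverP₁₃Aux (c : B) : (B ⊗[ℂ] A) ⊗[ℂ] B →ₗ[ℂ] B ⊗[ℂ] (B ⊗[ℂ] A) :=
  (LinearMap.mul' ℂ B).rTensor (B ⊗[ℂ] A) ∘ₗ
    (TensorProduct.assoc ℂ B B (B ⊗[ℂ] A)).symm.toLinearMap ∘ₗ
    (γ.P₁₃B α ∘ₗ (TensorProduct.assoc ℂ B B A).toLinearMap ∘ₗ
      (TensorProduct.comm ℂ A (B ⊗[ℂ] B)).toLinearMap ∘ₗ
      (K.T₁.toLinearMap ∘ₗ (TensorProduct.mk ℂ B B).flip c).lTensor A).lTensor B ∘ₗ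
    (TensorProduct.assoc ℂ B A B).toLinearMap

theorem coverP₁₃Aux_tmul (c d : B) (a : A) (b : B) : γ.coverP₁₃Aux α c ((d ⊗ₜ a) ⊗ₜ b) =
    (LinearMap.mulLeft ℂ d).rTensor (B ⊗[ℂ] A)
      (γ.P₁₃B α (TensorProduct.assoc ℂ B B A (K.T₁ (b ⊗ₜ c) ⊗ₜ a))) := by
  simp only [coverP₁₃Aux, LinearMap.comp_apply, LinearEquiv.coe_coe, TensorProduct.assoc_tmul,
    LinearMap.lTensor_tmul, LinearMap.flip_apply, TensorProduct.mk_apply, TensorProduct.comm_tmul]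
  generalize γ.P₁₃B α (TensorProduct.assoc ℂ B B A (K.T₁ (b ⊗ₜ c) ⊗ₜ a)) = z
  induction z with
  | zero => simp
  | add y y' h h' => simp only [map_add, TensorProduct.tmul_add, h, h']
  | tmul v w => simp

theorem P₁₃B_tmul (p q : B) (a : A) : γ.P₁₃B α (p ⊗ₜ (q ⊗ₜ a)) =
    TensorProduct.leftComm ℂ B B A (q ⊗ₜ γ.P α (p ⊗ₜ a)) := rfl

/-- `P(d p ⊗ a)` in terms of `Rᵒᵖ(d ⊗ a)`. -/
theorem mul_P (d p : B) (a : A) : γ.P α ((d * p) ⊗ₜ a) =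
    TensorProduct.lift ((LinearMap.llcomp ℂ A (B ⊗[ℂ] A) (B ⊗[ℂ] A)).flip
      (γ.P α ∘ₗ TensorProduct.mk ℂ B A p) ∘ₗ (LinearMap.rTensorHom A ∘ₗ LinearMap.mul ℂ B))
        (TensorProduct.comm ℂ A B (α.twistOp (d ⊗ₜ a))) := by
  have h : γ.P α ((d * p) ⊗ₜ a) = γ.Top (α.twistOpMul p (α.twistOp (d ⊗ₜ a))) := by
    rw [← α.twistOp_mul]; rfl
  rw [h]
  generalize α.twistOp (d ⊗ₜ a) = z
  induction z with
  | zero => simp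
  | add y y' h h' => simp only [map_add, h, h']
  | tmul v w =>
    rw [α.twistOpMul_tmul, Top_mul]
    rfl

theorem exists_coverP₁₃ : ∃ f : (B ⊗[ℂ] A) ⊗[ℂ] B →ₗ[ℂ] B ⊗[ℂ] (B ⊗[ℂ] A),
    ∀ x (c : B), ((LinearMap.mulRight ℂ c).rTensor A).lTensor B (f x) = γ.coverP₁₃Aux α c x := by
  apply RegularMultiplierHopf.exists_covered
    (fun c : B => ((LinearMap.mulRight ℂ c).rTensor A).lTensor B) _ _
    {x | ∃ (d : B) (a : A) (b : B), x = TensorProduct.comm ℂ A B (α.twistOp (d ⊗ₜ a)) ⊗ₜ b}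
  · rw [eq_top_iff, ← TensorProduct.span_tmul_eq_top, Submodule.span_le]
    rintro _ ⟨y, b, rfl⟩
    obtain ⟨z, rfl⟩ := (TensorProduct.comm ℂ A B).surjective y
    obtain ⟨z, rfl⟩ := α.twistOp_surjective z
    induction z with
    | zero => simp
    | add y y' h h' => simp only [map_add, TensorProduct.add_tmul]; exact add_mem h h'
    | tmul d a => exact Submodule.subset_span ⟨d, a, b, rfl⟩
  · rintro _ ⟨d, a, b, rfl⟩
    refine ⟨γ.P₁₃B α (TensorProduct.assoc ℂ B B A (K.T₂ (d ⊗ₜ b) ⊗ₜ a)), fun c => ?_⟩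
    have h1 : ∀ s : B ⊗[ℂ] B, ((LinearMap.mulRight ℂ c).rTensor A).lTensor B
        (γ.P₁₃B α (TensorProduct.assoc ℂ B B A (s ⊗ₜ a))) =
        γ.P₁₃B α (TensorProduct.assoc ℂ B B A ((LinearMap.mulRight ℂ c).lTensor B s ⊗ₜ a)) := by
      intro s
      induction s with
      | zero => simp
      | add y y' h h' => simp only [map_add, TensorProduct.add_tmul, h, h']
      | tmul p q =>
        rw [TensorProduct.assoc_tmul, P₁₃B_tmul, LinearMap.lTensor_tmul, TensorProduct.assoc_tmul,
          P₁₃B_tmul]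
        generalize γ.P α (p ⊗ₜ a) = z
        induction z with
        | zero => simp
        | add y y' h h' => simp only [map_add, TensorProduct.tmul_add, h, h']
        | tmul v w => simp
    have h2 : (LinearMap.mulRight ℂ c).lTensor B (K.T₂ (d ⊗ₜ b)) =
        (LinearMap.mulLeft ℂ d).rTensor B (K.T₁ (b ⊗ₜ c)) := by
      apply K.of_injective
      rw [RegularMultiplierHopf.of_lTensor_mulRight, RegularMultiplierHopf.of_rTensor_mulLeft,
        K.T₁_spec, K.T₂_spec, mul_assoc]
    have h3 : ∀ (x : B ⊗[ℂ] A), γ.coverP₁₃Aux α c (x ⊗ₜ b) =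
        TensorProduct.lift ((LinearMap.llcomp ℂ A (B ⊗[ℂ] (B ⊗[ℂ] A)) (B ⊗[ℂ] (B ⊗[ℂ] A))).flip
          (γ.P₁₃B α ∘ₗ (TensorProduct.assoc ℂ B B A).toLinearMap ∘ₗ
            TensorProduct.mk ℂ (B ⊗[ℂ] B) A (K.T₁ (b ⊗ₜ c))) ∘ₗ
              (LinearMap.rTensorHom (B ⊗[ℂ] A) ∘ₗ LinearMap.mul ℂ B)) x := by
      intro x
      induction x with
      | zero => simp
      | add y y' h h' => simp only [map_add, TensorProduct.add_tmul, h, h']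
      | tmul p q => rw [coverP₁₃Aux_tmul]; rfl
    rw [h1, h2, h3]
    generalize K.T₁ (b ⊗ₜ c) = s
    induction s with
    | zero =>
      generalize TensorProduct.comm ℂ A B (α.twistOp (d ⊗ₜ a)) = x
      induction x with
      | zero => simp
      | add y y' h h' => rw [map_add, ← h, ← h']; simp
      | tmul p q => simp
    | add y y' h h' =>
      simp only [map_add, TensorProduct.add_tmul, h, h']
      generalize TensorProduct.comm ℂ A B (α.twistOp (d ⊗ₜ a)) = x
      induction x with
      | zero => simp
      | add y y' h h' => simp only [map_add, ← h, ← h']; abel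
      | tmul p q => simp
    | tmul p q =>
      rw [LinearMap.rTensor_tmul, TensorProduct.assoc_tmul, P₁₃B_tmul, LinearMap.mulLeft_apply, mul_P]
      generalize TensorProduct.comm ℂ A B (α.twistOp (d ⊗ₜ a)) = x
      induction x with
      | zero => simp
      | add y y' h h' => simp only [map_add, TensorProduct.tmul_add, h, h']
      | tmul v w =>
        simp only [TensorProduct.lift.tmul, LinearMap.comp_apply, LinearMap.flip_apply,
          LinearMap.llcomp_apply, TensorProduct.mk_apply, LinearEquiv.coe_coe,
          TensorProduct.assoc_tmul, P₁₃B_tmul]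
        generalize γ.P α (p ⊗ₜ w) = z
        induction z with
        | zero => simp
        | add y y' h h' => simp only [map_add, TensorProduct.tmul_add, h, h']
        | tmul v w => simp
  · intro z z' h
    refine RegularMultiplierHopf.eq_of_lTensor
      (fun c : B => (LinearMap.mulRight ℂ c).rTensor A) (fun v hv => ?_) h
    refine RegularMultiplierHopf.eq_of_rTensor
      (fun c : B => LinearMap.mulRight ℂ c) K.mulRight_cancel (fun c => ?_)
    rw [hv c, map_zero]

/-- The linear map `(d ⊗ a) ⊗ b ↦ (d ⊗ 1 ⊗ 1) P₁₃(Δ_B(b) ⊗ a)` with values in `B ⊗ B ⊗ A`, determined by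
`coverP₁₃_spec`. -/
def coverP₁₃ : (B ⊗[ℂ] A) ⊗[ℂ] B →ₗ[ℂ] B ⊗[ℂ] (B ⊗[ℂ] A) := (γ.exists_coverP₁₃ α).choose

/-- `((d ⊗ 1 ⊗ 1) P₁₃(Δ_B(b) ⊗ a))(1 ⊗ c ⊗ 1) = (d ⊗ 1 ⊗ 1) P₁₃(Δ_B(b)(1 ⊗ c) ⊗ a)`. -/
theorem coverP₁₃_spec (c d : B) (a : A) (b : B) :
    ((LinearMap.mulRight ℂ c).rTensor A).lTensor B (γ.coverP₁₃ α ((d ⊗ₜ a) ⊗ₜ b)) =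
      (LinearMap.mulLeft ℂ d).rTensor (B ⊗[ℂ] A)
        (γ.P₁₃B α (TensorProduct.assoc ℂ B B A (K.T₁ (b ⊗ₜ c) ⊗ₜ a))) :=
  ((γ.exists_coverP₁₃ α).choose_spec _ c).trans (γ.coverP₁₃Aux_tmul α c d a b)

/-- `P(ι ⊗ m_A) = (ι ⊗ m_A)P₁₃P₁₂` on `B ⊗ A ⊗ A`. -/
def MulCondition : Prop :=
  γ.P α ∘ₗ (LinearMap.mul' ℂ A).lTensor B =
    (LinearMap.mul' ℂ A).lTensor B ∘ₗ γ.P₁₃ α ∘ₗ γ.P₁₂ α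

/-- `(Δ_B ⊗ ι)P = P₂₃P₁₃(Δ_B ⊗ ι)` on `B ⊗ A`, read after multiplication of the first factor on the left
by elements `d` of `B`: `(d ⊗ 1 ⊗ 1)(Δ_B ⊗ ι)P(b ⊗ a) = P₂₃((d ⊗ 1 ⊗ 1)P₁₃(Δ_B(b) ⊗ a))`. -/
def ComulCondition : Prop :=
  ∀ (d : B) (a : A) (b : B),
    TensorProduct.assoc ℂ B B A
        ((K.T₂.toLinearMap ∘ₗ TensorProduct.mk ℂ B B d).rTensor A (γ.P α (b ⊗ₜ a))) =
      γ.P₂₃ α (γ.coverP₁₃ α ((d ⊗ₜ a) ⊗ₜ b))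

/-- `T ∘ R = Tᵒᵖ ∘ Rᵒᵖ` on `B ⊗ A`. -/
def TwistCondition : Prop := γ.T ∘ₗ α.twist = γ.Top ∘ₗ α.twistOp

/-- `ι ⊗ T ⊗ ι : A ⊗ A ⊗ B ⊗ B → A ⊗ B ⊗ A ⊗ B`. -/
def middleT : (A ⊗[ℂ] A) ⊗[ℂ] (B ⊗[ℂ] B) →ₗ[ℂ] (A ⊗[ℂ] B) ⊗[ℂ] (A ⊗[ℂ] B) :=
  (TensorProduct.assoc ℂ A B (A ⊗[ℂ] B)).symm.toLinearMap ∘ₗ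
    (TensorProduct.assoc ℂ B A B).toLinearMap.lTensor A ∘ₗ
    (γ.T.rTensor B).lTensor A ∘ₗ
    (TensorProduct.assoc ℂ A B B).symm.toLinearMap.lTensor A ∘ₗ
    (TensorProduct.assoc ℂ A A (B ⊗[ℂ] B)).toLinearMap

/-- `Δ_#(a # b) = ∑ (a₍₁₎ ⊗ 1)Γ(a₍₂₎)Δ_B(b)` in `M(AB ⊗ AB)`. The formula is covered by multiplying
with `a' ⊗ 1` on the left and with `1 ⊗ b'` on the right, where it becomes
`(a' ⊗ 1)Δ_#(a # b)(1 ⊗ b') = ∑ a' a₍₁₎ · Γ(a₍₂₎)(b₍₁₎ ⊗ 1) · b₍₂₎ b'`, i.e. the image in `AB ⊗ AB` of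
`(ι ⊗ T ⊗ ι)((a' ⊗ 1)Δ_A(a) ⊗ Δ_B(b)(1 ⊗ b')) ∈ A ⊗ B ⊗ A ⊗ B`. -/
def IsSmashCoproduct (Δ : α.Smash → Multiplier (α.Smash ⊗[ℂ] α.Smash)) : Prop :=
  ∀ (a a' : A) (b b' : B),
    Multiplier.tmul (α.smashA a') 1 * Δ (α.toSmash (a ⊗ₜ b)) * Multiplier.tmul 1 (α.smashB b') =
      Multiplier.of (TensorProduct.congr α.toSmash α.toSmash
        (γ.middleT (H.T₂ (a' ⊗ₜ a) ⊗ₜ K.T₁ (b ⊗ₜ b'))))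

end LeftComoduleCoalgebra

end Comodule


end Bicross

end

open Bicross

/-!
The smash product `AB` has two candidate canonical maps, to be `y ⊗ z ↦ Δ_#(y)(1 ⊗ z)` and
`x ⊗ y ↦ (x ⊗ 1)Δ_#(y)`. The coproduct is built from them: by `exists_coproduct`, two surjective
operators `T₁`, `T₂` on `X ⊗ X` which are compatible, commute on `X ⊗ X ⊗ X` (coassociativity) and
of which `T₂` is multiplicative in its second argument come from a non-degenerate coassociative
homomorphism `X → M(X ⊗ X)`. Covering thus disappears at once, and everything that follows is an
identity between operators on tensor products of copies of `A` and `B`.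

These operators are made of the canonical maps of `A` and `B`, of `R`, `Rᵒᵖ`, `T`, `Tᵒᵖ` and of `P`.
To have them act on the same spaces, `R`, `Rᵒᵖ` and `P` are composed with flips to operators `r`,
`rop`, `flipP` on `A ⊗ B`, and `T` to an operator `τ` (`tau`) on `A ⊗ B`. Both `r` and `τ` are
bijective: `r` because its inverse is given by the inverse antipode of `A`, in the form of the
canonical map `T₄` (`twist_injective`, `twist_surjective`), and `τ` by means of the counit and the
inverse antipode of `B` (`tau_injective`, `tau_surjective`). In particular `AB = BA`, from which
local units of the smash product follow.

The bijectivity of `τ` is the main device. First, it makes `∑ a₍₁₎ ⊗ Γ(a₍₂₎)(b ⊗ x)` a linear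
function of its arguments, namely `τ⁻¹ T₁ τ`, since `Γ` is compatible with `Δ_A`; hence
`Δ_#(ab)(1 ⊗ x)` is defined (`smashT₁`). Second, `(x ⊗ 1)Δ_#(y)` is composed of `P` and the
canonical maps `T₂` of `A` and `B` (`smashT₂`), and relations between these operators are proved by
applying `τ` and cancelling it: as `P` is `Tᵒᵖ Rᵒᵖ` and `τ₁₃ (T₂)₂₃` absorbs `Tᵒᵖ` (`tau_T₂`), only
`Rᵒᵖ` remains, and `Rᵒᵖ` commutes with every map of the form `a ↦ ∑ a₍₁₎ ⊗ f(a₍₂₎)` by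
coassociativity of `Δ_A` (`rop_rTensor`). In this way one obtains coassociativity
(`leg12_smashT₂_leg23_smashT₁`) and, from the conditions on `(Δ_B ⊗ ι)P` and on `T R = Tᵒᵖ Rᵒᵖ`, the
exchange relation `r_flipP_T₂`. The latter expresses `Δ_#(ba) = Δ_#(b)Δ_#(a)`; together with the
condition on `P(ι ⊗ m_A)`, which is multiplicativity on `A`, it shows that `Δ_#` is a homomorphism
(`smashT₂_isMultiplicative`). Non-degeneracy is the surjectivity of the two canonical maps, where
`T R = Tᵒᵖ Rᵒᵖ` is used once more to see that `P` is bijective.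
-/

open scoped TensorProduct
open TensorProduct (comm assoc rightComm)

noncomputable section

namespace Bicross

universe u v

set_option linter.unusedSectionVars false

local notation "μₗ" => LinearMap.mulLeft ℂ
local notation "μᵣ" => LinearMap.mulRight ℂ

/-! ### Operators on the factors of a tensor product -/

section Legs

variable {L M N : Type*} [AddCommGroup L] [Module ℂ L] [AddCommGroup M] [Module ℂ M]
  [AddCommGroup N] [Module ℂ N]

/-- `f₁₂`: the operator `f` on the first two factors of `(L ⊗ M) ⊗ N`. All triple tensor products on
which `leg12`, `leg13` and `leg23` act are bracketed to the left. -/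
def leg12 (f : Module.End ℂ (L ⊗[ℂ] M)) : Module.End ℂ ((L ⊗[ℂ] M) ⊗[ℂ] N) := f.rTensor N

/-- `f₁₃`: the operator `f` on the outer factors of `(L ⊗ M) ⊗ N`. -/
def leg13 (f : Module.End ℂ (L ⊗[ℂ] N)) : Module.End ℂ ((L ⊗[ℂ] M) ⊗[ℂ] N) :=
  (rightComm ℂ L N M).toLinearMap ∘ₗ f.rTensor M ∘ₗ (rightComm ℂ L M N).toLinearMap

/-- `f₂₃`: the operator `f` on the last two factors of `(L ⊗ M) ⊗ N`. -/
def leg23 (f : Module.End ℂ (M ⊗[ℂ] N)) : Module.End ℂ ((L ⊗[ℂ] M) ⊗[ℂ] N) :=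
  (assoc ℂ L M N).symm.toLinearMap ∘ₗ f.lTensor L ∘ₗ (assoc ℂ L M N).toLinearMap

theorem leg12_mul (f g : Module.End ℂ (L ⊗[ℂ] M)) :
    (leg12 (f * g) : Module.End ℂ ((L ⊗[ℂ] M) ⊗[ℂ] N)) = leg12 f * leg12 g :=
  LinearMap.rTensor_comp _ _ _

theorem leg13_mul (f g : Module.End ℂ (L ⊗[ℂ] N)) :
    (leg13 (f * g) : Module.End ℂ ((L ⊗[ℂ] M) ⊗[ℂ] N)) = leg13 f * leg13 g := by
  apply LinearMap.ext
  intro x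
  have : ∀ y, rightComm ℂ L M N (rightComm ℂ L N M y) = y := fun y => by
    rw [← TensorProduct.rightComm_symm, LinearEquiv.symm_apply_apply]
  simp only [leg13, Module.End.mul_apply, LinearMap.comp_apply, LinearEquiv.coe_coe, this]
  simp [Module.End.mul_eq_comp, LinearMap.rTensor_comp]

theorem leg23_mul (f g : Module.End ℂ (M ⊗[ℂ] N)) :
    (leg23 (f * g) : Module.End ℂ ((L ⊗[ℂ] M) ⊗[ℂ] N)) = leg23 f * leg23 g := by
  apply LinearMap.ext
  intro x
  simp [leg23, Module.End.mul_eq_comp, LinearMap.lTensor_comp]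

@[simp] theorem leg12_one : (leg12 1 : Module.End ℂ ((L ⊗[ℂ] M) ⊗[ℂ] N)) = 1 :=
  LinearMap.rTensor_id _ _

@[simp] theorem leg13_one : (leg13 1 : Module.End ℂ ((L ⊗[ℂ] M) ⊗[ℂ] N)) = 1 := by
  apply TensorProduct.ext_threefold
  intro x y z
  simp [leg13]

@[simp] theorem leg23_one : (leg23 1 : Module.End ℂ ((L ⊗[ℂ] M) ⊗[ℂ] N)) = 1 := by
  apply TensorProduct.ext_threefold
  intro x y z
  simp [leg23]

theorem leg12_tmul (f : Module.End ℂ (L ⊗[ℂ] M)) (t : L ⊗[ℂ] M) (z : N) :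
    leg12 f (t ⊗ₜ z) = f t ⊗ₜ z := rfl

theorem leg13_tmul (f : Module.End ℂ (L ⊗[ℂ] N)) (x : L) (y : M) (z : N) :
    leg13 f ((x ⊗ₜ y) ⊗ₜ z) = ((TensorProduct.mk ℂ L M).flip y).rTensor N (f (x ⊗ₜ z)) := by
  simp only [leg13, LinearMap.comp_apply, LinearEquiv.coe_coe, TensorProduct.rightComm_tmul,
    LinearMap.rTensor_tmul]
  generalize f (x ⊗ₜ z) = t
  induction t with
  | zero => simp
  | add s t hs ht => simp only [map_add, TensorProduct.add_tmul, hs, ht]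
  | tmul p q => simp

theorem leg23_tmul (f : Module.End ℂ (M ⊗[ℂ] N)) (x : L) (y : M) (z : N) :
    leg23 f ((x ⊗ₜ y) ⊗ₜ z) = (TensorProduct.mk ℂ L M x).rTensor N (f (y ⊗ₜ z)) := by
  simp only [leg23, LinearMap.comp_apply, LinearEquiv.coe_coe, TensorProduct.assoc_tmul,
    LinearMap.lTensor_tmul]
  generalize f (y ⊗ₜ z) = t
  induction t with
  | zero => simp
  | add s t hs ht => simp only [map_add, TensorProduct.tmul_add, hs, ht]
  | tmul p q => simp

theorem leg13_rTensor (f : Module.End ℂ (L ⊗[ℂ] N)) (y : M) (t : L ⊗[ℂ] N) :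
    leg13 f (((TensorProduct.mk ℂ L M).flip y).rTensor N t) =
      ((TensorProduct.mk ℂ L M).flip y).rTensor N (f t) := by
  induction t with
  | zero => simp
  | add s t hs ht => simp only [map_add, hs, ht]
  | tmul p q => rw [LinearMap.rTensor_tmul]; exact leg13_tmul f p y q

theorem leg23_rTensor (f : Module.End ℂ (M ⊗[ℂ] N)) (x : L) (t : M ⊗[ℂ] N) :
    leg23 f ((TensorProduct.mk ℂ L M x).rTensor N t) =
      (TensorProduct.mk ℂ L M x).rTensor N (f t) := by
  induction t with
  | zero => simp
  | add s t hs ht => simp only [map_add, hs, ht]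
  | tmul p q => rw [LinearMap.rTensor_tmul]; exact leg23_tmul f x p q

theorem end_ext₃ {V : Type*} [AddCommGroup V] [Module ℂ V] {f g : (L ⊗[ℂ] M) ⊗[ℂ] N →ₗ[ℂ] V}
    (h : ∀ x y z, f ((x ⊗ₜ y) ⊗ₜ z) = g ((x ⊗ₜ y) ⊗ₜ z)) : f = g :=
  TensorProduct.ext_threefold h

end Legs

/-! ### Tensors and finitely many vectors -/

section Slices

variable {V W Z : Type*} [AddCommGroup V] [Module ℂ V] [AddCommGroup W] [Module ℂ W]
  [AddCommGroup Z] [Module ℂ Z]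

/-- Only finitely many vectors of `V` matter for a tensor in `V ⊗ Z`. -/
theorem exists_finset_rTensor (z : V ⊗[ℂ] Z) :
    ∃ S : Finset V, ∀ f : V →ₗ[ℂ] V, (∀ v ∈ S, f v = v) → f.rTensor Z z = z := by
  classical
  induction z with
  | zero => exact ⟨∅, by simp⟩
  | add s t hs ht =>
    obtain ⟨S, hS⟩ := hs
    obtain ⟨S', hS'⟩ := ht
    refine ⟨S ∪ S', fun f hf => ?_⟩
    rw [map_add, hS f fun v hv => hf v (Finset.mem_union_left _ hv),
      hS' f fun v hv => hf v (Finset.mem_union_right _ hv)]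
  | tmul v w => exact ⟨{v}, fun f hf => by simp [hf v]⟩

theorem exists_finset_lTensor (z : Z ⊗[ℂ] V) :
    ∃ S : Finset V, ∀ f : V →ₗ[ℂ] V, (∀ v ∈ S, f v = v) → f.lTensor Z z = z := by
  classical
  induction z with
  | zero => exact ⟨∅, by simp⟩
  | add s t hs ht =>
    obtain ⟨S, hS⟩ := hs
    obtain ⟨S', hS'⟩ := ht
    refine ⟨S ∪ S', fun f hf => ?_⟩
    rw [map_add, hS f fun v hv => hf v (Finset.mem_union_left _ hv),
      hS' f fun v hv => hf v (Finset.mem_union_right _ hv)]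
  | tmul v w => exact ⟨{w}, fun f hf => by simp [hf w]⟩

/-- If `σ` is a bijection of `V ⊗ V` commuting with the operators `μ a ⊗ ι`, and `σ (a ⊗ x)` is, up
to covering the second factor, in the range of `μ a ⊗ ι` (uniformly in `a`), then finitely many
elements `a` have a common `e` with `μ a e = a`. With `μ` the product of a regular multiplier Hopf
algebra or its opposite, and `σ` a canonical map, this gives local units. -/
theorem exists_local_unit [Nontrivial V] (μ : V →ₗ[ℂ] V →ₗ[ℂ] V) (σ : V ⊗[ℂ] V ≃ₗ[ℂ] V ⊗[ℂ] V)
    (hσ : ∀ a t, σ ((μ a).rTensor V t) = (μ a).rTensor V (σ t))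
    {ι : Type*} (g : ι → V →ₗ[ℂ] V) (hg : ∀ v, (∀ i, g i v = 0) → v = 0)
    (k : V → ι → V ⊗[ℂ] V)
    (hk : ∀ a x i, (g i).lTensor V (σ (a ⊗ₜ x)) = (μ a).rTensor V (k x i)) (S : Finset V) :
    ∃ e, ∀ a ∈ S, μ a e = a := by
  classical
  obtain ⟨x, hx⟩ := exists_ne (0 : V)
  obtain ⟨f, hf⟩ := Module.Projective.exists_dual_eq_one ℂ hx
  -- the family `u = (σ (a ⊗ x))` indexed by `a ∈ S` is of the form `j ⊗ ι` applied to some `t`,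
  -- since it vanishes modulo the range of `j`; then `e` is a slice of `σ⁻¹ t`
  let j : V →ₗ[ℂ] (S → V) := LinearMap.pi fun a => μ a
  let u : (S → V) ⊗[ℂ] V := ∑ a : S, (LinearMap.single ℂ (fun _ : S => V) a).rTensor V (σ (a ⊗ₜ x))
  have hj : ∀ t : V ⊗[ℂ] V, j.rTensor V t =
      ∑ a : S, (LinearMap.single ℂ (fun _ : S => V) a).rTensor V ((μ a).rTensor V t) := by
    intro t
    have h : j = ∑ a : S, LinearMap.single ℂ (fun _ : S => V) a ∘ₗ μ a := by
      apply LinearMap.ext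
      intro v
      ext b
      simp [j, Finset.sum_apply, Pi.single_apply]
    rw [h]
    induction t with
    | zero => simp
    | add s t hs ht => simp only [map_add, hs, ht, Finset.sum_add_distrib]
    | tmul p q => simp [LinearMap.sum_apply, TensorProduct.sum_tmul]
  have hu : (LinearMap.range j).mkQ.rTensor V u = 0 := by
    apply RegularMultiplierHopf.eq_of_lTensor g hg
    intro i
    have h1 : ∀ t : (S → V) ⊗[ℂ] V, (g i).lTensor _ ((LinearMap.range j).mkQ.rTensor V t) =
        (LinearMap.range j).mkQ.rTensor V ((g i).lTensor _ t) := fun t => by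
      rw [← LinearMap.comp_apply, LinearMap.lTensor_comp_rTensor, ← LinearMap.rTensor_comp_lTensor,
        LinearMap.comp_apply]
    have h2 : ∀ (a : S) (t : V ⊗[ℂ] V), (g i).lTensor _
        ((LinearMap.single ℂ (fun _ : S => V) a).rTensor V t) =
        (LinearMap.single ℂ (fun _ : S => V) a).rTensor V ((g i).lTensor _ t) := fun a t => by
      rw [← LinearMap.comp_apply, LinearMap.lTensor_comp_rTensor, ← LinearMap.rTensor_comp_lTensor,
        LinearMap.comp_apply]
    rw [h1, map_zero]
    simp only [u, map_sum, h2, hk]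
    rw [← map_sum, ← hj, ← LinearMap.rTensor_comp_apply, LinearMap.range_mkQ_comp]
    simp
  obtain ⟨t, ht⟩ := (rTensor_exact V (LinearMap.exact_map_mkQ_range j)
    (Submodule.mkQ_surjective _) u).mp hu
  refine ⟨TensorProduct.rid ℂ V (f.lTensor V (σ.symm t)), fun a ha => ?_⟩
  have hc : (μ a).rTensor V t = σ (a ⊗ₜ x) := by
    have h := congrArg ((LinearMap.proj (⟨a, ha⟩ : S) : (S → V) →ₗ[ℂ] V).rTensor V) ht
    rw [← LinearMap.rTensor_comp_apply] at h
    simp only [u, map_sum, ← LinearMap.rTensor_comp_apply] at h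
    rw [Finset.sum_eq_single ⟨a, ha⟩] at h
    · simpa [j, LinearMap.proj_pi, LinearMap.proj_comp_single_same] using h
    · intro b _ hb
      rw [LinearMap.proj_comp_single_ne _ _ _ _ (Ne.symm hb)]
      simp
    · simp
  have hd : (μ a).rTensor V (σ.symm t) = a ⊗ₜ x := by
    apply σ.injective
    rw [hσ, LinearEquiv.apply_symm_apply, hc]
  have key : ∀ y : V ⊗[ℂ] V, μ a (TensorProduct.rid ℂ V (f.lTensor V y)) =
      TensorProduct.rid ℂ V (f.lTensor V ((μ a).rTensor V y)) := by
    intro y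
    induction y with
    | zero => simp
    | add s t hs ht => simp only [map_add, hs, ht]
    | tmul v w => simp
  rw [key, hd]
  simp [hf]

end Slices

section

variable {V V' W W' : Type*} [AddCommGroup V] [Module ℂ V] [AddCommGroup V'] [Module ℂ V']
  [AddCommGroup W] [Module ℂ W] [AddCommGroup W'] [Module ℂ W']

theorem rTensor_lTensor_comm (f : V →ₗ[ℂ] V') (g : W →ₗ[ℂ] W') (t : V ⊗[ℂ] W) :
    f.rTensor W' (g.lTensor V t) = g.lTensor V' (f.rTensor W t) := by
  rw [← LinearMap.comp_apply, LinearMap.rTensor_comp_lTensor, ← LinearMap.lTensor_comp_rTensor,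
    LinearMap.comp_apply]

theorem rTensor_comm (f : V →ₗ[ℂ] V') (t : W ⊗[ℂ] V) :
    f.rTensor W (comm ℂ W V t) = comm ℂ W V' (f.lTensor W t) := by
  induction t with
  | zero => simp
  | add s t hs ht => simp only [map_add, hs, ht]
  | tmul p q => simp

theorem lTensor_comm (f : V →ₗ[ℂ] V') (t : V ⊗[ℂ] W) :
    f.lTensor W (comm ℂ V W t) = comm ℂ V' W (f.rTensor W t) := by
  induction t with
  | zero => simp
  | add s t hs ht => simp only [map_add, hs, ht]
  | tmul p q => simp

theorem eq_zero_of_rTensor {ι : Type*} (f : ι → V →ₗ[ℂ] V')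
    (hf : ∀ v, (∀ i, f i v = 0) → v = 0) {z : V ⊗[ℂ] W}
    (h : ∀ i, (f i).rTensor W z = 0) : z = 0 :=
  RegularMultiplierHopf.eq_of_rTensor f hf fun i => by rw [h, map_zero]

theorem eq_zero_of_lTensor {ι : Type*} (f : ι → W →ₗ[ℂ] W')
    (hf : ∀ v, (∀ i, f i v = 0) → v = 0) {z : V ⊗[ℂ] W}
    (h : ∀ i, (f i).lTensor V z = 0) : z = 0 :=
  RegularMultiplierHopf.eq_of_lTensor f hf fun i => by rw [h, map_zero]

end

/-! ### Canonical maps and local units of regular multiplier Hopf algebras -/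

namespace RegularMultiplierHopf

variable {A : Type u} [NonUnitalRing A] [Module ℂ A] [IsScalarTower ℂ A A] [SMulCommClass ℂ A A]

theorem of_rTensor_mulRight (a : A) (t : A ⊗[ℂ] A) :
    Multiplier.of ((μᵣ a).rTensor A t) =
      Multiplier.of t * Multiplier.tmul (Multiplier.of a) 1 := by
  have key : (μᵣ a).rTensor A t = comm ℂ A A ((μᵣ a).lTensor A (comm ℂ A A t)) := by
    rw [lTensor_comm, TensorProduct.comm_comm]
  rw [key, ← flip_of, of_lTensor_mulRight, map_mul, flip_tmul, flip_of]
  simp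

theorem tmul_mul_tmul (m n m' n' : Multiplier A) :
    Multiplier.tmul m n * Multiplier.tmul m' n' = Multiplier.tmul (m * m') (n * n') := by
  apply Multiplier.ext <;> intro y
  · induction y with
    | zero => simp
    | add y y' h h' => simp only [map_add, h, h']
    | tmul v w => simp
  · induction y with
    | zero => simp
    | add y y' h h' => simp only [map_add, h, h']
    | tmul v w => simp

theorem of_mul_of (a b : A) : Multiplier.of a * Multiplier.of b = Multiplier.of (a * b) := by
  apply Multiplier.ext <;> intro y <;> simp [mul_assoc]

variable (H : RegularMultiplierHopf A)

/-- Both sides are `(a ⊗ 1)Δ(x)(1 ⊗ c)`. -/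
theorem T₂_T₁ (a x c : A) : (μᵣ c).lTensor A (H.T₂ (a ⊗ₜ x)) =
    (μₗ a).rTensor A (H.T₁ (x ⊗ₜ c)) := by
  apply H.of_injective
  rw [of_lTensor_mulRight, of_rTensor_mulLeft, T₂_spec, T₁_spec, mul_assoc]

/-- Both sides are `(a ⊗ 1)Δ(x)(c ⊗ 1)`. -/
theorem T₃_T₂ (a x c : A) : (μₗ a).rTensor A (H.T₃ (x ⊗ₜ c)) =
    (μᵣ c).rTensor A (H.T₂ (a ⊗ₜ x)) := by
  apply H.of_injective
  rw [of_rTensor_mulRight, of_rTensor_mulLeft, T₂_spec, T₃_spec, mul_assoc]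

/-- Both sides are `Δ(x)(c ⊗ d)`. -/
theorem T₁_T₃ (x c d : A) : (μᵣ c).rTensor A (H.T₁ (x ⊗ₜ d)) =
    (μᵣ d).lTensor A (H.T₃ (x ⊗ₜ c)) := by
  apply H.of_injective
  rw [of_rTensor_mulRight, of_lTensor_mulRight, T₁_spec, T₃_spec, mul_assoc, mul_assoc,
    tmul_of_mul_tmul_of, tmul_of_mul_tmul_of']

theorem T₂_mulLeft (x : A) (t : A ⊗[ℂ] A) :
    H.T₂ ((μₗ x).rTensor A t) = (μₗ x).rTensor A (H.T₂ t) := by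
  induction t with
  | zero => simp
  | add s t hs ht => simp only [map_add, hs, ht]
  | tmul p q =>
    apply H.of_injective
    rw [of_rTensor_mulLeft, LinearMap.rTensor_tmul, T₂_spec, T₂_spec, ← mul_assoc, tmul_mul_tmul,
      of_mul_of]
    simp

theorem T₁_mulRight (x : A) (t : A ⊗[ℂ] A) :
    H.T₁ ((μᵣ x).lTensor A t) = (μᵣ x).lTensor A (H.T₁ t) := by
  induction t with
  | zero => simp
  | add s t hs ht => simp only [map_add, hs, ht]
  | tmul p q =>
    apply H.of_injective
    rw [of_lTensor_mulRight, LinearMap.lTensor_tmul, T₁_spec, T₁_spec, mul_assoc, tmul_mul_tmul,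
      of_mul_of]
    simp

theorem T₄_mulLeft (x : A) (t : A ⊗[ℂ] A) :
    H.T₄ ((μₗ x).rTensor A t) = (μₗ x).lTensor A (H.T₄ t) := by
  induction t with
  | zero => simp
  | add s t hs ht => simp only [map_add, hs, ht]
  | tmul p q =>
    apply H.of_injective
    rw [of_lTensor_mulLeft, LinearMap.rTensor_tmul, T₄_spec, T₄_spec, ← mul_assoc, tmul_mul_tmul,
      of_mul_of]
    simp

/-- Regular multiplier Hopf algebras have local units. -/
theorem exists_right_unit (H : RegularMultiplierHopf A) (S : Finset A) :
    ∃ e : A, ∀ a ∈ S, a * e = a := by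
  rcases subsingleton_or_nontrivial A with h | h
  · exact ⟨0, fun a _ => Subsingleton.elim _ _⟩
  · exact exists_local_unit (LinearMap.mul ℂ A) H.T₂ (fun a t => H.T₂_mulLeft a t)
      (fun c : A => μᵣ c) H.mulRight_cancel (fun x c => H.T₁ (x ⊗ₜ c))
      (fun a x c => H.T₂_T₁ a x c) S

/-- The mirror image of `exists_right_unit`, with the flip of `T₁` in place of `T₂`. -/
theorem exists_left_unit (H : RegularMultiplierHopf A) (S : Finset A) :
    ∃ e : A, ∀ a ∈ S, e * a = a := by
  rcases subsingleton_or_nontrivial A with h | h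
  · exact ⟨0, fun a _ => Subsingleton.elim _ _⟩
  · refine exists_local_unit (LinearMap.mul ℂ A).flip
      ((comm ℂ A A).trans (H.T₁.trans (comm ℂ A A))) (fun a t => ?_)
      (fun c : A => μₗ c) H.mulLeft_cancel (fun x c => comm ℂ A A (H.T₂ (c ⊗ₜ x)))
      (fun a x c => ?_) S
    · change comm ℂ A A (H.T₁ (comm ℂ A A ((μᵣ a).rTensor A t))) =
        (μᵣ a).rTensor A (comm ℂ A A (H.T₁ (comm ℂ A A t)))
      rw [← lTensor_comm, T₁_mulRight, rTensor_comm]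
    · change (μₗ c).lTensor A (comm ℂ A A (H.T₁ (x ⊗ₜ a))) =
        (μᵣ a).rTensor A (comm ℂ A A (H.T₂ (c ⊗ₜ x)))
      rw [lTensor_comm, rTensor_comm, T₂_T₁]

theorem exists_left_unit_rTensor (H : RegularMultiplierHopf A) {Z : Type*} [AddCommGroup Z]
    [Module ℂ Z] (z : A ⊗[ℂ] Z) :
    ∃ e : A, (μₗ e).rTensor Z z = z := by
  obtain ⟨S, hS⟩ := exists_finset_rTensor z
  obtain ⟨e, he⟩ := H.exists_left_unit S
  exact ⟨e, hS _ he⟩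

theorem exists_right_unit_lTensor (H : RegularMultiplierHopf A) {Z : Type*} [AddCommGroup Z]
    [Module ℂ Z] (z : Z ⊗[ℂ] A) :
    ∃ e : A, (μᵣ e).lTensor Z z = z := by
  obtain ⟨S, hS⟩ := exists_finset_lTensor z
  obtain ⟨e, he⟩ := H.exists_right_unit S
  exact ⟨e, hS _ he⟩

/-- Coassociativity of `Δ`: both sides send `a ⊗ b ⊗ c` to `∑ a b₍₁₎ ⊗ b₍₂₎ ⊗ b₍₃₎ c`. -/
theorem leg12_T₂_leg23_T₁ : (leg12 H.T₂.toLinearMap * leg23 H.T₁.toLinearMap :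
      Module.End ℂ ((A ⊗[ℂ] A) ⊗[ℂ] A)) = leg23 H.T₁.toLinearMap * leg12 H.T₂.toLinearMap := by
  apply end_ext₃
  intro a b c
  apply (assoc ℂ A A A).injective
  exact (H.coassoc_T₂_T₁ a b c).trans (by simp [leg23, leg12])

/-- `y ⊗ p ↦ y Δ(p)` for `y ∈ A ⊗ A`. -/
def mulComul₂ : (A ⊗[ℂ] A) ⊗[ℂ] A →ₗ[ℂ] A ⊗[ℂ] A :=
  (LinearMap.mul' ℂ A).lTensor A ∘ₗ (assoc ℂ A A A).toLinearMap ∘ₗ leg13 H.T₂.toLinearMap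

theorem mulComul₂_tmul (u v p : A) : H.mulComul₂ ((u ⊗ₜ v) ⊗ₜ p) =
    (μₗ v).lTensor A (H.T₂ (u ⊗ₜ p)) := by
  simp only [mulComul₂, LinearMap.comp_apply, leg13_tmul, LinearEquiv.coe_coe]
  generalize H.T₂ (u ⊗ₜ p) = t
  induction t with
  | zero => simp
  | add s t hs ht => simp only [map_add, hs, ht]
  | tmul p q => simp

/-- `(c ⊗ 1)Δ(fp) = ((c ⊗ 1)Δ(f))Δ(p)`. -/
theorem T₂_mul₂ (c f p : A) : H.T₂ (c ⊗ₜ (f * p)) = H.mulComul₂ (H.T₂ (c ⊗ₜ f) ⊗ₜ p) := by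
  rw [T₂_mul]
  generalize H.T₂ (c ⊗ₜ f) = t
  induction t with
  | zero => simp
  | add s t hs ht => simp only [map_add, TensorProduct.add_tmul, hs, ht]
  | tmul u v => rw [mulComul_tmul, mulComul₂_tmul]

/-- The pentagon equation for `T₂`: both sides send `c ⊗ f ⊗ a` to
`∑ c f₍₁₎ a₍₁₎ ⊗ f₍₂₎ a₍₂₎ ⊗ a₍₃₎`. -/
theorem T₂_pentagon : (leg12 H.T₂.toLinearMap * leg23 H.T₂.toLinearMap :
      Module.End ℂ ((A ⊗[ℂ] A) ⊗[ℂ] A)) =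
    leg23 H.T₂.toLinearMap * leg13 H.T₂.toLinearMap * leg12 H.T₂.toLinearMap := by
  apply end_ext₃
  intro c f a
  apply eq_of_lTensor (fun x : A => μᵣ x) H.mulRight_cancel
  intro x
  have h1 : ∀ t : A ⊗[ℂ] A, leg12 H.T₂.toLinearMap ((TensorProduct.mk ℂ A A c).rTensor A
      ((μₗ f).rTensor A t)) =
      H.mulComul₂.rTensor A ((assoc ℂ (A ⊗[ℂ] A) A A).symm (H.T₂ (c ⊗ₜ f) ⊗ₜ t)) := by
    intro t
    induction t with
    | zero => simp
    | add s t hs ht => simp only [map_add, TensorProduct.tmul_add, hs, ht]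
    | tmul p q => simp [leg12_tmul, T₂_mul₂]
  have h2 : ∀ (u v : A) (t : A ⊗[ℂ] A),
      H.mulComul₂.rTensor A ((assoc ℂ (A ⊗[ℂ] A) A A).symm ((u ⊗ₜ v) ⊗ₜ t)) =
      ((μₗ v).lTensor A).rTensor A (leg12 H.T₂.toLinearMap
        ((TensorProduct.mk ℂ A A u).rTensor A t)) := by
    intro u v t
    induction t with
    | zero => simp
    | add s t hs ht => simp only [map_add, TensorProduct.tmul_add, hs, ht]
    | tmul p q => simp [leg12_tmul, mulComul₂_tmul]
  have h3 : ∀ (u v : A) (t : A ⊗[ℂ] A), (μᵣ x).lTensor (A ⊗[ℂ] A) (leg23 H.T₂.toLinearMap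
      (((TensorProduct.mk ℂ A A).flip v).rTensor A t)) =
      ((μₗ v).lTensor A).rTensor A (leg23 H.T₁.toLinearMap (t ⊗ₜ x)) := by
    intro u v t
    induction t with
    | zero => simp
    | add s t hs ht => simp only [map_add, TensorProduct.add_tmul, hs, ht]
    | tmul p q =>
      rw [LinearMap.rTensor_tmul, LinearMap.flip_apply, TensorProduct.mk_apply, leg23_tmul,
        leg23_tmul, ← rTensor_lTensor_comm, LinearEquiv.coe_coe, T₂_T₁, LinearEquiv.coe_coe,
        ← LinearMap.rTensor_comp_apply, ← LinearMap.rTensor_comp_apply]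
      congr 2
  rw [Module.End.mul_apply, Module.End.mul_apply, Module.End.mul_apply, leg23_tmul, leg12_tmul]
  have h0 : ∀ s : (A ⊗[ℂ] A) ⊗[ℂ] A, (μᵣ x).lTensor (A ⊗[ℂ] A) (leg12 H.T₂.toLinearMap s) =
      leg12 H.T₂.toLinearMap ((μᵣ x).lTensor (A ⊗[ℂ] A) s) := fun s =>
    (rTensor_lTensor_comm _ _ _).symm
  rw [h0, ← rTensor_lTensor_comm, LinearEquiv.coe_coe, T₂_T₁, h1]
  generalize H.T₂ (c ⊗ₜ f) = y
  induction y with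
  | zero => simp
  | add s t hs ht => simp only [map_add, TensorProduct.add_tmul, hs, ht]
  | tmul u v =>
    rw [h2, leg13_tmul, h3 u, ← leg12_tmul, ← LinearEquiv.coe_coe, ← leg23_tmul]
    congr 1
    exact LinearMap.congr_fun H.leg12_T₂_leg23_T₁ ((u ⊗ₜ a) ⊗ₜ x)

end RegularMultiplierHopf

/-! ### The counit and the inverse of the antipode -/

namespace RegularMultiplierHopf

variable {A : Type u} [NonUnitalRing A] [Module ℂ A] [IsScalarTower ℂ A A] [SMulCommClass ℂ A A]
variable (H : RegularMultiplierHopf A)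

/-- The counit is determined by `m T₁⁻¹ = ε ⊗ ι` and `m T₂⁻¹ = ι ⊗ ε`. Both exist because
coassociativity gives `a ⊗ m T₁⁻¹(b ⊗ c) = m T₂⁻¹(a ⊗ b) ⊗ c`. -/
theorem exists_counit : ∃ ε : A →ₗ[ℂ] ℂ,
    (∀ b c, LinearMap.mul' ℂ A (H.T₁.symm (b ⊗ₜ c)) = ε b • c) ∧
    ∀ a b, LinearMap.mul' ℂ A (H.T₂.symm (a ⊗ₜ b)) = ε b • a := by
  rcases subsingleton_or_nontrivial A with h | h
  · exact ⟨0, fun b c => Subsingleton.elim _ _, fun b c => Subsingleton.elim _ _⟩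
  obtain ⟨a₀, ha₀⟩ := exists_ne (0 : A)
  obtain ⟨f, hf⟩ := Module.Projective.exists_dual_eq_one ℂ ha₀
  -- the operators `T₂ ⊗ ι` and `ι ⊗ T₁⁻¹` commute; multiply the last two factors
  have h1 : ∀ (t : A ⊗[ℂ] A) (a : A), (LinearMap.mul' ℂ A).lTensor A (assoc ℂ A A A
      (leg12 H.T₂.toLinearMap ((TensorProduct.mk ℂ A A a).rTensor A t))) =
      (μₗ a).rTensor A (H.T₁ t) := by
    intro t a
    induction t with
    | zero => simp
    | add s t hs ht => simp only [map_add, hs, ht]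
    | tmul p q =>
      rw [LinearMap.rTensor_tmul, TensorProduct.mk_apply, leg12_tmul, ← T₂_T₁]
      simp only [LinearEquiv.coe_coe]
      generalize H.T₂ (a ⊗ₜ p) = s
      induction s with
      | zero => simp
      | add s t hs ht => simp only [map_add, TensorProduct.add_tmul, hs, ht]
      | tmul u v => simp
  have h2 : ∀ (t : A ⊗[ℂ] A) (c : A),
      (LinearMap.mul' ℂ A ∘ₗ H.T₁.symm.toLinearMap).lTensor A (assoc ℂ A A A (H.T₂ t ⊗ₜ c)) =
      LinearMap.mul' ℂ A t ⊗ₜ c := by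
    intro t c
    induction t with
    | zero => simp
    | add s t hs ht => simp only [map_add, TensorProduct.add_tmul, hs, ht]
    | tmul a b =>
      have h4 : leg23 H.T₁.toLinearMap (leg12 H.T₂.toLinearMap
          ((TensorProduct.mk ℂ A A a).rTensor A (H.T₁.symm (b ⊗ₜ c)))) =
          H.T₂ (a ⊗ₜ b) ⊗ₜ c := by
        rw [← Module.End.mul_apply, ← leg12_T₂_leg23_T₁, Module.End.mul_apply, leg23_rTensor]
        simp [leg12_tmul]
      have h5 := congrArg (fun z => (LinearMap.mul' ℂ A ∘ₗ H.T₁.symm.toLinearMap).lTensor A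
        (assoc ℂ A A A z)) h4
      rw [← h5]
      have h6 : ∀ z, (LinearMap.mul' ℂ A ∘ₗ H.T₁.symm.toLinearMap).lTensor A (assoc ℂ A A A
          (leg23 H.T₁.toLinearMap z)) = (LinearMap.mul' ℂ A).lTensor A (assoc ℂ A A A z) := by
        intro z
        simp only [leg23, LinearMap.comp_apply, LinearEquiv.coe_coe, LinearEquiv.apply_symm_apply]
        rw [← LinearMap.lTensor_comp_apply]
        congr 2
        ext
        simp
      rw [h6, h1, LinearEquiv.apply_symm_apply]
      simp
  have h3 : ∀ a b c : A, a ⊗ₜ[ℂ] LinearMap.mul' ℂ A (H.T₁.symm (b ⊗ₜ c)) =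
      LinearMap.mul' ℂ A (H.T₂.symm (a ⊗ₜ b)) ⊗ₜ[ℂ] c := by
    intro a b c
    have := h2 (H.T₂.symm (a ⊗ₜ b)) c
    simpa using this
  refine ⟨f ∘ₗ LinearMap.mul' ℂ A ∘ₗ H.T₂.symm.toLinearMap ∘ₗ TensorProduct.mk ℂ A A a₀,
    fun b c => ?_, fun a b => ?_⟩
  · have := congrArg (fun z => TensorProduct.lid ℂ A (f.rTensor A z)) (h3 a₀ b c)
    simpa [hf] using this
  · have h4 := congrArg (fun z => TensorProduct.lid ℂ A (f.rTensor A z)) (h3 a₀ b a₀)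
    have h5 := h3 a b a₀
    have h6 := congrArg (fun z => TensorProduct.rid ℂ A (f.lTensor A z)) h5
    simp only [LinearMap.rTensor_tmul, TensorProduct.lid_tmul, hf, one_smul,
      LinearMap.lTensor_tmul, TensorProduct.rid_tmul] at h4 h6
    rw [← h6, h4]
    simp [hf]

/-- The counit `ε` of a regular multiplier Hopf algebra. -/
def counit : A →ₗ[ℂ] ℂ := H.exists_counit.choose

section

variable {Z : Type*} [AddCommGroup Z] [Module ℂ Z]

/-- The slice map `ε ⊗ ι`. -/
def epsL : A ⊗[ℂ] Z →ₗ[ℂ] Z := (TensorProduct.lid ℂ Z).toLinearMap ∘ₗ H.counit.rTensor Z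

/-- The slice map `ι ⊗ ε`. -/
def epsR : Z ⊗[ℂ] A →ₗ[ℂ] Z := (TensorProduct.rid ℂ Z).toLinearMap ∘ₗ H.counit.lTensor Z

@[simp] theorem epsL_tmul (a : A) (z : Z) : H.epsL (a ⊗ₜ z) = H.counit a • z := by simp [epsL]

@[simp] theorem epsR_tmul (a : A) (z : Z) : H.epsR (z ⊗ₜ a) = H.counit a • z := by simp [epsR]

theorem epsL_lTensor {Z' : Type*} [AddCommGroup Z'] [Module ℂ Z'] (f : Z →ₗ[ℂ] Z')
    (t : A ⊗[ℂ] Z) : H.epsL (f.lTensor A t) = f (H.epsL t) := by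
  induction t with
  | zero => simp
  | add s t hs ht => simp only [map_add, hs, ht]
  | tmul p q => simp

theorem epsR_rTensor {Z' : Type*} [AddCommGroup Z'] [Module ℂ Z'] (f : Z →ₗ[ℂ] Z')
    (t : Z ⊗[ℂ] A) : H.epsR (f.rTensor A t) = f (H.epsR t) := by
  induction t with
  | zero => simp
  | add s t hs ht => simp only [map_add, hs, ht]
  | tmul p q => simp

theorem epsL_comm (t : Z ⊗[ℂ] A) : H.epsL (comm ℂ Z A t) = H.epsR t := by
  induction t with
  | zero => simp
  | add s t hs ht => simp only [map_add, hs, ht]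
  | tmul p q => simp

theorem epsR_comm (t : A ⊗[ℂ] Z) : H.epsR (comm ℂ A Z t) = H.epsL t := by
  induction t with
  | zero => simp
  | add s t hs ht => simp only [map_add, hs, ht]
  | tmul p q => simp

end

/-- `∑ ε(x₍₁₎) x₍₂₎ c = x c`. -/
theorem epsL_T₁ (t : A ⊗[ℂ] A) : H.epsL (H.T₁ t) = LinearMap.mul' ℂ A t := by
  obtain ⟨t, rfl⟩ := H.T₁.symm.surjective t
  rw [LinearEquiv.apply_symm_apply]
  induction t with
  | zero => simp
  | add s t hs ht => simp only [map_add, hs, ht]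
  | tmul p q => rw [H.exists_counit.choose_spec.1, epsL_tmul]; rfl

/-- `∑ c x₍₁₎ ε(x₍₂₎) = c x`. -/
theorem epsR_T₂ (t : A ⊗[ℂ] A) : H.epsR (H.T₂ t) = LinearMap.mul' ℂ A t := by
  obtain ⟨t, rfl⟩ := H.T₂.symm.surjective t
  rw [LinearEquiv.apply_symm_apply]
  induction t with
  | zero => simp
  | add s t hs ht => simp only [map_add, hs, ht]
  | tmul p q => rw [H.exists_counit.choose_spec.2, epsR_tmul]; rfl

/-- `t ↦ Δ(x) t` on `A ⊗ A`. -/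
def comulMul (x : A) : A ⊗[ℂ] A →ₗ[ℂ] A ⊗[ℂ] A := (H.comul x).left

theorem tensor_mul_left_cancel (H : RegularMultiplierHopf A) {z z' : A ⊗[ℂ] A}
    (h : ∀ s, s * z = s * z') : z = z' := by
  apply eq_of_rTensor (fun a : A => μₗ a) H.mulLeft_cancel
  intro a
  apply eq_of_lTensor (fun a : A => μₗ a) H.mulLeft_cancel
  intro b
  have key : ∀ y : A ⊗[ℂ] A, (μₗ b).lTensor A ((μₗ a).rTensor A y) = (a ⊗ₜ b) * y := by
    intro y
    induction y with
    | zero => simp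
    | add y y' h h' => simp only [map_add, mul_add, h, h']
    | tmul v w => simp
  rw [key, key, h]

theorem of_comulMul (x : A) (t : A ⊗[ℂ] A) :
    Multiplier.of (H.comulMul x t) = H.comul x * Multiplier.of t := by
  apply Multiplier.ext <;> intro y
  · apply H.tensor_mul_left_cancel
    intro s
    simp only [Multiplier.of_left, Multiplier.mul_left, comulMul]
    rw [← mul_assoc, Multiplier.central, Multiplier.central, mul_assoc]
  · simp only [Multiplier.of_right, Multiplier.mul_right, comulMul, Multiplier.central]

theorem comulMul_tmul (x y c : A) : H.comulMul x (y ⊗ₜ c) = (μᵣ y).rTensor A (H.T₁ (x ⊗ₜ c)) := by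
  apply H.of_injective
  rw [of_comulMul, of_rTensor_mulRight, T₁_spec, mul_assoc, tmul_of_mul_tmul_of]

theorem comulMul_T₁ (x p q : A) : H.comulMul x (H.T₁ (p ⊗ₜ q)) = H.T₁ ((x * p) ⊗ₜ q) := by
  apply H.of_injective
  rw [of_comulMul, T₁_spec, T₁_spec, map_mul, mul_assoc]

theorem comulMul_T₃ (x p q : A) : H.comulMul x (H.T₃ (p ⊗ₜ q)) = H.T₃ ((x * p) ⊗ₜ q) := by
  apply H.of_injective
  rw [of_comulMul, T₃_spec, T₃_spec, map_mul, mul_assoc]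

theorem epsL_comulMul (x : A) (t : A ⊗[ℂ] A) : H.epsL (H.comulMul x t) = x * H.epsL t := by
  obtain ⟨t, rfl⟩ := H.T₁.surjective t
  induction t with
  | zero => simp
  | add s t hs ht => simp only [map_add, mul_add, hs, ht]
  | tmul p q => rw [comulMul_T₁, epsL_T₁, epsL_T₁]; simp [mul_assoc]

/-- The counit is multiplicative. -/
theorem counit_mul (x y : A) : H.counit (x * y) = H.counit x * H.counit y := by
  rcases subsingleton_or_nontrivial A with h | h
  · rw [Subsingleton.elim (x * y) 0, Subsingleton.elim x 0]; simp
  obtain ⟨c, hc⟩ := exists_ne (0 : A)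
  have key : ∀ t : A ⊗[ℂ] A, H.epsL ((μᵣ y).rTensor A t) = H.counit y • H.epsL t := by
    intro t
    obtain ⟨t, rfl⟩ := H.T₁.surjective t
    induction t with
    | zero => simp
    | add s t hs ht => simp only [map_add, smul_add, hs, ht]
    | tmul p q =>
      rw [← comulMul_tmul, epsL_comulMul, epsL_T₁]
      simp [mul_smul_comm]
  have := key (x ⊗ₜ c)
  rw [LinearMap.rTensor_tmul, epsL_tmul, epsL_tmul, smul_smul, LinearMap.mulRight_apply] at this
  rw [smul_left_injective ℂ hc this, mul_comm]

theorem exists_counit_eq_one [Nontrivial A] : ∃ a, H.counit a = 1 := by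
  by_contra! h
  have h0 : ∀ a, H.counit a = 0 := by
    intro a
    by_contra ha
    exact h ((H.counit a)⁻¹ • a) (by simp [ha])
  obtain ⟨c, hc⟩ := exists_ne (0 : A)
  apply hc
  apply H.nondegenerate.left
  intro b
  have h1 := H.epsL_T₁ (c ⊗ₜ b)
  have h2 : ∀ t : A ⊗[ℂ] A, H.epsL t = 0 := by
    intro t
    induction t with
    | zero => simp
    | add s t hs ht => simp only [map_add, hs, ht, add_zero]
    | tmul p q => simp [h0]
  rw [h2] at h1
  exact h1.symm

/-- `x ⊗ c ↦ ∑ x₍₂₎ ⊗ x₍₁₎ c`, whose inverse `q ⊗ c ↦ ∑ q₍₂₎ ⊗ S⁻¹(q₍₁₎) c` yields the inverse of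
the antipode. -/
def T₅ : A ⊗[ℂ] A ≃ₗ[ℂ] A ⊗[ℂ] A := H.T₃.trans (comm ℂ A A)

theorem T₅_apply (t : A ⊗[ℂ] A) : H.T₅ t = comm ℂ A A (H.T₃ t) := rfl

/-- `∑ ε(x₍₂₎) x₍₁₎ c = x c`. -/
theorem epsL_T₅ (t : A ⊗[ℂ] A) : H.epsL (H.T₅ t) = LinearMap.mul' ℂ A t := by
  rw [T₅_apply, epsL_comm]
  induction t with
  | zero => simp
  | add s t hs ht => simp only [map_add, hs, ht]
  | tmul p q =>
    apply sub_eq_zero.mp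
    apply H.mulLeft_cancel
    intro e
    rw [map_sub, sub_eq_zero, ← epsR_rTensor, T₃_T₂, epsR_rTensor, epsR_T₂]
    simp [mul_assoc]

/-- `∑ x₍₂₎ ε(x₍₁₎ c) = ε(c) x`. -/
theorem epsR_T₅ (x c : A) : H.epsR (H.T₅ (x ⊗ₜ c)) = H.counit c • x := by
  rw [T₅_apply, epsR_comm]
  apply sub_eq_zero.mp
  apply H.mulRight_cancel
  intro d
  rw [map_sub, sub_eq_zero, ← epsL_lTensor, ← T₁_T₃, ← comulMul_tmul, epsL_comulMul]
  simp [mul_smul_comm]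

/-- `T₅` is multiplicative in its first argument. -/
theorem T₅_mul (d x c : A) : H.T₅ ((d * x) ⊗ₜ c) =
    (LinearMap.mul' ℂ A).rTensor A (leg13 H.T₅.toLinearMap (leg23 H.T₅.toLinearMap
      ((d ⊗ₜ x) ⊗ₜ c))) := by
  rw [T₅_apply, ← comulMul_T₃, leg23_tmul, LinearEquiv.coe_coe, T₅_apply]
  generalize H.T₃ (x ⊗ₜ c) = t
  induction t with
  | zero => simp
  | add s t hs ht => simp only [map_add, hs, ht]
  | tmul p q =>
    have h1 : H.comulMul d (p ⊗ₜ q) = (μᵣ q).lTensor A (H.T₃ (d ⊗ₜ p)) := by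
      rw [comulMul_tmul, T₁_T₃]
    rw [h1, TensorProduct.comm_tmul, LinearMap.rTensor_tmul, TensorProduct.mk_apply, leg13_tmul,
      LinearEquiv.coe_coe, T₅_apply, ← rTensor_comm, ← LinearMap.rTensor_comp_apply]
    rfl

/-- Coassociativity again: both sides send `x ⊗ c ⊗ d` to `∑ x₍₂₎ ⊗ x₍₁₎ c ⊗ x₍₃₎ d`. -/
theorem leg12_T₅_leg13_T₁ : (leg12 H.T₅.toLinearMap * leg13 H.T₁.toLinearMap :
      Module.End ℂ ((A ⊗[ℂ] A) ⊗[ℂ] A)) = leg13 H.T₁.toLinearMap * leg12 H.T₅.toLinearMap := by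
  apply end_ext₃
  intro x c d
  apply eq_of_rTensor (fun e : A => (μₗ e).lTensor A)
    (fun v hv => eq_zero_of_lTensor (fun e : A => μₗ e) H.mulLeft_cancel hv)
  intro e
  have h0 : ∀ p, (μₗ e).lTensor A (H.T₅ (p ⊗ₜ c)) =
      comm ℂ A A ((μᵣ c).rTensor A (H.T₂ (e ⊗ₜ p))) := fun p => by
    rw [T₅_apply, lTensor_comm, T₃_T₂]
  have h1 : ∀ t : A ⊗[ℂ] A, ((μₗ e).lTensor A).rTensor A (leg12 H.T₅.toLinearMap
      (((TensorProduct.mk ℂ A A).flip c).rTensor A t)) =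
      ((comm ℂ A A).toLinearMap ∘ₗ (μᵣ c).rTensor A).rTensor A
        (leg12 H.T₂.toLinearMap ((TensorProduct.mk ℂ A A e).rTensor A t)) := by
    intro t
    induction t with
    | zero => simp
    | add s t hs ht => simp only [map_add, hs, ht]
    | tmul p q => simp [leg12_tmul, h0]
  have h2 : ∀ (s : A ⊗[ℂ] A), ((μₗ e).lTensor A).rTensor A (leg13 H.T₁.toLinearMap (s ⊗ₜ d)) =
      leg13 H.T₁.toLinearMap ((μₗ e).lTensor A s ⊗ₜ d) := by
    intro s
    induction s with
    | zero => simp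
    | add s t hs ht => simp only [map_add, TensorProduct.add_tmul, hs, ht]
    | tmul p q =>
      rw [leg13_tmul, LinearMap.lTensor_tmul, leg13_tmul, ← LinearMap.rTensor_comp_apply]
      rfl
  have h3 : ∀ (s : A ⊗[ℂ] A), leg13 H.T₁.toLinearMap (comm ℂ A A ((μᵣ c).rTensor A s) ⊗ₜ d) =
      ((comm ℂ A A).toLinearMap ∘ₗ (μᵣ c).rTensor A).rTensor A
        (leg23 H.T₁.toLinearMap (s ⊗ₜ d)) := by
    intro s
    induction s with
    | zero => simp
    | add s t hs ht => simp only [map_add, TensorProduct.add_tmul, hs, ht]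
    | tmul p q =>
      rw [LinearMap.rTensor_tmul, TensorProduct.comm_tmul, leg13_tmul, leg23_tmul,
        ← LinearMap.rTensor_comp_apply]
      rfl
  rw [Module.End.mul_apply, Module.End.mul_apply, leg12_tmul, leg13_tmul, h1, h2,
    LinearEquiv.coe_coe, LinearEquiv.coe_coe, h0, h3, ← LinearEquiv.coe_coe, ← leg23_tmul,
    ← LinearEquiv.coe_coe H.T₂, ← leg12_tmul]
  exact congrArg _ (LinearMap.congr_fun H.leg12_T₂_leg23_T₁ ((e ⊗ₜ x) ⊗ₜ d))

/-- `p ⊗ c ↦ S⁻¹(p) c`, where `S` is the antipode. Only this covered form of `S⁻¹` is needed; the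
antipode itself, with values in the multipliers, is not constructed. -/
def invAntipode : A ⊗[ℂ] A →ₗ[ℂ] A := H.epsL ∘ₗ H.T₅.symm.toLinearMap

theorem invAntipode_T₅ (t : A ⊗[ℂ] A) : H.invAntipode (H.T₅ t) = H.epsL t := by
  simp [invAntipode]

theorem invAntipode_surjective [Nontrivial A] (c : A) : ∃ t, H.invAntipode t = c := by
  obtain ⟨x, hx⟩ := H.exists_counit_eq_one
  exact ⟨H.T₅ (x ⊗ₜ c), by rw [invAntipode_T₅, epsL_tmul, hx, one_smul]⟩

/-- `∑ q₍₂₎ S⁻¹(q₍₁₎) c = ε(q) c`. -/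
theorem mul_T₅_symm (t : A ⊗[ℂ] A) : LinearMap.mul' ℂ A (H.T₅.symm t) = H.epsL t := by
  rw [← epsL_T₅, LinearEquiv.apply_symm_apply]

/-- `T₅⁻¹(q ⊗ c) = ∑ q₍₂₎ ⊗ S⁻¹(q₍₁₎) c`, multiplied by `d` in the first factor. -/
theorem T₅_symm_mulRight (q c d : A) : (H.invAntipode.rTensor A)
      (rightComm ℂ A A A (H.T₁ (q ⊗ₜ d) ⊗ₜ c)) =
    comm ℂ A A ((μᵣ d).rTensor A (H.T₅.symm (q ⊗ₜ c))) := by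
  have h1 : leg12 H.T₅.symm.toLinearMap (leg13 H.T₁.toLinearMap ((q ⊗ₜ c) ⊗ₜ d)) =
      leg13 H.T₁.toLinearMap (leg12 H.T₅.symm.toLinearMap ((q ⊗ₜ c) ⊗ₜ d)) := by
    have h : H.T₅.symm.toLinearMap * H.T₅.toLinearMap = 1 := by
      apply LinearMap.ext; intro x; simp
    have h' : H.T₅.toLinearMap * H.T₅.symm.toLinearMap = 1 := by
      apply LinearMap.ext; intro x; simp
    have h2 : (leg12 H.T₅.symm.toLinearMap * leg13 H.T₁.toLinearMap :
        Module.End ℂ ((A ⊗[ℂ] A) ⊗[ℂ] A)) =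
        leg13 H.T₁.toLinearMap * leg12 H.T₅.symm.toLinearMap := by
      calc _ = leg12 H.T₅.symm.toLinearMap * (leg13 H.T₁.toLinearMap * leg12 H.T₅.toLinearMap) *
            leg12 H.T₅.symm.toLinearMap := by
            rw [mul_assoc, mul_assoc, ← leg12_mul, h', leg12_one, mul_one]
        _ = _ := by
            rw [← leg12_T₅_leg13_T₁, ← mul_assoc, ← leg12_mul, h, leg12_one, one_mul]
    exact LinearMap.congr_fun h2 _
  have h2 : ∀ z, H.epsL.rTensor A (leg12 H.T₅.symm.toLinearMap z) = H.invAntipode.rTensor A z :=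
    fun z => by rw [leg12, ← LinearMap.rTensor_comp_apply]; rfl
  have h3 : ∀ s : A ⊗[ℂ] A, H.epsL.rTensor A (leg13 H.T₁.toLinearMap (s ⊗ₜ d)) =
      comm ℂ A A ((μᵣ d).rTensor A s) := by
    intro s
    induction s with
    | zero => simp
    | add s t hs ht => simp only [map_add, TensorProduct.add_tmul, hs, ht]
    | tmul p r =>
      have h4 : ∀ t : A ⊗[ℂ] A, H.epsL.rTensor A (((TensorProduct.mk ℂ A A).flip r).rTensor A t) =
          r ⊗ₜ H.epsL t := by
        intro t
        induction t with
        | zero => simp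
        | add s t hs ht => simp only [map_add, TensorProduct.tmul_add, hs, ht]
        | tmul u v => simp [TensorProduct.smul_tmul]
      rw [leg13_tmul, h4, LinearEquiv.coe_coe, epsL_T₁]
      simp
  have h5 := congrArg (H.epsL.rTensor A) h1
  rw [h2, leg12_tmul, h3] at h5
  simpa [leg13] using h5

/-- `S⁻¹` is antimultiplicative: `S⁻¹(d x) c = S⁻¹(x) (S⁻¹(d) c)`. -/
theorem invAntipode_mul (d x c : A) : H.invAntipode ((d * x) ⊗ₜ c) =
    H.invAntipode (x ⊗ₜ H.invAntipode (d ⊗ₜ c)) := by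
  have h1 : H.invAntipode ∘ₗ (LinearMap.mul' ℂ A).rTensor A = H.invAntipode ∘ₗ
      H.invAntipode.lTensor A ∘ₗ (TensorProduct.leftComm ℂ A A A).toLinearMap ∘ₗ
        (assoc ℂ A A A).toLinearMap := by
    -- it suffices to compare the two sides on `∑ d₍₂₎ ⊗ x₍₂₎ ⊗ d₍₁₎ x₍₁₎ c`
    have h2 : ∀ z : (A ⊗[ℂ] A) ⊗[ℂ] A,
        ∃ y, leg13 H.T₅.toLinearMap (leg23 H.T₅.toLinearMap y) = z := by
      have h : H.T₅.toLinearMap * H.T₅.symm.toLinearMap = 1 := by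
        apply LinearMap.ext; intro x; simp
      intro z
      refine ⟨leg23 H.T₅.symm.toLinearMap (leg13 H.T₅.symm.toLinearMap z), ?_⟩
      rw [← Module.End.mul_apply (leg23 _), ← leg23_mul, h, leg23_one, Module.End.one_apply,
        ← Module.End.mul_apply, ← leg13_mul, h, leg13_one, Module.End.one_apply]
    have h3 : ∀ y : A ⊗[ℂ] A, ∀ d : A,
        H.invAntipode (H.invAntipode.lTensor A (TensorProduct.leftComm ℂ A A A (assoc ℂ A A A
          (leg13 H.T₅.toLinearMap ((TensorProduct.mk ℂ A A d).rTensor A y))))) =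
        H.counit d • H.invAntipode y := by
      intro y d
      induction y with
      | zero => simp
      | add s t hs ht => simp only [map_add, smul_add, hs, ht]
      | tmul p q =>
        have h4 : ∀ t : A ⊗[ℂ] A, H.invAntipode.lTensor A (TensorProduct.leftComm ℂ A A A
            (assoc ℂ A A A (((TensorProduct.mk ℂ A A).flip p).rTensor A t))) =
            p ⊗ₜ H.invAntipode t := by
          intro t
          induction t with
          | zero => simp
          | add s t hs ht => simp only [map_add, TensorProduct.tmul_add, hs, ht]
          | tmul u v => simp
        rw [LinearMap.rTensor_tmul, TensorProduct.mk_apply, leg13_tmul, h4, LinearEquiv.coe_coe,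
          invAntipode_T₅]
        simp
    apply LinearMap.ext
    intro z
    obtain ⟨y, rfl⟩ := h2 z
    induction y with
    | zero => simp
    | add s t hs ht => simp only [map_add, hs, ht]
    | tmul y c =>
      induction y with
      | zero => simp
      | add s t hs ht => simp only [map_add, TensorProduct.add_tmul, hs, ht]
      | tmul d x =>
        simp only [LinearMap.comp_apply, LinearEquiv.coe_coe]
        rw [← T₅_mul, invAntipode_T₅, leg23_tmul, h3, LinearEquiv.coe_coe, invAntipode_T₅]
        simp [counit_mul, smul_smul]
  exact LinearMap.congr_fun h1 ((d ⊗ₜ x) ⊗ₜ c)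

/-- `∑ b₍₂₎ S⁻¹(d b₍₁₎) c = ε(b) S⁻¹(d) c`. -/
theorem mul_invAntipode_T₂ (d b c : A) :
    LinearMap.mul' ℂ A ((H.invAntipode ∘ₗ (TensorProduct.mk ℂ A A).flip c).lTensor A
      (comm ℂ A A (H.T₂ (d ⊗ₜ b)))) = H.counit b • H.invAntipode (d ⊗ₜ c) := by
  classical
  set e := H.invAntipode (d ⊗ₜ c) with he
  obtain ⟨S, hS⟩ := exists_finset_lTensor
    ((H.invAntipode ∘ₗ (TensorProduct.mk ℂ A A).flip c).lTensor A (comm ℂ A A (H.T₂ (d ⊗ₜ b))))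
  obtain ⟨S', hS'⟩ := exists_finset_lTensor (H.T₅.symm (b ⊗ₜ e))
  obtain ⟨x, hx⟩ := H.exists_left_unit (S ∪ S')
  have h0 : ∀ t : A ⊗[ℂ] A, LinearMap.mul' ℂ A ((μₗ x).lTensor A t) =
      LinearMap.mul' ℂ A ((μᵣ x).rTensor A t) := by
    intro t
    induction t with
    | zero => simp
    | add s t hs ht => simp only [map_add, hs, ht]
    | tmul u v => simp [mul_assoc]
  rw [← hS (μₗ x) fun v hv => hx v (Finset.mem_union_left _ hv), h0, rTensor_lTensor_comm,
    rTensor_comm, T₂_T₁]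
  have h1 : ∀ t : A ⊗[ℂ] A, (H.invAntipode ∘ₗ (TensorProduct.mk ℂ A A).flip c).lTensor A
      (comm ℂ A A ((μₗ d).rTensor A t)) =
      comm ℂ A A (H.invAntipode.rTensor A (rightComm ℂ A A A (t ⊗ₜ e))) := by
    intro t
    induction t with
    | zero => simp
    | add s t hs ht => simp only [map_add, TensorProduct.add_tmul, hs, ht]
    | tmul u v => simp [invAntipode_mul, he]
  rw [h1, T₅_symm_mulRight, TensorProduct.comm_comm, ← h0,
    hS' (μₗ x) fun v hv => hx v (Finset.mem_union_right _ hv), mul_T₅_symm, epsL_tmul]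

/-! ### Maps determined by covered coproducts -/

/-- A linear map `w : A → A ⊗ Z` is of the form `w(a) = ∑ a₍₁₎ ⊗ τ(a₍₂₎)`, the formula being read
after multiplication of the first factor on the left. -/
def IsCovered {Z : Type*} [AddCommGroup Z] [Module ℂ Z] (τ : A →ₗ[ℂ] Z) (w : A →ₗ[ℂ] A ⊗[ℂ] Z) :
    Prop :=
  ∀ c a : A, (μₗ c).rTensor Z (w a) = τ.lTensor A (H.T₂ (c ⊗ₜ a))

variable {H}

/-- Coassociativity for `w(a) = ∑ a₍₁₎ ⊗ τ(a₍₂₎)`: both sides are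
`∑ c a₍₁₎ ⊗ a₍₂₎ ⊗ τ(a₍₃₎)`. -/
theorem IsCovered.T₂_rTensor {Z : Type*} [AddCommGroup Z] [Module ℂ Z] {τ : A →ₗ[ℂ] Z}
    {w : A →ₗ[ℂ] A ⊗[ℂ] Z} (hw : H.IsCovered τ w) (c a : A) :
    H.T₂.toLinearMap.rTensor Z ((assoc ℂ A A Z).symm (c ⊗ₜ w a)) =
      (assoc ℂ A A Z).symm (w.lTensor A (H.T₂ (c ⊗ₜ a))) := by
  apply eq_of_rTensor (fun e : A => (μₗ e).lTensor A)
    (fun v hv => eq_zero_of_lTensor (fun e : A => μₗ e) H.mulLeft_cancel hv)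
  intro e
  -- the two sides, multiplied by `e`, are the values at `y = c ⊗ e` of expressions
  -- `∑ y Δ(a₍₁₎) ⊗ τ(a₍₂₎)` which are linear in `y`; write `y` as a sum of `T₂ (c' ⊗ f)`
  have h1 : ∀ t : A ⊗[ℂ] Z, ((μₗ e).lTensor A).rTensor Z
      (H.T₂.toLinearMap.rTensor Z ((assoc ℂ A A Z).symm (c ⊗ₜ t))) =
      H.mulComul₂.rTensor Z ((assoc ℂ (A ⊗[ℂ] A) A Z).symm ((c ⊗ₜ e) ⊗ₜ t)) := by
    intro t
    induction t with
    | zero => simp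
    | add s t hs ht => simp only [map_add, TensorProduct.tmul_add, hs, ht]
    | tmul p q => simp [mulComul₂_tmul]
  have h2 : ∀ t : A ⊗[ℂ] A, ((μₗ e).lTensor A).rTensor Z
      ((assoc ℂ A A Z).symm (w.lTensor A t)) = τ.lTensor (A ⊗[ℂ] A)
        (leg23 H.T₂.toLinearMap (((TensorProduct.mk ℂ A A).flip e).rTensor A t)) := by
    intro t
    induction t with
    | zero => simp
    | add s t hs ht => simp only [map_add, hs, ht]
    | tmul p q =>
      rw [LinearMap.rTensor_tmul, LinearMap.lTensor_tmul, LinearMap.flip_apply,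
        TensorProduct.mk_apply, leg23_tmul, ← rTensor_lTensor_comm, LinearEquiv.coe_coe, ← hw]
      generalize w q = s
      induction s with
      | zero => simp
      | add s t hs ht => simp only [map_add, TensorProduct.tmul_add, hs, ht]
      | tmul u v => simp
  have h3 : ∀ y : A ⊗[ℂ] A, H.mulComul₂.rTensor Z ((assoc ℂ (A ⊗[ℂ] A) A Z).symm (y ⊗ₜ w a)) =
      τ.lTensor (A ⊗[ℂ] A) (leg23 H.T₂.toLinearMap (leg13 H.T₂.toLinearMap (y ⊗ₜ a))) := by
    intro y
    obtain ⟨y, rfl⟩ := H.T₂.surjective y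
    induction y with
    | zero => simp
    | add s t hs ht => simp only [map_add, TensorProduct.add_tmul, hs, ht]
    | tmul d f =>
      have h4 : ∀ t : A ⊗[ℂ] Z, H.mulComul₂.rTensor Z ((assoc ℂ (A ⊗[ℂ] A) A Z).symm
          (H.T₂ (d ⊗ₜ f) ⊗ₜ t)) = H.T₂.toLinearMap.rTensor Z
            ((TensorProduct.mk ℂ A A d).rTensor Z ((μₗ f).rTensor Z t)) := by
        intro t
        induction t with
        | zero => simp
        | add s t hs ht => simp only [map_add, TensorProduct.tmul_add, hs, ht]
        | tmul p q => simp [T₂_mul₂]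
      have h5 := LinearMap.congr_fun H.T₂_pentagon ((d ⊗ₜ f) ⊗ₜ a)
      simp only [Module.End.mul_apply, leg12_tmul, LinearEquiv.coe_coe] at h5
      rw [h4, hw, ← h5, rTensor_lTensor_comm, rTensor_lTensor_comm, leg23_tmul]
      rfl
  rw [h1, h2, h3, leg13_tmul, LinearEquiv.coe_coe]

end RegularMultiplierHopf

section Legs

variable {L M N : Type*} [AddCommGroup L] [Module ℂ L] [AddCommGroup M] [Module ℂ M]
  [AddCommGroup N] [Module ℂ N]

theorem leg13_tmul_eq_rightComm (f : Module.End ℂ (L ⊗[ℂ] N)) (t : L ⊗[ℂ] M) (z : N) :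
    leg13 f (t ⊗ₜ z) =
      rightComm ℂ L N M ((f ∘ₗ (TensorProduct.mk ℂ L N).flip z).rTensor M t) := by
  induction t with
  | zero => simp
  | add s t hs ht => simp only [map_add, TensorProduct.add_tmul, hs, ht]
  | tmul x y => simp [leg13]

end Legs

/-! ### The twist map and the smash product -/

namespace RightModuleAlgebra

variable {A : Type u} [NonUnitalRing A] [Module ℂ A] [IsScalarTower ℂ A A] [SMulCommClass ℂ A A]
variable {B : Type v} [NonUnitalRing B] [Module ℂ B] [IsScalarTower ℂ B B] [SMulCommClass ℂ B B]
variable {H : RegularMultiplierHopf A} (α : RightModuleAlgebra B H)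

/-- Since `B ◁ A = B`, local units of `A` act as local units on `B`. -/
theorem exists_act_unit (α : RightModuleAlgebra B H) (S : Finset B) :
    ∃ e : A, ∀ b ∈ S, α.act b e = b := by
  classical
  have h : ∀ b : B, ∃ S : Finset A, ∀ e, (∀ y ∈ S, y * e = y) → α.act b e = b := by
    intro b
    have hb : b ∈ Submodule.span ℂ {z : B | ∃ b a, z = α.act b a} := by rw [α.unital]; trivial
    induction hb using Submodule.span_induction with
    | zero => exact ⟨∅, by simp⟩
    | add x y _ _ hx hy =>
      obtain ⟨S, hS⟩ := hx
      obtain ⟨S', hS'⟩ := hy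
      refine ⟨S ∪ S', fun e he => ?_⟩
      rw [map_add, LinearMap.add_apply, hS e fun y hy => he y (Finset.mem_union_left _ hy),
        hS' e fun y hy => he y (Finset.mem_union_right _ hy)]
    | smul c x _ hx =>
      obtain ⟨S, hS⟩ := hx
      exact ⟨S, fun e he => by rw [map_smul, LinearMap.smul_apply, hS e he]⟩
    | mem x hx =>
      obtain ⟨b, a, rfl⟩ := hx
      exact ⟨{a}, fun e he => by rw [← α.act_mul, he a (by simp)]⟩
  choose T hT using h
  obtain ⟨e, he⟩ := H.exists_right_unit (S.biUnion T)
  exact ⟨e, fun b hb => hT b e fun y hy => he y (Finset.mem_biUnion.mpr ⟨b, hb, hy⟩)⟩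

/-- `x ⊗ (b ◁ y)` is the image under `R` of `(b ◁ ·) ⊗ ι` applied to `T₄⁻¹(x ⊗ y)`. -/
theorem twist_surjective : Function.Surjective α.twist := by
  rw [← LinearMap.range_eq_top, eq_top_iff, ← TensorProduct.span_tmul_eq_top, Submodule.span_le]
  rintro _ ⟨x, b, rfl⟩
  have hb : b ∈ Submodule.span ℂ {z : B | ∃ b a, z = α.act b a} := by rw [α.unital]; trivial
  induction hb using Submodule.span_induction with
  | zero => simp
  | add y z _ _ hy hz => rw [TensorProduct.tmul_add]; exact add_mem hy hz
  | smul c y _ hy => rw [TensorProduct.tmul_smul]; exact Submodule.smul_mem _ c hy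
  | mem y hy =>
    obtain ⟨b, y, rfl⟩ := hy
    have key : ∀ t : A ⊗[ℂ] A, (α.act b).lTensor A (H.T₄ t) = α.twist ((α.act b).rTensor A t) := by
      intro t
      induction t with
      | zero => simp
      | add y y' h h' => simp only [map_add, h, h']
      | tmul e a => rw [LinearMap.rTensor_tmul, twist_act]
    refine ⟨(α.act b).rTensor A (H.T₄.symm (x ⊗ₜ y)), ?_⟩
    rw [← key]
    simp

/-- The inverse of `R` is `x ⊗ b ↦ ∑ (b ◁ S⁻¹(x₍₂₎)) ⊗ x₍₁₎`. It is read off from `T₄⁻¹`, after the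
elements of `B` that occur have been written as `b = b ◁ e₁`. -/
theorem twist_injective : Function.Injective α.twist := by
  rw [injective_iff_map_eq_zero]
  intro z hz
  obtain ⟨S, hS⟩ := exists_finset_rTensor z
  obtain ⟨e₁, he₁⟩ := α.exists_act_unit S
  have hz1 : (α.act.flip e₁).rTensor A z = z := hS _ he₁
  obtain ⟨e, he⟩ := H.exists_right_unit_lTensor
    ((assoc ℂ B A A).symm ((H.T₄.toLinearMap ∘ₗ TensorProduct.mk ℂ A A e₁).lTensor B z))
  let Ψ : B ⊗[ℂ] (A ⊗[ℂ] A) →ₗ[ℂ] B ⊗[ℂ] A :=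
    TensorProduct.lift (LinearMap.rTensorHom A ∘ₗ α.act) ∘ₗ H.T₄.symm.toLinearMap.lTensor B
  let Q : A ⊗[ℂ] B →ₗ[ℂ] B ⊗[ℂ] A := TensorProduct.lift ((LinearMap.rTensorHom A ∘ₗ α.act).compl₂
    (H.T₄.symm.toLinearMap ∘ₗ (TensorProduct.mk ℂ A A).flip e)) ∘ₗ (comm ℂ A B).toLinearMap
  have hT : ∀ q t, H.T₄.symm ((μₗ q).lTensor A t) = (μₗ q).rTensor A (H.T₄.symm t) := by
    intro q t
    apply H.T₄.injective
    rw [LinearEquiv.apply_symm_apply, H.T₄_mulLeft, LinearEquiv.apply_symm_apply]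
  have h1 : ∀ (b : B) (t : A ⊗[ℂ] A), Q ((α.act b).lTensor A t) =
      Ψ (b ⊗ₜ (μᵣ e).lTensor A t) := by
    intro b t
    induction t with
    | zero => simp
    | add s t hs ht => simp only [map_add, TensorProduct.tmul_add, hs, ht]
    | tmul p q =>
      have hq : p ⊗ₜ[ℂ] (q * e) = (μₗ q).lTensor A (p ⊗ₜ[ℂ] e) := by simp
      simp only [Q, Ψ, LinearMap.lTensor_tmul, LinearMap.comp_apply, LinearEquiv.coe_coe,
        TensorProduct.comm_tmul, TensorProduct.lift.tmul, LinearMap.compl₂_apply,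
        LinearMap.flip_apply, TensorProduct.mk_apply, LinearMap.mulRight_apply,
        LinearMap.coe_rTensorHom]
      rw [hq, hT, ← LinearMap.rTensor_comp_apply]
      congr 2
      apply LinearMap.ext
      intro y
      simp [α.act_mul]
  have h2 : ∀ z : B ⊗[ℂ] A, Q (α.twist ((α.act.flip e₁).rTensor A z)) =
      Ψ (assoc ℂ B A A ((μᵣ e).lTensor (B ⊗[ℂ] A) ((assoc ℂ B A A).symm
        ((H.T₄.toLinearMap ∘ₗ TensorProduct.mk ℂ A A e₁).lTensor B z)))) := by
    intro z
    induction z with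
    | zero => simp
    | add s t hs ht => simp only [map_add, hs, ht]
    | tmul b a =>
      rw [LinearMap.rTensor_tmul, LinearMap.flip_apply, twist_act, h1, LinearMap.lTensor_tmul]
      congr 1
      simp only [LinearMap.comp_apply, LinearEquiv.coe_coe, TensorProduct.mk_apply]
      generalize H.T₄ (e₁ ⊗ₜ a) = t
      induction t with
      | zero => simp
      | add s t hs ht => simp only [map_add, TensorProduct.tmul_add, hs, ht]
      | tmul p q => simp
  have h3 : ∀ z : B ⊗[ℂ] A, Ψ ((H.T₄.toLinearMap ∘ₗ TensorProduct.mk ℂ A A e₁).lTensor B z) =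
      (α.act.flip e₁).rTensor A z := by
    intro z
    induction z with
    | zero => simp
    | add s t hs ht => simp only [map_add, hs, ht]
    | tmul b a => simp [Ψ]
  have h4 := h2 z
  rw [he, LinearEquiv.apply_symm_apply, h3, hz1, hz, map_zero] at h4
  exact h4.symm

/-- `a ⊗ b ↦ ∑ a₍₁₎ ⊗ (b ◁ a₍₂₎)`, as a bijection of `A ⊗ B`: the twist map `R` with its source in
the order `A ⊗ B`. -/
def r : A ⊗[ℂ] B ≃ₗ[ℂ] A ⊗[ℂ] B :=
  (comm ℂ A B).trans (LinearEquiv.ofBijective α.twist ⟨α.twist_injective, α.twist_surjective⟩)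

/-- `a ⊗ b ↦ ∑ a₍₂₎ ⊗ (b ◁ a₍₁₎)`: the map `Rᵒᵖ` with its source in the order `A ⊗ B`. -/
def rop : Module.End ℂ (A ⊗[ℂ] B) := α.twistOp ∘ₗ (comm ℂ A B).toLinearMap

@[simp] theorem rop_tmul (a : A) (b : B) : α.rop (a ⊗ₜ b) = α.twistOp (b ⊗ₜ a) := rfl

/-- `R(b ⊗ a)` is an element of the form `∑ a₍₁₎ ⊗ τ(a₍₂₎)`. -/
theorem twist_isCovered (b : B) :
    H.IsCovered (α.act b) (α.twist ∘ₗ TensorProduct.mk ℂ B A b) := fun c a =>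
  α.twist_spec c b a

/-- Both sides are `∑ a₍₂₎ ⊗ (d ◁ a₍₁₎) ⊗ τ(a₍₃₎)`. -/
theorem rop_rTensor {Z : Type*} [AddCommGroup Z] [Module ℂ Z] {τ : A →ₗ[ℂ] Z}
    {w : A →ₗ[ℂ] A ⊗[ℂ] Z} (hw : H.IsCovered τ w) (a : A) (d : B) :
    α.rop.rTensor Z (rightComm ℂ A Z B (w a ⊗ₜ d)) =
      rightComm ℂ A Z B (w.rTensor B (α.rop (a ⊗ₜ d))) := by
  have hd : d ∈ Submodule.span ℂ {z : B | ∃ b a, z = α.act b a} := by rw [α.unital]; trivial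
  induction hd using Submodule.span_induction with
  | zero => simp
  | add x y _ _ hx hy => simp only [TensorProduct.tmul_add, map_add, hx, hy]
  | smul c x _ hx => simp only [TensorProduct.tmul_smul, map_smul, hx]
  | mem x hx =>
    obtain ⟨d, y, rfl⟩ := hx
    have h1 : ∀ t : A ⊗[ℂ] Z, α.rop.rTensor Z (rightComm ℂ A Z B (t ⊗ₜ α.act d y)) =
        ((α.act d).lTensor A ∘ₗ (comm ℂ A A).toLinearMap).rTensor Z
          (H.T₂.toLinearMap.rTensor Z ((assoc ℂ A A Z).symm (y ⊗ₜ t))) := by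
      intro t
      induction t with
      | zero => simp
      | add s t hs ht => simp only [map_add, TensorProduct.add_tmul, TensorProduct.tmul_add, hs, ht]
      | tmul p q => simp [twistOp_act]
    have h2 : ∀ t : A ⊗[ℂ] A, ((α.act d).lTensor A ∘ₗ (comm ℂ A A).toLinearMap).rTensor Z
        ((assoc ℂ A A Z).symm (w.lTensor A t)) =
        rightComm ℂ A Z B (w.rTensor B ((α.act d).lTensor A (comm ℂ A A t))) := by
      intro t
      induction t with
      | zero => simp
      | add s t hs ht => simp only [map_add, hs, ht]
      | tmul p q =>
        simp only [LinearMap.lTensor_tmul, TensorProduct.comm_tmul, LinearMap.rTensor_tmul]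
        generalize w q = s
        induction s with
        | zero => simp
        | add s t hs ht =>
          simp only [map_add, TensorProduct.add_tmul, TensorProduct.tmul_add, hs, ht]
        | tmul u v => simp
    rw [h1, hw.T₂_rTensor, h2, rop_tmul, twistOp_act]

/-- Both sides send `a ⊗ d ⊗ b` to `∑ a₍₂₎ ⊗ (d ◁ a₍₁₎) ⊗ (b ◁ a₍₃₎)`. -/
theorem leg12_rop_leg13_r : (leg12 α.rop * leg13 α.r.toLinearMap :
    Module.End ℂ ((A ⊗[ℂ] B) ⊗[ℂ] B)) = leg13 α.r.toLinearMap * leg12 α.rop := by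
  apply end_ext₃
  intro a d b
  have h := α.rop_rTensor (α.twist_isCovered b) a d
  rw [Module.End.mul_apply, Module.End.mul_apply, leg12_tmul, leg13_tmul_eq_rightComm,
    leg13_tmul_eq_rightComm]
  exact h

/-- The smash product has left local units `ef`: since `AB = BA`, an element of `AB` is fixed by
some `f ∈ B` from the left, and by some `e ∈ A`. -/
theorem exists_smashMul_left_unit (K : RegularMultiplierHopf B) (z : A ⊗[ℂ] B) :
    ∃ x, α.smashMul (x ⊗ₜ z) = z := by
  obtain ⟨e, he⟩ := H.exists_left_unit_rTensor z
  obtain ⟨y, rfl⟩ := α.twist_surjective z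
  obtain ⟨f, hf⟩ := K.exists_left_unit_rTensor y
  have h : ∀ y : B ⊗[ℂ] A, α.mulLeftB f (α.twist y) = α.twist ((μₗ f).rTensor A y) := by
    intro y
    induction y with
    | zero => simp
    | add s t hs ht => simp only [map_add, hs, ht]
    | tmul p q => rw [LinearMap.rTensor_tmul, LinearMap.mulLeft_apply, twist_mul_left]
  exact ⟨e ⊗ₜ f, by rw [smashMul_tmul_left, h, hf, he]⟩

theorem exists_smashMul_right_unit (K : RegularMultiplierHopf B) (z : A ⊗[ℂ] B) :
    ∃ x, α.smashMul (z ⊗ₜ x) = z := by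
  obtain ⟨f, hf⟩ := K.exists_right_unit_lTensor z
  obtain ⟨y, rfl⟩ := α.twist_surjective z
  obtain ⟨e, he⟩ := H.exists_right_unit_lTensor y
  have h : ∀ y : B ⊗[ℂ] A, α.mulRightA e (α.twist y) = α.twist ((μᵣ e).lTensor B y) := by
    intro y
    induction y with
    | zero => simp
    | add s t hs ht => simp only [map_add, hs, ht]
    | tmul p q => rw [LinearMap.lTensor_tmul, LinearMap.mulRight_apply, twist_mul_right]
  exact ⟨e ⊗ₜ f, by rw [smashMul_tmul_right, h, he, hf]⟩

theorem exists_left_unit (K : RegularMultiplierHopf B) (z : α.Smash) : ∃ x, x * z = z := by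
  obtain ⟨x, hx⟩ := α.exists_smashMul_left_unit K (α.toSmash.symm z)
  exact ⟨α.toSmash x, by
    rw [smash_mul_def, LinearEquiv.symm_apply_apply, hx, LinearEquiv.apply_symm_apply]⟩

theorem exists_right_unit (K : RegularMultiplierHopf B) (z : α.Smash) : ∃ x, z * x = z := by
  obtain ⟨x, hx⟩ := α.exists_smashMul_right_unit K (α.toSmash.symm z)
  exact ⟨α.toSmash x, by
    rw [smash_mul_def, LinearEquiv.symm_apply_apply, hx, LinearEquiv.apply_symm_apply]⟩

theorem smash_nondegenerate (K : RegularMultiplierHopf B) : NondegenerateProduct α.Smash where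
  left a h := by
    obtain ⟨x, hx⟩ := α.exists_right_unit K a
    rw [← hx, h]
  right a h := by
    obtain ⟨x, hx⟩ := α.exists_left_unit K a
    rw [← hx, h]

end RightModuleAlgebra

/-! ### Bijectivity of the cotwist map -/

namespace LeftComoduleCoalgebra

variable {A : Type u} [NonUnitalRing A] [Module ℂ A] [IsScalarTower ℂ A A] [SMulCommClass ℂ A A]
variable {B : Type v} [NonUnitalRing B] [Module ℂ B] [IsScalarTower ℂ B B] [SMulCommClass ℂ B B]
variable {H : RegularMultiplierHopf A} {K : RegularMultiplierHopf B}
variable (γ : LeftComoduleCoalgebra H K)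

/-- `τ : a ⊗ b ↦ ∑ a₍₀₎ ⊗ a₍₋₁₎ b`, where `Γ(a) = ∑ a₍₋₁₎ ⊗ a₍₀₎`: the map `T` with its target in
the order `A ⊗ B`. -/
def tau : Module.End ℂ (A ⊗[ℂ] B) := (comm ℂ B A).toLinearMap ∘ₗ γ.T

/-- `a ⊗ b ↦ ∑ a₍₀₎ ⊗ b a₍₋₁₎`: the map `Tᵒᵖ` with its target in the order `A ⊗ B`. -/
def tauOp : Module.End ℂ (A ⊗[ℂ] B) := (comm ℂ B A).toLinearMap ∘ₗ γ.Top

theorem tau_apply (t : A ⊗[ℂ] B) : γ.tau t = comm ℂ B A (γ.T t) := rfl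

theorem tauOp_apply (t : A ⊗[ℂ] B) : γ.tauOp t = comm ℂ B A (γ.Top t) := rfl

/-- `b (Γ(a)(b' ⊗ 1)) = ((b ⊗ 1)Γ(a)) b'`. -/
theorem mul_T (a : A) (b b' : B) : (μₗ b).rTensor A (γ.T (a ⊗ₜ b')) =
    (μᵣ b').rTensor A (γ.Top (a ⊗ₜ b)) :=
  (γ.coact a).2 b b'

/-- The map `T` is right linear over `B`. -/
theorem T_mul (d : B) (t : A ⊗[ℂ] B) : γ.T ((μᵣ d).lTensor A t) = (μᵣ d).rTensor A (γ.T t) := by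
  induction t with
  | zero => simp
  | add s t hs ht => simp only [map_add, hs, ht]
  | tmul a b =>
    apply RegularMultiplierHopf.eq_of_rTensor (fun c : B => μₗ c) K.mulLeft_cancel
    intro c
    have h : ∀ s : B ⊗[ℂ] A, (μₗ c).rTensor A ((μᵣ d).rTensor A s) =
        (μᵣ d).rTensor A ((μₗ c).rTensor A s) := by
      intro s
      rw [← LinearMap.rTensor_comp_apply, ← LinearMap.rTensor_comp_apply]
      congr 2
      ext x
      simp [mul_assoc]
    rw [LinearMap.lTensor_tmul, h, mul_T, mul_T, ← LinearMap.rTensor_comp_apply]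
    congr 2
    ext x
    simp [mul_assoc]

theorem mul_tau (a : A) (b b' : B) : (μₗ b).lTensor A (γ.tau (a ⊗ₜ b')) =
    (μᵣ b').lTensor A (γ.tauOp (a ⊗ₜ b)) := by
  rw [tau_apply, tauOp_apply, lTensor_comm, lTensor_comm, mul_T]

theorem tau_mul (d : B) (t : A ⊗[ℂ] B) :
    γ.tau ((μᵣ d).lTensor A t) = (μᵣ d).lTensor A (γ.tau t) := by
  rw [tau_apply, tau_apply, lTensor_comm, T_mul]

/-- The injectivity of `Γ`. -/
theorem tau_cancel (a : A) (h : ∀ b, γ.tau (a ⊗ₜ b) = 0) : a = 0 := by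
  have h1 : ∀ b, γ.T (a ⊗ₜ b) = 0 := fun b => (comm ℂ B A).injective (by
    rw [map_zero]; exact h b)
  have h2 : ∀ b, γ.Top (a ⊗ₜ b) = 0 := by
    intro b
    apply eq_zero_of_rTensor (fun c : B => μᵣ c) K.mulRight_cancel
    intro c
    rw [← mul_T, h1, map_zero]
  apply γ.injective
  rw [map_zero]
  apply Subtype.ext
  exact Prod.ext (LinearMap.ext h1) (LinearMap.ext h2)

/-- Coassociativity of the coaction: both sides send `a ⊗ p ⊗ q` to
`∑ a₍₀₎ ⊗ a₍₋₁₎ p₍₂₎ ⊗ a₍₋₂₎ p₍₁₎ q`. -/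
theorem tau_pentagon : (leg23 K.T₅.toLinearMap * leg12 γ.tau :
      Module.End ℂ ((A ⊗[ℂ] B) ⊗[ℂ] B)) =
    leg12 γ.tau * leg13 γ.tau * leg23 K.T₅.toLinearMap := by
  apply end_ext₃
  intro a p q
  have h := congrArg (fun z => comm ℂ B (A ⊗[ℂ] B) ((comm ℂ B A).toLinearMap.lTensor B z))
    (γ.coassoc_right a p q)
  have h1 : ∀ t : B ⊗[ℂ] A, leg23 K.T₅.toLinearMap (comm ℂ B A t ⊗ₜ q) =
      comm ℂ B (A ⊗[ℂ] B) ((comm ℂ B A).toLinearMap.lTensor B (assoc ℂ B B A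
        ((K.T₃.toLinearMap ∘ₗ (TensorProduct.mk ℂ B B).flip q).rTensor A t))) := by
    intro t
    induction t with
    | zero => simp
    | add s t hs ht => simp only [map_add, TensorProduct.add_tmul, hs, ht]
    | tmul b a =>
      rw [TensorProduct.comm_tmul, leg23_tmul, LinearEquiv.coe_coe, K.T₅_apply,
        LinearMap.rTensor_tmul]
      simp only [LinearMap.comp_apply, LinearMap.flip_apply, TensorProduct.mk_apply,
        LinearEquiv.coe_coe]
      generalize K.T₃ (b ⊗ₜ q) = s
      induction s with
      | zero => simp
      | add s t hs ht => simp only [map_add, TensorProduct.add_tmul, hs, ht]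
      | tmul u v => simp
  have h2 : ∀ s : B ⊗[ℂ] B, leg12 γ.tau (leg13 γ.tau ((TensorProduct.mk ℂ A B a).rTensor B
      (comm ℂ B B s))) = comm ℂ B (A ⊗[ℂ] B) ((comm ℂ B A).toLinearMap.lTensor B
        (γ.T.lTensor B (assoc ℂ B A B (γ.T.rTensor B ((assoc ℂ A B B).symm (a ⊗ₜ s)))))) := by
    intro s
    induction s with
    | zero => simp
    | add s t hs ht => simp only [map_add, TensorProduct.tmul_add, hs, ht]
    | tmul x y =>
      rw [TensorProduct.comm_tmul, LinearMap.rTensor_tmul, TensorProduct.mk_apply, leg13_tmul,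
        tau_apply, TensorProduct.assoc_symm_tmul, LinearMap.rTensor_tmul]
      generalize γ.T (a ⊗ₜ x) = t
      induction t with
      | zero => simp
      | add s t hs ht => simp only [map_add, TensorProduct.add_tmul, hs, ht]
      | tmul u v => simp [leg12_tmul, tau_apply]
  rw [Module.End.mul_apply, Module.End.mul_apply, Module.End.mul_apply, leg12_tmul, tau_apply, h1,
    leg23_tmul, LinearEquiv.coe_coe, K.T₅_apply, h2]
  exact h.symm

/-- If `τ(∑ aᵢ ⊗ bᵢ) = 0`, then conjugation by `T₅` turns the pentagon relation into
`∑ τ(aᵢ ⊗ p₍₂₎) ⊗ S⁻¹(p₍₁₎)bᵢ = 0` for all `p`. Here `p₍₁₎` and `p₍₂₎` may be separated, and the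
injectivity of `Γ` leaves `∑ aᵢ ⊗ S⁻¹(p)bᵢ = 0`, whence `∑ aᵢ ⊗ bᵢ = 0`. -/
theorem tau_injective : Function.Injective γ.tau := by
  rw [injective_iff_map_eq_zero]
  intro z hz
  rcases subsingleton_or_nontrivial B with hB | hB
  · exact Subsingleton.elim _ _
  have hinv : K.T₅.toLinearMap * K.T₅.symm.toLinearMap = 1 := by
    apply LinearMap.ext; intro x; simp
  -- `∑ τ(aᵢ ⊗ p₍₂₎) ⊗ S⁻¹(p₍₁₎)bᵢ = 0`, where `z = ∑ aᵢ ⊗ bᵢ`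
  have h1 : ∀ p : B, leg12 γ.tau ((assoc ℂ A B B).symm
      ((K.T₅.symm.toLinearMap ∘ₗ TensorProduct.mk ℂ B B p).lTensor A z)) = 0 := by
    intro p
    have h2 : ∀ z : A ⊗[ℂ] B, (assoc ℂ A B B).symm
        ((K.T₅.symm.toLinearMap ∘ₗ TensorProduct.mk ℂ B B p).lTensor A z) =
        leg23 K.T₅.symm.toLinearMap (rightComm ℂ A B B (z ⊗ₜ p)) := by
      intro z
      induction z with
      | zero => simp
      | add s t hs ht => simp only [map_add, TensorProduct.add_tmul, hs, ht]
      | tmul a b => simp [leg23]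
    have h3 : ∀ z : A ⊗[ℂ] B, leg13 γ.tau (rightComm ℂ A B B (z ⊗ₜ p)) =
        rightComm ℂ A B B (γ.tau z ⊗ₜ p) := by
      intro z
      induction z with
      | zero => simp
      | add s t hs ht => simp only [map_add, TensorProduct.add_tmul, hs, ht]
      | tmul a b => simp [leg13]
    have h4 : leg23 K.T₅.toLinearMap (leg12 γ.tau (leg23 K.T₅.symm.toLinearMap
        (rightComm ℂ A B B (z ⊗ₜ p)))) = 0 := by
      rw [← Module.End.mul_apply, tau_pentagon, Module.End.mul_apply, ← Module.End.mul_apply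
        (leg23 _), ← leg23_mul, hinv, leg23_one, Module.End.one_apply, Module.End.mul_apply, h3,
        hz]
      simp
    have h5 : K.T₅.symm.toLinearMap * K.T₅.toLinearMap = 1 := by
      apply LinearMap.ext; intro x; simp
    have h6 := congrArg (leg23 K.T₅.symm.toLinearMap) h4
    rw [← Module.End.mul_apply, ← leg23_mul, h5, leg23_one, map_zero, Module.End.one_apply] at h6
    rw [h2, h6]
  -- `κ (p ⊗ q)` sends `b` to `q ⊗ S⁻¹(p) b`; writing tensors as `∑ p₍₁₎ ⊗ p₍₂₎ d` separates
  -- the legs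
  let κ : B ⊗[ℂ] B → B →ₗ[ℂ] B ⊗[ℂ] B := fun t => (comm ℂ B B).toLinearMap ∘ₗ
    K.invAntipode.rTensor B ∘ₗ (rightComm ℂ B B B).toLinearMap ∘ₗ TensorProduct.mk ℂ (B ⊗[ℂ] B) B t
  have hκ : ∀ p d, κ (K.T₁ (p ⊗ₜ d)) = (μᵣ d).rTensor B ∘ₗ K.T₅.symm.toLinearMap ∘ₗ
      TensorProduct.mk ℂ B B p := by
    intro p d
    apply LinearMap.ext
    intro b
    simp only [κ, LinearMap.comp_apply, LinearEquiv.coe_coe, TensorProduct.mk_apply,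
      K.T₅_symm_mulRight, TensorProduct.comm_comm]
  have hadd : ∀ s t, κ (s + t) = κ s + κ t := by
    intro s t
    simp only [κ, map_add, LinearMap.comp_add]
  have h0 : κ 0 = 0 := by simp only [κ, map_zero, LinearMap.comp_zero]
  have h2 : ∀ t, leg12 γ.tau ((assoc ℂ A B B).symm ((κ t).lTensor A z)) = 0 := by
    intro t
    obtain ⟨t, rfl⟩ := K.T₁.surjective t
    induction t with
    | zero => simp [h0]
    | add s t hs ht =>
      simp only [map_add, hadd, LinearMap.lTensor_add, LinearMap.add_apply, hs, ht, add_zero]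
    | tmul p d =>
      have h3 : ∀ y : A ⊗[ℂ] (B ⊗[ℂ] B), leg12 γ.tau ((assoc ℂ A B B).symm
          (((μᵣ d).rTensor B).lTensor A y)) = ((μᵣ d).lTensor A).rTensor B
            (leg12 γ.tau ((assoc ℂ A B B).symm y)) := by
        intro y
        induction y with
        | zero => simp
        | add s t hs ht => simp only [map_add, hs, ht]
        | tmul a s =>
          induction s with
          | zero => simp
          | add s t hs ht => simp only [map_add, TensorProduct.tmul_add, hs, ht]
          | tmul b c =>
            have := γ.tau_mul d (a ⊗ₜ b)
            rw [LinearMap.lTensor_tmul] at this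
            simp only [LinearMap.lTensor_tmul, LinearMap.rTensor_tmul,
              TensorProduct.assoc_symm_tmul, leg12_tmul, this]
      rw [hκ, LinearMap.lTensor_comp_apply, h3, h1, map_zero]
  have h3 : ∀ Q : B, (K.invAntipode ∘ₗ TensorProduct.mk ℂ B B Q).lTensor A z = 0 := by
    intro Q
    apply eq_zero_of_rTensor (fun C : B => γ.tau ∘ₗ (TensorProduct.mk ℂ A B).flip C) γ.tau_cancel
    intro C
    rw [← h2 (Q ⊗ₜ C)]
    generalize z = z
    induction z with
    | zero => simp
    | add s t hs ht => simp only [map_add, hs, ht]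
    | tmul a b => simp [κ, leg12_tmul]
  have h4 : ∀ t, (κ t).lTensor A z = 0 := by
    intro t
    induction t with
    | zero => simp [h0]
    | add s t hs ht =>
      simp only [hadd, LinearMap.lTensor_add, LinearMap.add_apply, hs, ht, add_zero]
    | tmul Q C =>
      have : κ (Q ⊗ₜ C) =
          TensorProduct.mk ℂ B B C ∘ₗ K.invAntipode ∘ₗ TensorProduct.mk ℂ B B Q := by
        ext b
        simp [κ]
      rw [this, LinearMap.lTensor_comp_apply, h3, map_zero]
  obtain ⟨p, hp⟩ := exists_ne (0 : B)
  obtain ⟨f, hf⟩ := Module.Projective.exists_dual_eq_one ℂ hp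
  have h5 : (K.T₅.symm.toLinearMap ∘ₗ TensorProduct.mk ℂ B B p).lTensor A z = 0 := by
    apply eq_zero_of_lTensor (fun d : B => (μᵣ d).rTensor B)
      (fun v hv => eq_zero_of_rTensor (fun d : B => μᵣ d) K.mulRight_cancel hv)
    intro d
    rw [← LinearMap.lTensor_comp_apply, ← hκ, h4]
  have h6 := congrArg (((TensorProduct.lid ℂ B).toLinearMap ∘ₗ f.rTensor B ∘ₗ
    K.T₅.toLinearMap).lTensor A) h5
  rw [← LinearMap.lTensor_comp_apply, map_zero] at h6
  rw [← h6]
  have h7 : ((TensorProduct.lid ℂ B).toLinearMap ∘ₗ f.rTensor B ∘ₗ K.T₅.toLinearMap) ∘ₗ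
      K.T₅.symm.toLinearMap ∘ₗ TensorProduct.mk ℂ B B p = LinearMap.id := by
    ext b
    simp [hf]
  rw [h7, LinearMap.lTensor_id, LinearMap.id_apply]

end LeftComoduleCoalgebra

namespace LeftComoduleCoalgebra

variable {A : Type u} [NonUnitalRing A] [Module ℂ A] [IsScalarTower ℂ A A] [SMulCommClass ℂ A A]
variable {B : Type v} [NonUnitalRing B] [Module ℂ B] [IsScalarTower ℂ B B] [SMulCommClass ℂ B B]
variable {H : RegularMultiplierHopf A} {K : RegularMultiplierHopf B}
variable (γ : LeftComoduleCoalgebra H K)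

/-- The coaction is counital: `∑ a₍₀₎ ε(a₍₋₁₎) = a`. This follows from the pentagon relation because
`τ` is injective. -/
theorem epsR_tau (t : A ⊗[ℂ] B) : K.epsR (γ.tau t) = K.epsR t := by
  rcases subsingleton_or_nontrivial B with hB | hB
  · rw [Subsingleton.elim (γ.tau t) t]
  have h1 : ∀ y : (A ⊗[ℂ] B) ⊗[ℂ] B, K.epsR (leg23 K.T₅.toLinearMap y) = K.epsR y := by
    intro y
    rw [← LinearMap.comp_apply]
    congr 1
    apply end_ext₃
    intro a p q
    rw [LinearMap.comp_apply, leg23_tmul, K.epsR_rTensor, LinearEquiv.coe_coe, K.epsR_T₅]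
    simp [RegularMultiplierHopf.epsR]
  have h2 : ∀ y : (A ⊗[ℂ] B) ⊗[ℂ] B, K.epsR (leg13 γ.tau y) = K.epsR y := by
    intro y
    have hs : leg23 (L := A) K.T₅.toLinearMap (leg23 K.T₅.symm.toLinearMap y) = y := by
      rw [← Module.End.mul_apply, ← leg23_mul]
      have : K.T₅.toLinearMap * K.T₅.symm.toLinearMap = 1 := by
        apply LinearMap.ext; intro x; simp
      rw [this, leg23_one, Module.End.one_apply]
    rw [← hs]
    generalize leg23 K.T₅.symm.toLinearMap y = y
    rw [h1]
    apply γ.tau_injective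
    have h := congrArg (fun f : Module.End ℂ ((A ⊗[ℂ] B) ⊗[ℂ] B) => K.epsR (f y)) γ.tau_pentagon
    simp only [Module.End.mul_apply, h1] at h
    unfold leg12 at h
    rw [K.epsR_rTensor, K.epsR_rTensor] at h
    exact h.symm
  obtain ⟨p, hp⟩ := exists_ne (0 : B)
  obtain ⟨f, hf⟩ := Module.Projective.exists_dual_eq_one ℂ hp
  have h3 : ∀ t : A ⊗[ℂ] B, (TensorProduct.rid ℂ A) (f.lTensor A
      (K.epsR (((TensorProduct.mk ℂ A B).flip p).rTensor B t))) = K.epsR t := by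
    intro t
    rw [K.epsR_rTensor]
    simp [hf]
  rw [← h3 (γ.tau t), ← h3 t]
  have h4 : leg13 γ.tau (((TensorProduct.mk ℂ A B).flip p).rTensor B t) =
      ((TensorProduct.mk ℂ A B).flip p).rTensor B (γ.tau t) := leg13_rTensor _ _ _
  rw [← h4, h2]

/-- Both sides send `a ⊗ d ⊗ b` to `∑ a₍₀₎ ⊗ d a₍₋₂₎ b₍₁₎ ⊗ a₍₋₁₎ b₍₂₎`. -/
theorem tau_T₂ : (leg13 γ.tau * leg23 K.T₂.toLinearMap * leg12 γ.tauOp :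
      Module.End ℂ ((A ⊗[ℂ] B) ⊗[ℂ] B)) = leg23 K.T₂.toLinearMap * leg13 γ.tau := by
  apply end_ext₃
  intro a d b
  apply RegularMultiplierHopf.eq_of_rTensor (fun q : B => (μᵣ q).lTensor A)
    (fun v hv => eq_zero_of_lTensor (fun d : B => μᵣ d) K.mulRight_cancel hv)
  intro q
  let J : A ⊗[ℂ] B → B ⊗[ℂ] B →ₗ[ℂ] (A ⊗[ℂ] B) ⊗[ℂ] B := fun t =>
    (comm ℂ B (A ⊗[ℂ] B)).toLinearMap ∘ₗ
      ((LinearMap.lTensorHom A ∘ₗ (LinearMap.mul ℂ B).flip).flip t).lTensor B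
  have hJ : ∀ t x y, J t (x ⊗ₜ y) = (μᵣ y).lTensor A t ⊗ₜ x := fun t x y => rfl
  have hJadd : ∀ s t, J (s + t) = J s + J t := by
    intro s t
    simp only [J, map_add, LinearMap.lTensor_add, LinearMap.comp_add]
  have h1 : ∀ t : A ⊗[ℂ] B, ((μᵣ q).lTensor A).rTensor B (leg23 K.T₂.toLinearMap (t ⊗ₜ b)) =
      J t (K.T₅ (b ⊗ₜ q)) := by
    intro t
    induction t with
    | zero => simp [J]
    | add s t hs ht =>
      simp only [map_add, TensorProduct.add_tmul, hs, ht, hJadd, LinearMap.add_apply]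
    | tmul u v =>
      have h := K.T₃_T₂ v b q
      rw [leg23_tmul, K.T₅_apply]
      have h' : ∀ s : B ⊗[ℂ] B,
          ((μᵣ q).lTensor A).rTensor B ((TensorProduct.mk ℂ A B u).rTensor B s) =
          (TensorProduct.mk ℂ A B u).rTensor B ((μᵣ q).rTensor B s) := by
        intro s
        induction s with
        | zero => simp
        | add s t hs ht => simp only [map_add, hs, ht]
        | tmul x y => simp
      rw [h', LinearEquiv.coe_coe, ← h]
      generalize K.T₃ (b ⊗ₜ q) = s
      induction s with
      | zero => simp
      | add s t hs ht => simp only [map_add, hs, ht]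
      | tmul x y => simp [hJ]
  have h2 : ∀ y : (A ⊗[ℂ] B) ⊗[ℂ] B, ((μᵣ q).lTensor A).rTensor B (leg13 γ.tau y) =
      leg13 γ.tau (((μᵣ q).lTensor A).rTensor B y) := by
    intro y
    rw [← LinearMap.comp_apply, ← LinearMap.comp_apply]
    congr 1
    apply end_ext₃
    intro a p q
    simp only [LinearMap.comp_apply, leg13_tmul, LinearMap.rTensor_tmul, LinearMap.lTensor_tmul]
    rw [← LinearMap.rTensor_comp_apply]
    congr 2
  have h3 : ∀ t : A ⊗[ℂ] B, ((μᵣ q).lTensor A).rTensor B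
      (leg23 K.T₂.toLinearMap (((TensorProduct.mk ℂ A B).flip d).rTensor B t)) =
      rightComm ℂ A B B ((μₗ d).lTensor (A ⊗[ℂ] B) (leg23 K.T₅.toLinearMap (t ⊗ₜ q))) := by
    intro t
    induction t with
    | zero => simp
    | add s t hs ht => simp only [map_add, TensorProduct.add_tmul, hs, ht]
    | tmul u v =>
      rw [LinearMap.rTensor_tmul, LinearMap.flip_apply, TensorProduct.mk_apply]
      have h := K.T₃_T₂ d v q
      have h' : ∀ s : B ⊗[ℂ] B,
          ((μᵣ q).lTensor A).rTensor B ((TensorProduct.mk ℂ A B u).rTensor B s) =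
          (TensorProduct.mk ℂ A B u).rTensor B ((μᵣ q).rTensor B s) := by
        intro s
        induction s with
        | zero => simp
        | add s t hs ht => simp only [map_add, hs, ht]
        | tmul x y => simp
      rw [leg23_tmul, leg23_tmul, LinearEquiv.coe_coe, LinearEquiv.coe_coe, K.T₅_apply, h', ← h]
      generalize K.T₃ (v ⊗ₜ q) = s
      induction s with
      | zero => simp
      | add s t hs ht => simp only [map_add, hs, ht]
      | tmul x y => simp
  have h4 : ∀ s : B ⊗[ℂ] B, rightComm ℂ A B B ((μₗ d).lTensor (A ⊗[ℂ] B)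
      (leg12 γ.tau (leg13 γ.tau ((TensorProduct.mk ℂ A B a).rTensor B s)))) =
      leg13 γ.tau (J (γ.tauOp (a ⊗ₜ d)) s) := by
    intro s
    induction s with
    | zero => simp
    | add s t hs ht => simp only [map_add, hs, ht]
    | tmul x y =>
      rw [hJ, ← mul_tau, LinearMap.rTensor_tmul, TensorProduct.mk_apply, leg13_tmul]
      generalize γ.tau (a ⊗ₜ y) = t
      induction t with
      | zero => simp
      | add s t hs ht => simp only [map_add, TensorProduct.add_tmul, hs, ht]
      | tmul u v =>
        simp only [LinearMap.rTensor_tmul, LinearMap.flip_apply, TensorProduct.mk_apply, leg12_tmul,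
          LinearMap.lTensor_tmul, leg13_tmul]
        generalize γ.tau (u ⊗ₜ x) = t
        induction t with
        | zero => simp
        | add s t hs ht => simp only [map_add, TensorProduct.add_tmul, hs, ht]
        | tmul u v => simp
  simp only [Module.End.mul_apply]
  rw [leg12_tmul, h2, h1, leg13_tmul, h3]
  have h := congrArg (fun f => f ((a ⊗ₜ b) ⊗ₜ q)) γ.tau_pentagon
  simp only [Module.End.mul_apply] at h
  rw [leg12_tmul] at h
  rw [h, leg23_tmul, h4]
  rfl

/-- In `tau_T₂`, multiply the last factor on the right by `S⁻¹` of the middle one times `c`. As this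
commutes with `τ`, the result shows that `a ⊗ S⁻¹(d)c` is in the range of `τ`. -/
theorem tau_surjective : Function.Surjective γ.tau := by
  rw [← LinearMap.range_eq_top, eq_top_iff]
  rcases subsingleton_or_nontrivial B with hB | hB
  · intro x _
    exact ⟨x, Subsingleton.elim _ _⟩
  rw [← TensorProduct.span_tmul_eq_top, Submodule.span_le]
  rintro _ ⟨a, c, rfl⟩
  obtain ⟨p, hp⟩ := K.exists_counit_eq_one
  obtain ⟨t, rfl⟩ := K.invAntipode_surjective c
  induction t with
  | zero => simp
  | add s t hs ht => rw [map_add, TensorProduct.tmul_add]; exact add_mem hs ht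
  | tmul d c =>
    -- `F (u ⊗ v ⊗ w) = u ⊗ w S⁻¹(v) c`; it is applied to `tau_T₂` at `a ⊗ d ⊗ p` with `ε(p) = 1`
    let F : (A ⊗[ℂ] B) ⊗[ℂ] B →ₗ[ℂ] A ⊗[ℂ] B := (LinearMap.mul' ℂ B ∘ₗ
      (K.invAntipode ∘ₗ (TensorProduct.mk ℂ B B).flip c).lTensor B ∘ₗ
      (comm ℂ B B).toLinearMap).lTensor A ∘ₗ (assoc ℂ A B B).toLinearMap
    have hF : ∀ u v w, F ((u ⊗ₜ v) ⊗ₜ w) = u ⊗ₜ (w * K.invAntipode (v ⊗ₜ c)) := fun u v w => rfl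
    clear_value F
    have h1 : ∀ y, F (leg13 γ.tau y) = γ.tau (F y) := by
      intro y
      rw [← LinearMap.comp_apply, ← LinearMap.comp_apply]
      congr 1
      apply end_ext₃
      intro u v w
      rw [LinearMap.comp_apply, LinearMap.comp_apply, hF, leg13_tmul]
      have h := γ.tau_mul (K.invAntipode (v ⊗ₜ c)) (u ⊗ₜ w)
      rw [LinearMap.lTensor_tmul, LinearMap.mulRight_apply] at h
      rw [h]
      generalize γ.tau (u ⊗ₜ w) = t
      induction t with
      | zero => simp
      | add s t hs ht => simp only [map_add, hs, ht]
      | tmul x y => simp [hF]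
    have h2 : ∀ u v w, F (leg23 K.T₂.toLinearMap ((u ⊗ₜ v) ⊗ₜ w)) =
        u ⊗ₜ (K.counit w • K.invAntipode (v ⊗ₜ c)) := by
      intro u v w
      rw [← K.mul_invAntipode_T₂, leg23_tmul, LinearEquiv.coe_coe]
      generalize K.T₂ (v ⊗ₜ w) = t
      induction t with
      | zero => simp
      | add s t hs ht => simp only [map_add, TensorProduct.tmul_add, hs, ht]
      | tmul x y => simp [hF]
    have h := congrArg (fun f => F (f ((a ⊗ₜ d) ⊗ₜ p))) γ.tau_T₂
    simp only [Module.End.mul_apply, h1] at h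
    refine ⟨_, h.trans ?_⟩
    have h3 : ∀ t : A ⊗[ℂ] B, F (leg23 K.T₂.toLinearMap
        (((TensorProduct.mk ℂ A B).flip d).rTensor B t)) =
        K.epsR t ⊗ₜ K.invAntipode (d ⊗ₜ c) := by
      intro t
      induction t with
      | zero => simp
      | add s t hs ht => simp only [map_add, TensorProduct.add_tmul, hs, ht]
      | tmul u v =>
        rw [LinearMap.rTensor_tmul, LinearMap.flip_apply, TensorProduct.mk_apply, h2]
        simp [RegularMultiplierHopf.epsR, TensorProduct.smul_tmul']
    rw [leg13_tmul, h3, epsR_tau]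
    simp [RegularMultiplierHopf.epsR, hp]

/-- The map `τ` as a linear equivalence. -/
def tauEquiv : A ⊗[ℂ] B ≃ₗ[ℂ] A ⊗[ℂ] B :=
  LinearEquiv.ofBijective γ.tau ⟨γ.tau_injective, γ.tau_surjective⟩

end LeftComoduleCoalgebra

/-! ### Operators that commute or are multiplicative -/

section Legs

variable {L L' M N S : Type*} [AddCommGroup L] [Module ℂ L] [AddCommGroup L'] [Module ℂ L']
  [AddCommGroup M] [Module ℂ M] [AddCommGroup N] [Module ℂ N] [AddCommGroup S] [Module ℂ S]

/-- If `f₁₂` and `g₂₃` commute, they still do after a factor `S`, on which neither acts, has been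
inserted in the second place. -/
theorem leg12_leg13_comm {f : Module.End ℂ (L ⊗[ℂ] M)} {g : Module.End ℂ (M ⊗[ℂ] N)}
    (h : (leg12 f * leg23 g : Module.End ℂ ((L ⊗[ℂ] M) ⊗[ℂ] N)) = leg23 g * leg12 f) :
    (leg12 (leg13 f) * leg23 g : Module.End ℂ (((L ⊗[ℂ] S) ⊗[ℂ] M) ⊗[ℂ] N)) =
      leg23 g * leg12 (leg13 f) := by
  have h1 : ∀ (x : L) (s : S) (t : M ⊗[ℂ] N),
      leg12 (leg13 f) ((TensorProduct.mk ℂ (L ⊗[ℂ] S) M (x ⊗ₜ s)).rTensor N t) =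
        (((TensorProduct.mk ℂ L S).flip s).rTensor M).rTensor N
          (leg12 f ((TensorProduct.mk ℂ L M x).rTensor N t)) := by
    intro x s t
    induction t with
    | zero => simp
    | add s t hs ht => simp only [map_add, hs, ht]
    | tmul p q => simp [leg12_tmul, leg13_tmul]
  have h2 : ∀ (s : S) (t : (L ⊗[ℂ] M) ⊗[ℂ] N),
      leg23 g ((((TensorProduct.mk ℂ L S).flip s).rTensor M).rTensor N t) =
        (((TensorProduct.mk ℂ L S).flip s).rTensor M).rTensor N (leg23 g t) := by
    intro s t
    induction t with
    | zero => simp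
    | add s t hs ht => simp only [map_add, hs, ht]
    | tmul p q =>
      induction p with
      | zero => simp
      | add s t hs ht => simp only [map_add, TensorProduct.add_tmul, hs, ht]
      | tmul x y =>
        simp only [LinearMap.rTensor_tmul, leg23_tmul, LinearMap.flip_apply, TensorProduct.mk_apply]
        rw [← LinearMap.rTensor_comp_apply]
        congr 2
  apply TensorProduct.ext'
  intro w z
  induction w with
  | zero => simp
  | add s t hs ht => simp only [map_add, TensorProduct.add_tmul, hs, ht]
  | tmul p y =>
    induction p with
    | zero => simp
    | add s t hs ht => simp only [map_add, TensorProduct.add_tmul, hs, ht]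
    | tmul x s =>
      rw [Module.End.mul_apply, Module.End.mul_apply, leg23_tmul, h1, leg12_tmul, leg13_tmul]
      have h3 := congrArg (fun f => f ((x ⊗ₜ y) ⊗ₜ z)) h
      simp only [Module.End.mul_apply] at h3
      rw [leg23_tmul, leg12_tmul] at h3
      rw [h3, ← h2, LinearMap.rTensor_tmul]

/-- If `f₁₂` and `g₂₃` commute, they still do after a factor `S`, on which neither acts, has been
inserted in the first place. -/
theorem leg12_leg23_comm {f : Module.End ℂ (L ⊗[ℂ] M)} {g : Module.End ℂ (M ⊗[ℂ] N)}
    (h : (leg12 f * leg23 g : Module.End ℂ ((L ⊗[ℂ] M) ⊗[ℂ] N)) = leg23 g * leg12 f) :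
    (leg12 (leg23 f) * leg23 g : Module.End ℂ (((S ⊗[ℂ] L) ⊗[ℂ] M) ⊗[ℂ] N)) =
      leg23 g * leg12 (leg23 f) := by
  have h1 : ∀ (x : L) (s : S) (t : M ⊗[ℂ] N),
      leg12 (leg23 f) ((TensorProduct.mk ℂ (S ⊗[ℂ] L) M (s ⊗ₜ x)).rTensor N t) =
        ((TensorProduct.mk ℂ S L s).rTensor M).rTensor N
          (leg12 f ((TensorProduct.mk ℂ L M x).rTensor N t)) := by
    intro x s t
    induction t with
    | zero => simp
    | add s t hs ht => simp only [map_add, hs, ht]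
    | tmul p q => simp [leg12_tmul, leg23_tmul]
  have h2 : ∀ (s : S) (t : (L ⊗[ℂ] M) ⊗[ℂ] N),
      leg23 g (((TensorProduct.mk ℂ S L s).rTensor M).rTensor N t) =
        ((TensorProduct.mk ℂ S L s).rTensor M).rTensor N (leg23 g t) := by
    intro s t
    induction t with
    | zero => simp
    | add s t hs ht => simp only [map_add, hs, ht]
    | tmul p q =>
      induction p with
      | zero => simp
      | add s t hs ht => simp only [map_add, TensorProduct.add_tmul, hs, ht]
      | tmul x y =>
        simp only [LinearMap.rTensor_tmul, leg23_tmul, TensorProduct.mk_apply]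
        rw [← LinearMap.rTensor_comp_apply]
        congr 2
  apply TensorProduct.ext'
  intro w z
  induction w with
  | zero => simp
  | add s t hs ht => simp only [map_add, TensorProduct.add_tmul, hs, ht]
  | tmul p y =>
    induction p with
    | zero => simp
    | add s t hs ht => simp only [map_add, TensorProduct.add_tmul, hs, ht]
    | tmul s x =>
      rw [Module.End.mul_apply, Module.End.mul_apply, leg23_tmul, h1, leg12_tmul, leg23_tmul]
      have h3 := congrArg (fun f => f ((x ⊗ₜ y) ⊗ₜ z)) h
      simp only [Module.End.mul_apply] at h3
      rw [leg23_tmul, leg12_tmul] at h3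
      rw [h3, ← h2, LinearMap.rTensor_tmul]

/-- For an operator `f` on `L ⊗ M` and a right multiplication `m` of `M` on `N`, the map sending
`y ∈ M` to the operator `x ⊗ v ↦ (1 ⊗ v) f(x ⊗ y)` on `L ⊗ N`. -/
def fuse (m : N ⊗[ℂ] M →ₗ[ℂ] N) (f : Module.End ℂ (L ⊗[ℂ] M)) : M →ₗ[ℂ] Module.End ℂ (L ⊗[ℂ] N) :=
  ((TensorProduct.mk ℂ (L ⊗[ℂ] N) M).compr₂
    (m.lTensor L ∘ₗ (assoc ℂ L N M).toLinearMap ∘ₗ leg13 f)).flip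

theorem fuse_tmul (m : N ⊗[ℂ] M →ₗ[ℂ] N) (f : Module.End ℂ (L ⊗[ℂ] M)) (y : M) (x : L) (v : N) :
    fuse m f y (x ⊗ₜ v) = (m ∘ₗ TensorProduct.mk ℂ N M v).lTensor L (f (x ⊗ₜ y)) := by
  have h : fuse m f y (x ⊗ₜ v) = m.lTensor L (assoc ℂ L N M (leg13 f ((x ⊗ₜ v) ⊗ₜ y))) := rfl
  rw [h, leg13_tmul]
  generalize f (x ⊗ₜ y) = t
  induction t with
  | zero => simp
  | add s t hs ht => simp only [map_add, hs, ht]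
  | tmul p q => simp

/-- The operator `f` on `L ⊗ M` is multiplicative in `M`: `f (ι ⊗ m) = (ι ⊗ m) f₁₃ f₁₂`. -/
def IsMultiplicative (m : M ⊗[ℂ] M →ₗ[ℂ] M) (f : Module.End ℂ (L ⊗[ℂ] M)) : Prop :=
  ∀ x y y', f (x ⊗ₜ m (y ⊗ₜ y')) = fuse m f y' (f (x ⊗ₜ y))

theorem fuse_mul_fuse {μ : M ⊗[ℂ] M →ₗ[ℂ] M} {m : N ⊗[ℂ] M →ₗ[ℂ] N}
    (hm : ∀ v p q, m (m (v ⊗ₜ p) ⊗ₜ q) = m (v ⊗ₜ μ (p ⊗ₜ q))) (f : Module.End ℂ (L ⊗[ℂ] M))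
    (y y' : M) (x : L) (v : N) : (fuse m f y' * fuse m f y) (x ⊗ₜ v) =
      (m ∘ₗ TensorProduct.mk ℂ N M v).lTensor L (fuse μ f y' (f (x ⊗ₜ y))) := by
  rw [Module.End.mul_apply, fuse_tmul]
  generalize f (x ⊗ₜ y) = t
  induction t with
  | zero => simp
  | add s t hs ht => simp only [map_add, hs, ht]
  | tmul x p =>
    rw [LinearMap.lTensor_tmul, LinearMap.comp_apply, TensorProduct.mk_apply, fuse_tmul, fuse_tmul,
      ← LinearMap.lTensor_comp_apply]
    congr 2
    ext q
    simp [hm]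

/-- Multiplicativity of `f` in `M` makes `fuse m f` an antihomomorphism. -/
theorem IsMultiplicative.fuse_mul {μ : M ⊗[ℂ] M →ₗ[ℂ] M} {f : Module.End ℂ (L ⊗[ℂ] M)}
    (hf : IsMultiplicative μ f) {m : N ⊗[ℂ] M →ₗ[ℂ] N}
    (hm : ∀ v p q, m (m (v ⊗ₜ p) ⊗ₜ q) = m (v ⊗ₜ μ (p ⊗ₜ q))) (y y' : M) :
    fuse m f (μ (y ⊗ₜ y')) = fuse m f y' * fuse m f y := by
  apply TensorProduct.ext'
  intro x v
  rw [fuse_mul_fuse hm, fuse_tmul, hf]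

/-- The converse of `IsMultiplicative.fuse_mul`, for a non-degenerate product. -/
theorem IsMultiplicative.of_fuse_mul {m : M ⊗[ℂ] M →ₗ[ℂ] M} {f : Module.End ℂ (L ⊗[ℂ] M)}
    (hm : ∀ v p q, m (m (v ⊗ₜ p) ⊗ₜ q) = m (v ⊗ₜ m (p ⊗ₜ q)))
    (hc : ∀ y, (∀ v, m (v ⊗ₜ y) = 0) → y = 0)
    (h : ∀ y y', fuse m f (m (y ⊗ₜ y')) = fuse m f y' * fuse m f y) : IsMultiplicative m f := by
  intro x y y'
  apply RegularMultiplierHopf.eq_of_lTensor (fun v => m ∘ₗ TensorProduct.mk ℂ M M v) hc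
  intro v
  rw [← fuse_mul_fuse hm, ← h, fuse_tmul]

/-- The product of two operators that are multiplicative in the last factor is so, too. -/
theorem IsMultiplicative.leg23_mul_leg13 {m : M ⊗[ℂ] M →ₗ[ℂ] M} {f : Module.End ℂ (L ⊗[ℂ] M)}
    {g : Module.End ℂ (L' ⊗[ℂ] M)} (hf : IsMultiplicative m f) (hg : IsMultiplicative m g) :
    IsMultiplicative m (leg23 g * leg13 f : Module.End ℂ ((L ⊗[ℂ] L') ⊗[ℂ] M)) := by
  intro p y y'
  induction p with
  | zero => simp
  | add s t hs ht => simp only [map_add, TensorProduct.add_tmul, hs, ht]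
  | tmul c d =>
    rw [Module.End.mul_apply, Module.End.mul_apply, leg13_tmul, leg13_tmul, hf]
    generalize f (c ⊗ₜ y) = t
    induction t with
    | zero => simp
    | add s t hs ht => simp only [map_add, hs, ht]
    | tmul c v =>
      rw [fuse_tmul, LinearMap.rTensor_tmul, LinearMap.flip_apply, TensorProduct.mk_apply,
        leg23_tmul]
      have h1 : ∀ t : L' ⊗[ℂ] M, fuse m (leg23 g * leg13 f) y'
          ((TensorProduct.mk ℂ L L' c).rTensor M t) =
          (assoc ℂ L L' M).symm ((LinearMap.flip (fuse m g) t).lTensor L (f (c ⊗ₜ y'))) := by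
        intro t
        induction t with
        | zero => simp
        | add s t hs ht => simp only [map_add, LinearMap.lTensor_add, LinearMap.add_apply, hs, ht]
        | tmul d v =>
          rw [LinearMap.rTensor_tmul, TensorProduct.mk_apply, fuse_tmul, Module.End.mul_apply,
            leg13_tmul]
          generalize f (c ⊗ₜ y') = s
          induction s with
          | zero => simp
          | add s t hs ht => simp only [map_add, hs, ht]
          | tmul c w =>
            rw [LinearMap.rTensor_tmul, LinearMap.flip_apply, TensorProduct.mk_apply, leg23_tmul,
              LinearMap.lTensor_tmul, LinearMap.flip_apply, fuse_tmul]
            generalize g (d ⊗ₜ w) = r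
            induction r with
            | zero => simp
            | add s t hs ht => simp only [map_add, TensorProduct.tmul_add, hs, ht]
            | tmul d w => simp
      rw [h1]
      generalize f (c ⊗ₜ y') = s
      induction s with
      | zero => simp
      | add s t hs ht => simp only [map_add, hs, ht]
      | tmul c w =>
        rw [LinearMap.lTensor_tmul, LinearMap.comp_apply, TensorProduct.mk_apply,
          LinearMap.rTensor_tmul, LinearMap.flip_apply, TensorProduct.mk_apply, leg23_tmul, hg,
          LinearMap.lTensor_tmul, LinearMap.flip_apply]
        generalize fuse m g w (g (d ⊗ₜ v)) = r
        induction r with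
        | zero => simp
        | add s t hs ht => simp only [map_add, TensorProduct.tmul_add, hs, ht]
        | tmul d w => simp

end Legs

/-! ### Coproducts from canonical maps -/

section Multipliers

variable {X : Type u} [NonUnitalRing X] [Module ℂ X] [IsScalarTower ℂ X X] [SMulCommClass ℂ X X]
variable {Y : Type v} [NonUnitalRing Y] [Module ℂ Y] [IsScalarTower ℂ Y Y] [SMulCommClass ℂ Y Y]

theorem Multiplier.ext_left (hX : NondegenerateProduct X) {m n : Multiplier X}
    (h : ∀ x, m.left x = n.left x) : m = n := by
  refine Multiplier.ext h fun x => ?_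
  rw [← sub_eq_zero]
  apply hX.left
  intro y
  rw [sub_mul, ← m.central, ← n.central, h, sub_self]

theorem Multiplier.ext_right (hX : NondegenerateProduct X) {m n : Multiplier X}
    (h : ∀ x, m.right x = n.right x) : m = n := by
  refine Multiplier.ext (fun x => ?_) h
  rw [← sub_eq_zero]
  apply hX.right
  intro y
  rw [mul_sub, m.central, n.central, h, sub_self]

theorem mul_tmul_eq (t : X ⊗[ℂ] Y) (x : X) (y : Y) :
    t * (x ⊗ₜ y) = (μᵣ y).lTensor X ((μᵣ x).rTensor Y t) := by
  induction t with
  | zero => simp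
  | add s t hs ht => simp only [map_add, add_mul, hs, ht]
  | tmul p q => simp

theorem tmul_mul_eq (t : X ⊗[ℂ] Y) (x : X) (y : Y) :
    (x ⊗ₜ y) * t = (μₗ y).lTensor X ((μₗ x).rTensor Y t) := by
  induction t with
  | zero => simp
  | add s t hs ht => simp only [map_add, mul_add, hs, ht]
  | tmul p q => simp

theorem NondegenerateProduct.tensor (hX : NondegenerateProduct X) (hY : NondegenerateProduct Y) :
    NondegenerateProduct (X ⊗[ℂ] Y) where
  left t h := by
    apply eq_zero_of_rTensor (fun x : X => μᵣ x) hX.left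
    intro x
    apply eq_zero_of_lTensor (fun y : Y => μᵣ y) hY.left
    intro y
    rw [← mul_tmul_eq, h]
  right t h := by
    apply eq_zero_of_rTensor (fun x : X => μₗ x) hX.right
    intro x
    apply eq_zero_of_lTensor (fun y : Y => μₗ y) hY.right
    intro y
    rw [← tmul_mul_eq, h]

variable (T₁ T₂ : Module.End ℂ (X ⊗[ℂ] X))

/-- `u ⊗ z ↦ T₁(y ⊗ z)(u ⊗ 1)`, which is `Δ(y)(u ⊗ z)`. -/
def comulLeft : X →ₗ[ℂ] Module.End ℂ (X ⊗[ℂ] X) where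
  toFun y := TensorProduct.lift ((LinearMap.rTensorHom X ∘ₗ (LinearMap.mul ℂ X).flip).compl₂
    (T₁ ∘ₗ TensorProduct.mk ℂ X X y))
  map_add' y y' := by ext u z; simp
  map_smul' c y := by ext u z; simp

theorem comulLeft_tmul (y u z : X) :
    comulLeft T₁ y (u ⊗ₜ z) = (μᵣ u).rTensor X (T₁ (y ⊗ₜ z)) := rfl

variable {T₁ T₂}

theorem central_comulLeft
    (h : ∀ x y z : X, (μₗ x).rTensor X (T₁ (y ⊗ₜ z)) = (μᵣ z).lTensor X (T₂ (x ⊗ₜ y)))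
    (y : X) (s t : X ⊗[ℂ] X) :
    s * comulLeft T₁ y t = fuse (LinearMap.mul' ℂ X) T₂ y s * t := by
  induction s with
  | zero => simp
  | add s t hs ht => simp only [map_add, add_mul, hs, ht]
  | tmul u v =>
    induction t with
    | zero => simp
    | add s t hs ht => simp only [map_add, mul_add, hs, ht]
    | tmul u' z =>
      have h1 : ∀ t : X ⊗[ℂ] X, (u ⊗ₜ v) * (μᵣ u').rTensor X t =
          (μᵣ u').rTensor X ((μₗ v).lTensor X ((μₗ u).rTensor X t)) := by
        intro t
        induction t with
        | zero => simp
        | add s t hs ht => simp only [map_add, mul_add, hs, ht]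
        | tmul p q => simp [mul_assoc]
      rw [comulLeft_tmul, h1, h, fuse_tmul]
      generalize T₂ (u ⊗ₜ y) = t
      induction t with
      | zero => simp
      | add s t hs ht => simp only [map_add, add_mul, hs, ht]
      | tmul p q => simp [mul_assoc]

/-- A pair of maps `T₁`, `T₂` on `X ⊗ X` that are to be `y ⊗ z ↦ Δ(y)(1 ⊗ z)` and
`x ⊗ y ↦ (x ⊗ 1)Δ(y)` for some coproduct `Δ` determines one: compatibility of the two gives the
multipliers, multiplicativity of `T₂` gives that `Δ` is a homomorphism, commutation of the two gives
coassociativity, and surjectivity together with units gives non-degeneracy. -/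
theorem exists_coproduct (hX : NondegenerateProduct X) (hl : ∀ z : X, ∃ x, x * z = z)
    (hr : ∀ z : X, ∃ x, z * x = z) (h₁ : Function.Surjective T₁) (h₂ : Function.Surjective T₂)
    (h : ∀ x y z : X, (μₗ x).rTensor X (T₁ (y ⊗ₜ z)) = (μᵣ z).lTensor X (T₂ (x ⊗ₜ y)))
    (hm : IsMultiplicative (LinearMap.mul' ℂ X) T₂)
    (hc : (leg12 T₂ * leg23 T₁ : Module.End ℂ ((X ⊗[ℂ] X) ⊗[ℂ] X)) = leg23 T₁ * leg12 T₂) :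
    ∃ Δ : X →ₙₐ[ℂ] Multiplier (X ⊗[ℂ] X), IsNondegenerate Δ ∧ IsCoassociative Δ ∧
      ∀ y u z, (Δ y).left (u ⊗ₜ z) = (μᵣ u).rTensor X (T₁ (y ⊗ₜ z)) := by
  have hXX := hX.tensor hX
  have hfuse : ∀ y y' : X, fuse (LinearMap.mul' ℂ X) T₂ (y * y') =
      fuse (LinearMap.mul' ℂ X) T₂ y' * fuse (LinearMap.mul' ℂ X) T₂ y :=
    hm.fuse_mul fun v p q => by simp [mul_assoc]
  let Δ : X →ₙₐ[ℂ] Multiplier (X ⊗[ℂ] X) :=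
    { toFun := fun y => Multiplier.mk (comulLeft T₁ y) (fuse (LinearMap.mul' ℂ X) T₂ y)
        (central_comulLeft h y)
      map_smul' := fun c y => Multiplier.ext_right hXX fun x => by
        change fuse (LinearMap.mul' ℂ X) T₂ (c • y) x = c • fuse (LinearMap.mul' ℂ X) T₂ y x
        rw [map_smul]; rfl
      map_zero' := Multiplier.ext_right hXX fun x => by
        change fuse (LinearMap.mul' ℂ X) T₂ 0 x = 0
        rw [map_zero]; rfl
      map_add' := fun y y' => Multiplier.ext_right hXX fun x => by
        change fuse (LinearMap.mul' ℂ X) T₂ (y + y') x =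
          fuse (LinearMap.mul' ℂ X) T₂ y x + fuse (LinearMap.mul' ℂ X) T₂ y' x
        rw [map_add]; rfl
      map_mul' := fun y y' => Multiplier.ext_right hXX fun x =>
        congrArg (fun f => f x) (hfuse y y') }
  have hleft : ∀ y u z, (Δ y).left (u ⊗ₜ z) = (μᵣ u).rTensor X (T₁ (y ⊗ₜ z)) :=
    fun y u z => rfl
  have hright : ∀ y u z, (Δ y).right (u ⊗ₜ z) = (μₗ z).lTensor X (T₂ (u ⊗ₜ y)) := by
    intro y u z
    change fuse _ _ _ _ = _
    rw [fuse_tmul]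
    rfl
  clear_value Δ
  have hT₁ : ∀ y z w : X, T₁ (y ⊗ₜ (z * w)) = (μᵣ w).lTensor X (T₁ (y ⊗ₜ z)) := by
    intro y z w
    apply RegularMultiplierHopf.eq_of_rTensor (fun x : X => μₗ x) hX.right
    intro x
    rw [h, rTensor_lTensor_comm, h, ← LinearMap.lTensor_comp_apply]
    congr 2
    ext v
    simp [mul_assoc]
  have hT₂ : ∀ w x y : X, T₂ ((w * x) ⊗ₜ y) = (μₗ w).rTensor X (T₂ (x ⊗ₜ y)) := by
    intro w x y
    apply RegularMultiplierHopf.eq_of_lTensor (fun z : X => μᵣ z) hX.left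
    intro z
    rw [← h, ← rTensor_lTensor_comm, ← h, ← LinearMap.rTensor_comp_apply]
    congr 2
    ext v
    simp
  have hcan₁ : IsCanonical₁ Δ T₁ := by
    intro y z
    apply Multiplier.ext_left hXX
    intro s
    induction s with
    | zero => simp
    | add s t hs ht => simp only [map_add, hs, ht]
    | tmul u w =>
      rw [Multiplier.of_left, Multiplier.mul_left, Multiplier.tmul_left, TensorProduct.map_tmul,
        Multiplier.one_left, Multiplier.of_left, hleft, hT₁, mul_tmul_eq, rTensor_lTensor_comm]
  have hcan₂ : IsCanonical₂ Δ T₂ := by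
    intro x y
    apply Multiplier.ext_right hXX
    intro s
    induction s with
    | zero => simp
    | add s t hs ht => simp only [map_add, hs, ht]
    | tmul u w =>
      rw [Multiplier.of_right, Multiplier.mul_right, Multiplier.tmul_right, TensorProduct.map_tmul,
        Multiplier.one_right, Multiplier.of_right, hright, hT₂, tmul_mul_eq]
  refine ⟨Δ, ⟨?_, ?_⟩, ⟨T₁, T₂, hcan₁, hcan₂, ?_⟩, hleft⟩
  · rw [eq_top_iff, ← TensorProduct.span_tmul_eq_top, Submodule.span_le]
    rintro _ ⟨p, q, rfl⟩
    obtain ⟨e, he⟩ := hr p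
    have h1 : ∀ t, (μᵣ e).rTensor X (T₁ t) ∈
        Submodule.span ℂ {z : X ⊗[ℂ] X | ∃ x y, z = (Δ x).left y} := by
      intro t
      induction t with
      | zero => simp
      | add s t hs ht => rw [map_add, map_add]; exact add_mem hs ht
      | tmul y z => exact Submodule.subset_span ⟨y, e ⊗ₜ z, (hleft y e z).symm⟩
    obtain ⟨t, ht⟩ := h₁ (p ⊗ₜ q)
    have h2 := h1 t
    rwa [ht, LinearMap.rTensor_tmul, LinearMap.mulRight_apply, he] at h2
  · rw [eq_top_iff, ← TensorProduct.span_tmul_eq_top, Submodule.span_le]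
    rintro _ ⟨p, q, rfl⟩
    obtain ⟨e, he⟩ := hl q
    have h1 : ∀ t, (μₗ e).lTensor X (T₂ t) ∈
        Submodule.span ℂ {z : X ⊗[ℂ] X | ∃ x y, z = (Δ x).right y} := by
      intro t
      induction t with
      | zero => simp
      | add s t hs ht => rw [map_add, map_add]; exact add_mem hs ht
      | tmul u y => exact Submodule.subset_span ⟨y, u ⊗ₜ e, (hright y u e).symm⟩
    obtain ⟨t, ht⟩ := h₂ (p ⊗ₜ q)
    have h2 := h1 t
    rwa [ht, LinearMap.lTensor_tmul, LinearMap.mulLeft_apply, he] at h2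
  · intro a b c
    have h1 : ∀ t : X ⊗[ℂ] X, (assoc ℂ X X X).symm (a ⊗ₜ t) =
        (TensorProduct.mk ℂ X X a).rTensor X t := by
      intro t
      induction t with
      | zero => simp
      | add s t hs ht => simp only [map_add, TensorProduct.tmul_add, hs, ht]
      | tmul p q => simp
    have h2 : ∀ t : X ⊗[ℂ] X, assoc ℂ X X X (leg23 T₁ (t ⊗ₜ c)) =
        T₁.lTensor X (assoc ℂ X X X (t ⊗ₜ c)) := by
      intro t
      simp [leg23]
    have h3 := congrArg (fun f => assoc ℂ X X X (f ((a ⊗ₜ b) ⊗ₜ c))) hc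
    simp only [Module.End.mul_apply] at h3
    rw [leg23_tmul, leg12_tmul, h2] at h3
    rw [h1]
    exact h3

end Multipliers

/-! ### The conditions on `P` as identities of operators -/

namespace LeftComoduleCoalgebra

variable {A : Type u} [NonUnitalRing A] [Module ℂ A] [IsScalarTower ℂ A A] [SMulCommClass ℂ A A]
variable {B : Type v} [NonUnitalRing B] [Module ℂ B] [IsScalarTower ℂ B B] [SMulCommClass ℂ B B]
variable {H : RegularMultiplierHopf A} {K : RegularMultiplierHopf B}
variable (γ : LeftComoduleCoalgebra H K) (α : RightModuleAlgebra B H)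

/-- The operator `P` with its source and target in the order `A ⊗ B`. -/
def flipP : Module.End ℂ (A ⊗[ℂ] B) :=
  (comm ℂ B A).toLinearMap ∘ₗ γ.P α ∘ₗ (comm ℂ A B).toLinearMap

theorem flipP_apply (t : A ⊗[ℂ] B) : γ.flipP α t = comm ℂ B A (γ.P α (comm ℂ A B t)) := rfl

theorem flipP_eq : γ.flipP α = γ.tauOp * α.rop := rfl

/-- The condition `T R = Tᵒᵖ Rᵒᵖ` gives a second factorization of `P`, into two bijections. -/
theorem TwistCondition.flipP_eq {γ : LeftComoduleCoalgebra H K} {α : RightModuleAlgebra B H}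
    (h : γ.TwistCondition α) : γ.flipP α = γ.tau * α.r.toLinearMap := by
  apply LinearMap.ext
  intro t
  have h1 := congrArg (fun f => comm ℂ B A (f (comm ℂ A B t))) h
  exact h1.symm

/-- `(d ⊗ 1 ⊗ 1)P₁₃(Δ_B(b) ⊗ a)` when `d ⊗ a` is replaced by `∑ (d ◁ a₍₁₎) ⊗ a₍₂₎`: the factor `d`
can then be moved inside `P`. -/
theorem coverP₁₃_twistOp (d b : B) (a : A) :
    γ.coverP₁₃ α (comm ℂ A B (α.twistOp (d ⊗ₜ a)) ⊗ₜ b) =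
      γ.P₁₃B α (assoc ℂ B B A (K.T₂ (d ⊗ₜ b) ⊗ₜ a)) := by
  apply RegularMultiplierHopf.eq_of_lTensor (fun c : B => (μᵣ c).rTensor A)
    (fun v hv => eq_zero_of_rTensor (fun c : B => μᵣ c) K.mulRight_cancel hv)
  intro c
  have h1 : ∀ s : B ⊗[ℂ] B, ((μᵣ c).rTensor A).lTensor B
      (γ.P₁₃B α (assoc ℂ B B A (s ⊗ₜ a))) =
      γ.P₁₃B α (assoc ℂ B B A ((μᵣ c).lTensor B s ⊗ₜ a)) := by
    intro s
    induction s with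
    | zero => simp
    | add s t hs ht => simp only [map_add, TensorProduct.add_tmul, hs, ht]
    | tmul p q =>
      rw [TensorProduct.assoc_tmul, P₁₃B_tmul, LinearMap.lTensor_tmul, TensorProduct.assoc_tmul,
        P₁₃B_tmul]
      generalize γ.P α (p ⊗ₜ a) = z
      induction z with
      | zero => simp
      | add s t hs ht => simp only [map_add, TensorProduct.tmul_add, hs, ht]
      | tmul v w => simp
  have h2 : ∀ (x : B ⊗[ℂ] A), γ.coverP₁₃Aux α c (x ⊗ₜ b) =
      TensorProduct.lift ((LinearMap.llcomp ℂ A (B ⊗[ℂ] (B ⊗[ℂ] A)) (B ⊗[ℂ] (B ⊗[ℂ] A))).flip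
        (γ.P₁₃B α ∘ₗ (assoc ℂ B B A).toLinearMap ∘ₗ
          TensorProduct.mk ℂ (B ⊗[ℂ] B) A (K.T₁ (b ⊗ₜ c))) ∘ₗ
            (LinearMap.rTensorHom (B ⊗[ℂ] A) ∘ₗ LinearMap.mul ℂ B)) x := by
    intro x
    induction x with
    | zero => simp
    | add s t hs ht => simp only [map_add, TensorProduct.add_tmul, hs, ht]
    | tmul p q => rw [coverP₁₃Aux_tmul]; rfl
  have h3 := (γ.exists_coverP₁₃ α).choose_spec (comm ℂ A B (α.twistOp (d ⊗ₜ a)) ⊗ₜ b) c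
  rw [h1, K.T₂_T₁]
  refine h3.trans ?_
  rw [h2]
  generalize K.T₁ (b ⊗ₜ c) = s
  induction s with
  | zero =>
    generalize comm ℂ A B (α.twistOp (d ⊗ₜ a)) = x
    induction x with
    | zero => simp
    | add s t hs ht => rw [map_add, hs, ht]; simp
    | tmul p q => simp
  | add s t hs ht =>
    simp only [map_add, TensorProduct.add_tmul, ← hs, ← ht]
    generalize comm ℂ A B (α.twistOp (d ⊗ₜ a)) = x
    induction x with
    | zero => simp
    | add y y' h h' => simp only [map_add, h, h']; abel
    | tmul p q => simp
  | tmul p q =>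
    rw [LinearMap.rTensor_tmul, TensorProduct.assoc_tmul, P₁₃B_tmul, LinearMap.mulLeft_apply, mul_P]
    generalize comm ℂ A B (α.twistOp (d ⊗ₜ a)) = x
    induction x with
    | zero => simp
    | add s t hs ht => simp only [map_add, TensorProduct.tmul_add, hs, ht]
    | tmul v w =>
      simp only [TensorProduct.lift.tmul, LinearMap.comp_apply, LinearMap.flip_apply,
        LinearMap.llcomp_apply, TensorProduct.mk_apply, LinearEquiv.coe_coe,
        TensorProduct.assoc_tmul, P₁₃B_tmul]
      generalize γ.P α (p ⊗ₜ w) = z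
      induction z with
      | zero => simp
      | add s t hs ht => simp only [map_add, TensorProduct.tmul_add, hs, ht]
      | tmul v w => simp

/-- The identification of `B ⊗ (B ⊗ A)` with `(A ⊗ B) ⊗ B`, sending `d ⊗ b ⊗ a` to `a ⊗ d ⊗ b`. -/
def rotate : B ⊗[ℂ] (B ⊗[ℂ] A) ≃ₗ[ℂ] (A ⊗[ℂ] B) ⊗[ℂ] B :=
  (assoc ℂ B B A).symm ≪≫ₗ comm ℂ (B ⊗[ℂ] B) A ≪≫ₗ (assoc ℂ A B B).symm

theorem rotate_tmul (d b : B) (a : A) : rotate (d ⊗ₜ (b ⊗ₜ a)) = (a ⊗ₜ d) ⊗ₜ b := rfl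

theorem rotate_P₂₃ (t : B ⊗[ℂ] (B ⊗[ℂ] A)) :
    rotate (γ.P₂₃ α t) = leg13 (γ.flipP α) (rotate t) := by
  induction t with
  | zero => simp
  | add s t hs ht => simp only [map_add, hs, ht]
  | tmul d t =>
    induction t with
    | zero => simp
    | add s t hs ht => simp only [map_add, TensorProduct.tmul_add, hs, ht]
    | tmul b a =>
      rw [rotate_tmul, leg13_tmul, flipP_apply, TensorProduct.comm_tmul]
      change rotate (d ⊗ₜ γ.P α (b ⊗ₜ a)) = _
      generalize γ.P α (b ⊗ₜ a) = s
      induction s with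
      | zero => simp
      | add s t hs ht => simp only [map_add, TensorProduct.tmul_add, hs, ht]
      | tmul p q => rfl

theorem rotate_P₁₃B (t : B ⊗[ℂ] (B ⊗[ℂ] A)) :
    rotate (γ.P₁₃B α t) = leg12 (γ.flipP α) (rotate t) := by
  induction t with
  | zero => simp
  | add s t hs ht => simp only [map_add, hs, ht]
  | tmul d t =>
    induction t with
    | zero => simp
    | add s t hs ht => simp only [map_add, TensorProduct.tmul_add, hs, ht]
    | tmul b a =>
      rw [rotate_tmul, leg12_tmul, flipP_apply, TensorProduct.comm_tmul, P₁₃B_tmul]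
      generalize γ.P α (d ⊗ₜ a) = s
      induction s with
      | zero => simp
      | add s t hs ht => simp only [map_add, TensorProduct.tmul_add, TensorProduct.add_tmul, hs, ht]
      | tmul p q => rfl

variable {γ α}

/-- The condition `(Δ_B ⊗ ι)P = P₂₃P₁₃(Δ_B ⊗ ι)` as an identity between operators on `A ⊗ B ⊗ B`.
The operator `Rᵒᵖ` appears because the covering factor `d` is replaced as in `coverP₁₃_twistOp`. -/
theorem ComulCondition.flipP_T₂ (h : γ.ComulCondition α) :
    (leg13 (γ.flipP α) * leg12 (γ.flipP α) * leg23 K.T₂.toLinearMap :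
      Module.End ℂ ((A ⊗[ℂ] B) ⊗[ℂ] B)) =
    leg23 K.T₂.toLinearMap * leg13 (γ.flipP α) * leg12 α.rop := by
  apply end_ext₃
  intro a d b
  have h1 : ∀ t : A ⊗[ℂ] B, leg23 K.T₂.toLinearMap (leg13 (γ.flipP α) (t ⊗ₜ b)) =
      leg13 (γ.flipP α) (rotate (γ.coverP₁₃ α (comm ℂ A B t ⊗ₜ b))) := by
    intro t
    induction t with
    | zero => simp
    | add s t hs ht => simp only [map_add, TensorProduct.add_tmul, hs, ht]
    | tmul a d =>
      rw [TensorProduct.comm_tmul, ← rotate_P₂₃, ← h d a b, leg13_tmul, flipP_apply,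
        TensorProduct.comm_tmul]
      generalize γ.P α (b ⊗ₜ a) = s
      induction s with
      | zero => simp
      | add s t hs ht => simp only [map_add, hs, ht]
      | tmul p q =>
        rw [TensorProduct.comm_tmul, LinearMap.rTensor_tmul, LinearMap.flip_apply,
          TensorProduct.mk_apply, leg23_tmul, LinearMap.rTensor_tmul, LinearMap.comp_apply,
          TensorProduct.mk_apply]
        generalize K.T₂.toLinearMap (d ⊗ₜ p) = s
        induction s with
        | zero => simp
        | add s t hs ht => simp only [map_add, TensorProduct.add_tmul, hs, ht]
        | tmul p q => rfl
  have h2 : ∀ s : B ⊗[ℂ] B, rotate (assoc ℂ B B A (s ⊗ₜ a)) =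
      (TensorProduct.mk ℂ A B a).rTensor B s := by
    intro s
    induction s with
    | zero => simp
    | add s t hs ht => simp only [map_add, TensorProduct.add_tmul, hs, ht]
    | tmul p q => rfl
  simp only [Module.End.mul_apply]
  rw [leg12_tmul, h1]
  have h3 : α.rop (a ⊗ₜ d) = α.twistOp (d ⊗ₜ a) := rfl
  rw [h3, coverP₁₃_twistOp, rotate_P₁₃B, h2, leg23_tmul]
  rfl

theorem leg13_tau_cancel {V : Type*} [AddCommGroup V] [Module ℂ V]
    {f g : Module.End ℂ ((A ⊗[ℂ] V) ⊗[ℂ] B)}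
    (h : leg13 γ.tau * f = leg13 γ.tau * g) : f = g := by
  have h1 : γ.tauEquiv.symm.toLinearMap * γ.tau = 1 := by
    apply LinearMap.ext
    intro t
    exact γ.tauEquiv.symm_apply_apply t
  have h2 := congrArg (fun f => leg13 γ.tauEquiv.symm.toLinearMap * f) h
  rwa [← mul_assoc, ← mul_assoc, ← leg13_mul, h1, leg13_one, one_mul, one_mul] at h2

/-- The exchange relation between `P` and `Δ_B` that makes the coproduct of the smash product
multiplicative: it is what `Δ_#(ba) = Δ_#(b)Δ_#(a)` requires. After `τ₁₃` has been applied, both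
sides become `Δ_B P₁₃ Rᵒᵖ₁₂` up to flips, the left-hand side by the condition on `(Δ_B ⊗ ι)P`, the
right-hand side by `tau_T₂` and `leg12_rop_leg13_r`; and `τ` is injective. -/
theorem r_flipP_T₂ (hcomul : γ.ComulCondition α) (htwist : γ.TwistCondition α) :
    (leg13 α.r.toLinearMap * leg12 (γ.flipP α) * leg23 K.T₂.toLinearMap :
      Module.End ℂ ((A ⊗[ℂ] B) ⊗[ℂ] B)) =
    leg23 K.T₂.toLinearMap * leg12 (γ.flipP α) * leg13 α.r.toLinearMap := by
  apply leg13_tau_cancel (γ := γ)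
  calc _ = leg13 (γ.flipP α) * leg12 (γ.flipP α) * leg23 K.T₂.toLinearMap := by
        rw [htwist.flipP_eq, leg13_mul]; simp only [mul_assoc]
    _ = leg23 K.T₂.toLinearMap * leg13 (γ.flipP α) * leg12 α.rop := hcomul.flipP_T₂
    _ = leg23 K.T₂.toLinearMap * leg13 γ.tau * (leg12 α.rop * leg13 α.r.toLinearMap) := by
        rw [α.leg12_rop_leg13_r, htwist.flipP_eq, leg13_mul]; simp only [mul_assoc]
    _ = _ := by
        rw [← γ.tau_T₂, γ.flipP_eq, leg12_mul]; simp only [mul_assoc]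

/-- Applying `τ₁₃` removes the coaction from `P`. -/
theorem tau_T₂_flipP : (leg13 γ.tau * (leg23 K.T₂.toLinearMap * leg12 (γ.flipP α)) :
      Module.End ℂ ((A ⊗[ℂ] B) ⊗[ℂ] B)) =
    leg23 K.T₂.toLinearMap * leg13 γ.tau * leg12 α.rop := by
  rw [← γ.tau_T₂, flipP_eq, leg12_mul]
  simp only [mul_assoc]

end LeftComoduleCoalgebra

/-! ### Triple tensor products bracketed to the right -/

section Legs

variable {L M N : Type*} [AddCommGroup L] [Module ℂ L] [AddCommGroup M] [Module ℂ M]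
  [AddCommGroup N] [Module ℂ N]

/-- `f ⊗ ι` as an operator on `L ⊗ (M ⊗ N)`. -/
def legR12 (f : Module.End ℂ (L ⊗[ℂ] M)) : Module.End ℂ (L ⊗[ℂ] (M ⊗[ℂ] N)) :=
  (assoc ℂ L M N).toLinearMap ∘ₗ f.rTensor N ∘ₗ (assoc ℂ L M N).symm.toLinearMap

/-- `f` acting on the outer factors of `L ⊗ (M ⊗ N)`. -/
def legR13 (f : Module.End ℂ (L ⊗[ℂ] N)) : Module.End ℂ (L ⊗[ℂ] (M ⊗[ℂ] N)) :=
  (assoc ℂ L M N).toLinearMap ∘ₗ leg13 f ∘ₗ (assoc ℂ L M N).symm.toLinearMap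

theorem legR12_tmul (f : Module.End ℂ (L ⊗[ℂ] M)) (x : L) (y : M) (z : N) :
    legR12 f (x ⊗ₜ (y ⊗ₜ z)) = assoc ℂ L M N (f (x ⊗ₜ y) ⊗ₜ z) := rfl

theorem legR12_assoc (f : Module.End ℂ (L ⊗[ℂ] M)) (t : (L ⊗[ℂ] M) ⊗[ℂ] N) :
    legR12 f (assoc ℂ L M N t) = assoc ℂ L M N (leg12 f t) := by
  simp [legR12, leg12]

theorem legR13_assoc (f : Module.End ℂ (L ⊗[ℂ] N)) (t : (L ⊗[ℂ] M) ⊗[ℂ] N) :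
    legR13 f (assoc ℂ L M N t) = assoc ℂ L M N (leg13 f t) := by
  simp [legR13]

theorem legR13_tmul (f : Module.End ℂ (L ⊗[ℂ] N)) (x : L) (y : M) (z : N) :
    legR13 f (x ⊗ₜ (y ⊗ₜ z)) = (TensorProduct.mk ℂ M N y).lTensor L (f (x ⊗ₜ z)) := by
  rw [← TensorProduct.assoc_tmul, legR13_assoc, leg13_tmul]
  generalize f (x ⊗ₜ z) = t
  induction t with
  | zero => simp
  | add s t hs ht => simp only [map_add, hs, ht]
  | tmul p q => simp

theorem legR12_mul (f g : Module.End ℂ (L ⊗[ℂ] M)) :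
    (legR12 (f * g) : Module.End ℂ (L ⊗[ℂ] (M ⊗[ℂ] N))) = legR12 f * legR12 g := by
  apply LinearMap.ext
  intro t
  obtain ⟨t, rfl⟩ := (assoc ℂ L M N).surjective t
  rw [Module.End.mul_apply, legR12_assoc, legR12_assoc, legR12_assoc, leg12_mul,
    Module.End.mul_apply]

theorem legR12_one :
    (legR12 (1 : Module.End ℂ (L ⊗[ℂ] M)) : Module.End ℂ (L ⊗[ℂ] (M ⊗[ℂ] N))) = 1 := by
  apply LinearMap.ext
  intro t
  obtain ⟨t, rfl⟩ := (assoc ℂ L M N).surjective t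
  rw [legR12_assoc, leg12_one, Module.End.one_apply, Module.End.one_apply]

end Legs

section Covered

variable {A : Type u} [NonUnitalRing A] [Module ℂ A] [IsScalarTower ℂ A A] [SMulCommClass ℂ A A]
variable {B : Type v} [NonUnitalRing B] [Module ℂ B] [IsScalarTower ℂ B B] [SMulCommClass ℂ B B]
variable {H : RegularMultiplierHopf A}
variable {Z : Type*} [AddCommGroup Z] [Module ℂ Z]

/-- An operator of the form `a ⊗ z ↦ ∑ a₍₁₎ ⊗ τ_z(a₍₂₎)` commutes with `T₂` on the other side of
`a`, by coassociativity. -/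
theorem leg12_T₂_leg23_of_isCovered {Q : Module.End ℂ (A ⊗[ℂ] Z)} {τ : Z → A →ₗ[ℂ] Z}
    (h : ∀ z, H.IsCovered (τ z) (Q ∘ₗ (TensorProduct.mk ℂ A Z).flip z)) :
    (leg12 H.T₂.toLinearMap * leg23 Q : Module.End ℂ ((A ⊗[ℂ] A) ⊗[ℂ] Z)) =
      leg23 Q * leg12 H.T₂.toLinearMap := by
  apply end_ext₃
  intro c a z
  have h1 := (h z).T₂_rTensor c a
  have h2 : ∀ t : A ⊗[ℂ] Z, (assoc ℂ A A Z).symm (c ⊗ₜ t) =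
      (TensorProduct.mk ℂ A A c).rTensor Z t := by
    intro t
    induction t with
    | zero => simp
    | add s t hs ht => simp only [map_add, TensorProduct.tmul_add, hs, ht]
    | tmul p q => simp
  have h3 : ∀ t : A ⊗[ℂ] A, (assoc ℂ A A Z).symm
      ((Q ∘ₗ (TensorProduct.mk ℂ A Z).flip z).lTensor A t) = leg23 Q (t ⊗ₜ z) := by
    intro t
    induction t with
    | zero => simp
    | add s t hs ht => simp only [map_add, TensorProduct.add_tmul, hs, ht]
    | tmul p q => simp [leg23]
  rw [h3, LinearMap.comp_apply, h2] at h1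
  rw [Module.End.mul_apply, Module.End.mul_apply, leg23_tmul]
  exact h1

/-- An operator of the form `a ⊗ z ↦ ∑ a₍₁₎ ⊗ τ_z(a₍₂₎)` commutes with `Rᵒᵖ`, by coassociativity. -/
theorem leg12_rop_leg13_of_isCovered (α : RightModuleAlgebra B H) {Q : Module.End ℂ (A ⊗[ℂ] Z)}
    {τ : Z → A →ₗ[ℂ] Z}
    (h : ∀ z, H.IsCovered (τ z) (Q ∘ₗ (TensorProduct.mk ℂ A Z).flip z)) :
    (leg12 α.rop * leg13 Q : Module.End ℂ ((A ⊗[ℂ] B) ⊗[ℂ] Z)) = leg13 Q * leg12 α.rop := by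
  apply end_ext₃
  intro a d z
  have h1 := α.rop_rTensor (h z) a d
  rw [Module.End.mul_apply, Module.End.mul_apply, leg12_tmul, leg13_tmul_eq_rightComm,
    leg13_tmul_eq_rightComm]
  exact h1

end Covered

section Legs

variable {L M N S : Type*} [AddCommGroup L] [Module ℂ L] [AddCommGroup M] [Module ℂ M]
  [AddCommGroup N] [Module ℂ N] [AddCommGroup S] [Module ℂ S]

theorem legR12_leg12 (f : Module.End ℂ (L ⊗[ℂ] M)) :
    (legR12 (leg12 f) : Module.End ℂ ((L ⊗[ℂ] M) ⊗[ℂ] (N ⊗[ℂ] S))) = leg12 f := by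
  apply TensorProduct.ext'
  intro p q
  induction q with
  | zero => simp
  | add s t hs ht => simp only [map_add, TensorProduct.tmul_add, hs, ht]
  | tmul y z => rw [legR12_tmul, leg12_tmul, leg12_tmul, TensorProduct.assoc_tmul]

theorem legR12_leg13 (f : Module.End ℂ (L ⊗[ℂ] N)) :
    (legR12 (leg13 f) : Module.End ℂ ((L ⊗[ℂ] M) ⊗[ℂ] (N ⊗[ℂ] S))) = leg13 (legR12 f) := by
  apply end_ext₃
  intro x y q
  induction q with
  | zero => simp
  | add s t hs ht => simp only [map_add, TensorProduct.tmul_add, hs, ht]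
  | tmul z w =>
    rw [legR12_tmul, leg13_tmul, leg13_tmul, legR12_tmul]
    generalize f (x ⊗ₜ z) = s
    induction s with
    | zero => simp
    | add s t hs ht => simp only [map_add, TensorProduct.add_tmul, hs, ht]
    | tmul x z => simp

theorem legR12_leg23 (f : Module.End ℂ (M ⊗[ℂ] N)) :
    (legR12 (leg23 f) : Module.End ℂ ((L ⊗[ℂ] M) ⊗[ℂ] (N ⊗[ℂ] S))) = leg23 (legR12 f) := by
  apply end_ext₃
  intro x y q
  induction q with
  | zero => simp
  | add s t hs ht => simp only [map_add, TensorProduct.tmul_add, hs, ht]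
  | tmul z w =>
    rw [legR12_tmul, leg23_tmul, leg23_tmul, legR12_tmul]
    generalize f (y ⊗ₜ z) = s
    induction s with
    | zero => simp
    | add s t hs ht => simp only [map_add, TensorProduct.add_tmul, hs, ht]
    | tmul x z => simp

theorem leg13_lTensor (f : Module.End ℂ N) :
    (leg13 (f.lTensor L) : Module.End ℂ ((L ⊗[ℂ] M) ⊗[ℂ] N)) = f.lTensor (L ⊗[ℂ] M) := by
  apply end_ext₃
  intro x y z
  simp [leg13_tmul]

theorem leg23_lTensor (f : Module.End ℂ N) :
    (leg23 (f.lTensor M) : Module.End ℂ ((L ⊗[ℂ] M) ⊗[ℂ] N)) = f.lTensor (L ⊗[ℂ] M) := by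
  apply end_ext₃
  intro x y z
  simp [leg23_tmul]

theorem leg12_lTensor_comm (f : Module.End ℂ (L ⊗[ℂ] M)) (g : Module.End ℂ N) :
    leg12 f * g.lTensor (L ⊗[ℂ] M) = g.lTensor (L ⊗[ℂ] M) * leg12 f := by
  apply LinearMap.ext
  intro t
  exact rTensor_lTensor_comm f g t

/-- Operators on disjoint factors of `L ⊗ M ⊗ (N ⊗ S)` commute. -/
theorem leg13_legR13_leg23_legR12 (f : Module.End ℂ (L ⊗[ℂ] S)) (g : Module.End ℂ (M ⊗[ℂ] N)) :
    (leg13 (legR13 f) * leg23 (legR12 g) : Module.End ℂ ((L ⊗[ℂ] M) ⊗[ℂ] (N ⊗[ℂ] S))) =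
      leg23 (legR12 g) * leg13 (legR13 f) := by
  have key : ∀ (x : L) (y : M) (z : N) (w : S),
      (leg13 (legR13 f) (leg23 (legR12 g) ((x ⊗ₜ[ℂ] y) ⊗ₜ[ℂ] (z ⊗ₜ[ℂ] w)))) =
      (leg23 (legR12 g) (leg13 (legR13 f) ((x ⊗ₜ[ℂ] y) ⊗ₜ[ℂ] (z ⊗ₜ[ℂ] w)))) := by
    intro x y z w
    have h1 : ∀ t : M ⊗[ℂ] N, leg13 (legR13 f) ((TensorProduct.mk ℂ L M x).rTensor (N ⊗[ℂ] S)
        (assoc ℂ M N S (t ⊗ₜ w))) =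
        (comm ℂ S N).toLinearMap.lTensor (L ⊗[ℂ] M)
          (TensorProduct.tensorTensorTensorComm ℂ L S M N (f (x ⊗ₜ w) ⊗ₜ t)) := by
      intro t
      induction t with
      | zero => simp
      | add s t hs ht => simp only [map_add, TensorProduct.add_tmul, TensorProduct.tmul_add, hs, ht]
      | tmul y z =>
        rw [TensorProduct.assoc_tmul, LinearMap.rTensor_tmul, TensorProduct.mk_apply, leg13_tmul,
          legR13_tmul]
        generalize f (x ⊗ₜ w) = s
        induction s with
        | zero => simp
        | add s t hs ht => simp only [map_add, TensorProduct.add_tmul, hs, ht]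
        | tmul p q => simp
    rw [leg23_tmul, legR12_tmul, h1, leg13_tmul, legR13_tmul]
    generalize f (x ⊗ₜ w) = s
    induction s with
    | zero => simp
    | add s t hs ht => simp only [map_add, TensorProduct.add_tmul, ← hs, ← ht]
    | tmul p q =>
      rw [LinearMap.lTensor_tmul, TensorProduct.mk_apply, LinearMap.rTensor_tmul,
        LinearMap.flip_apply, TensorProduct.mk_apply, leg23_tmul, legR12_tmul]
      generalize g (y ⊗ₜ z) = s
      induction s with
      | zero => simp
      | add s t hs ht => simp only [map_add, TensorProduct.add_tmul, TensorProduct.tmul_add, hs, ht]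
      | tmul u v => simp
  apply end_ext₃
  intro x y q
  induction q with
  | zero => simp
  | add s t hs ht => simp only [map_add, TensorProduct.tmul_add, hs, ht]
  | tmul z w => exact key x y z w

end Legs

/-! ### The canonical maps of the smash product -/

namespace LeftComoduleCoalgebra

variable {A : Type u} [NonUnitalRing A] [Module ℂ A] [IsScalarTower ℂ A A] [SMulCommClass ℂ A A]
variable {B : Type v} [NonUnitalRing B] [Module ℂ B] [IsScalarTower ℂ B B] [SMulCommClass ℂ B B]
variable {H : RegularMultiplierHopf A} {K : RegularMultiplierHopf B}
variable (γ : LeftComoduleCoalgebra H K) (α : RightModuleAlgebra B H)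

/-- `a ⊗ b ⊗ x ↦ ∑ a₍₁₎ ⊗ Γ(a₍₂₎)(b ⊗ x)`. The definition of a comodule coalgebra only asserts the
existence of such an element. But `τ` on the first two factors sends it to
`∑ a₍₀₎₍₁₎ ⊗ a₍₋₁₎ b ⊗ a₍₀₎₍₂₎ x`, since `Γ` is compatible with `Δ_A`, and `τ` is bijective. -/
def coactFusion : Module.End ℂ (A ⊗[ℂ] (B ⊗[ℂ] (A ⊗[ℂ] B))) :=
  legR12 γ.tauEquiv.symm.toLinearMap * legR13 (legR12 H.T₁.toLinearMap) * legR12 γ.tau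

/-- `a ⊗ x ↦ a x`. -/
def mulLeftA : A ⊗[ℂ] (A ⊗[ℂ] B) →ₗ[ℂ] A ⊗[ℂ] B :=
  (LinearMap.mul' ℂ A).rTensor B ∘ₗ (assoc ℂ A A B).symm.toLinearMap

/-- `a ⊗ b ⊗ x ↦ Γ(a)(b ⊗ x)`. -/
def coactMul : A ⊗[ℂ] (B ⊗[ℂ] (A ⊗[ℂ] B)) →ₗ[ℂ] B ⊗[ℂ] (A ⊗[ℂ] B) :=
  mulLeftA.lTensor B ∘ₗ (assoc ℂ B A (A ⊗[ℂ] B)).toLinearMap ∘ₗ γ.T.rTensor (A ⊗[ℂ] B) ∘ₗ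
    (assoc ℂ A B (A ⊗[ℂ] B)).symm.toLinearMap

theorem coactMul_tmul (a : A) (b : B) (x : A ⊗[ℂ] B) : γ.coactMul (a ⊗ₜ (b ⊗ₜ x)) =
    mulLeftA.lTensor B (assoc ℂ B A (A ⊗[ℂ] B) (γ.T (a ⊗ₜ b) ⊗ₜ x)) := rfl

theorem coactMul_tmul_tmul (a : A) (b : B) (a' : A) (b' : B) : γ.coactMul (a ⊗ₜ (b ⊗ₜ (a' ⊗ₜ b'))) =
    assoc ℂ B A B ((μᵣ a').lTensor B (γ.T (a ⊗ₜ b)) ⊗ₜ b') := by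
  rw [coactMul_tmul]
  generalize γ.T (a ⊗ₜ b) = s
  induction s with
  | zero => simp
  | add s t hs ht => simp only [map_add, TensorProduct.add_tmul, hs, ht]
  | tmul u v => simp [mulLeftA]

/-- The compatibility of `Γ` with `Δ_A`. -/
theorem tau_mul_coactFusion : legR12 γ.tau * γ.coactFusion =
    legR13 (legR12 H.T₁.toLinearMap) * legR12 γ.tau := by
  have h : γ.tau * γ.tauEquiv.symm.toLinearMap = 1 := by
    apply LinearMap.ext
    intro t
    exact γ.tauEquiv.apply_symm_apply t
  rw [coactFusion, mul_assoc, ← mul_assoc, ← legR12_mul, h, legR12_one, one_mul]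

theorem legR12_tau_injective {V : Type*} [AddCommGroup V] [Module ℂ V] :
    Function.Injective (legR12 γ.tau : Module.End ℂ (A ⊗[ℂ] (B ⊗[ℂ] V))) := by
  have h : γ.tauEquiv.symm.toLinearMap * γ.tau = 1 := by
    apply LinearMap.ext
    intro t
    exact γ.tauEquiv.symm_apply_apply t
  refine Function.LeftInverse.injective (g := legR12 γ.tauEquiv.symm.toLinearMap) fun t => ?_
  rw [← Module.End.mul_apply, ← legR12_mul, h, legR12_one, Module.End.one_apply]

/-- The map `coactFusion` is indeed given by its formula `∑ a₍₁₎ ⊗ Γ(a₍₂₎)(b ⊗ x)`. -/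
theorem coactFusion_isCovered (η : B ⊗[ℂ] (A ⊗[ℂ] B)) :
    H.IsCovered (γ.coactMul ∘ₗ (TensorProduct.mk ℂ A (B ⊗[ℂ] (A ⊗[ℂ] B))).flip η)
      (γ.coactFusion ∘ₗ (TensorProduct.mk ℂ A (B ⊗[ℂ] (A ⊗[ℂ] B))).flip η) := by
  intro c a
  induction η with
  | zero => simp
  | add s t hs ht =>
    simp only [map_add, LinearMap.comp_add, LinearMap.add_apply, LinearMap.lTensor_add, hs, ht]
  | tmul b x =>
    induction x with
    | zero => simp
    | add s t hs ht =>
      simp only [map_add, TensorProduct.tmul_add, LinearMap.comp_add, LinearMap.add_apply,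
        LinearMap.lTensor_add, hs, ht]
    | tmul a' b' =>
      obtain ⟨w, hw⟩ := γ.covered_right a b a'
      have h1 : γ.coactFusion (a ⊗ₜ (b ⊗ₜ (a' ⊗ₜ b'))) =
          ((assoc ℂ B A B).toLinearMap ∘ₗ
            (TensorProduct.mk ℂ (B ⊗[ℂ] A) B).flip b').lTensor A w := by
        apply γ.legR12_tau_injective
        let E : B ⊗[ℂ] (A ⊗[ℂ] A) →ₗ[ℂ] A ⊗[ℂ] (B ⊗[ℂ] (A ⊗[ℂ] B)) :=
          (((TensorProduct.mk ℂ A B).flip b').lTensor B).lTensor A ∘ₗ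
            (TensorProduct.leftComm ℂ B A A).toLinearMap
        have hE : ∀ u v w, E (u ⊗ₜ (v ⊗ₜ w)) = v ⊗ₜ (u ⊗ₜ (w ⊗ₜ b')) := fun u v w => rfl
        clear_value E
        have h2 : ∀ w : A ⊗[ℂ] (B ⊗[ℂ] A), legR12 γ.tau
            (((assoc ℂ B A B).toLinearMap ∘ₗ
              (TensorProduct.mk ℂ (B ⊗[ℂ] A) B).flip b').lTensor A w) =
            E (assoc ℂ B A A (γ.T.rTensor A ((assoc ℂ A B A).symm w))) := by
          intro w
          induction w with
          | zero => simp
          | add s t hs ht => simp only [map_add, hs, ht]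
          | tmul p s =>
            induction s with
            | zero => simp
            | add s t hs ht => simp only [map_add, TensorProduct.tmul_add, hs, ht]
            | tmul q s =>
              simp only [LinearMap.lTensor_tmul, LinearMap.comp_apply, LinearMap.flip_apply,
                TensorProduct.mk_apply, LinearEquiv.coe_coe, TensorProduct.assoc_tmul, legR12_tmul,
                TensorProduct.assoc_symm_tmul, LinearMap.rTensor_tmul, tau_apply]
              generalize γ.T (p ⊗ₜ q) = r
              induction r with
              | zero => simp
              | add s t hs ht => simp only [map_add, TensorProduct.add_tmul, hs, ht]
              | tmul u v => simp [hE]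
        rw [h2, ← Module.End.mul_apply, tau_mul_coactFusion, Module.End.mul_apply]
        have h3 := γ.comul_right a b a' w hw
        have h4 : γ.T = cotwist γ.coact := rfl
        rw [h4, h3, ← h4, legR12_tmul, tau_apply]
        generalize γ.T (a ⊗ₜ b) = s
        induction s with
        | zero => simp
        | add s t hs ht => simp only [map_add, TensorProduct.add_tmul, hs, ht]
        | tmul u v =>
          rw [TensorProduct.comm_tmul, TensorProduct.assoc_tmul, legR13_tmul, legR12_tmul,
            LinearMap.lTensor_tmul, LinearMap.comp_apply, LinearMap.flip_apply,
            TensorProduct.mk_apply]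
          generalize H.T₁.toLinearMap (v ⊗ₜ a') = s
          induction s with
          | zero => simp
          | add s t hs ht =>
            simp only [map_add, TensorProduct.add_tmul, TensorProduct.tmul_add, hs, ht]
          | tmul u v => simp [hE]
      rw [LinearMap.comp_apply, LinearMap.flip_apply, TensorProduct.mk_apply, h1,
        rTensor_lTensor_comm, hw c]
      generalize H.T₂ (c ⊗ₜ a) = s
      induction s with
      | zero => simp
      | add s t hs ht => simp only [map_add, TensorProduct.add_tmul, hs, ht]
      | tmul u v =>
        simp only [TensorProduct.assoc_tmul, LinearMap.lTensor_tmul, LinearMap.comp_apply,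
          LinearMap.flip_apply, TensorProduct.mk_apply, LinearEquiv.coe_coe, coactMul_tmul_tmul]
        rfl

/-- The twist map as an equivalence `B ⊗ A ≃ A ⊗ B`. -/
def twistEquiv : B ⊗[ℂ] A ≃ₗ[ℂ] A ⊗[ℂ] B := comm ℂ B A ≪≫ₗ α.r

theorem twistEquiv_tmul (b : B) (a : A) : twistEquiv α (b ⊗ₜ a) = α.twist (b ⊗ₜ a) := rfl

/-- `b ⊗ x ↦ Δ_B(b)(1 ⊗ x)`, where `B` acts on `AB` by left multiplication. Since `AB = BA` by the
bijectivity of `R`, it suffices to multiply with `x` written in the order `B ⊗ A`. -/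
def comulFusion (K : RegularMultiplierHopf B) (α : RightModuleAlgebra B H) :
    Module.End ℂ (B ⊗[ℂ] (A ⊗[ℂ] B)) :=
  (twistEquiv α).toLinearMap.lTensor B ∘ₗ legR12 K.T₁.toLinearMap ∘ₗ
    (twistEquiv α).symm.toLinearMap.lTensor B

theorem comulFusion_lTensor (t : B ⊗[ℂ] (B ⊗[ℂ] A)) :
    comulFusion K α ((twistEquiv α).toLinearMap.lTensor B t) =
      (twistEquiv α).toLinearMap.lTensor B (legR12 K.T₁.toLinearMap t) := by
  simp only [comulFusion, LinearMap.comp_apply]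
  rw [← LinearMap.lTensor_comp_apply, ← LinearEquiv.coe_trans, LinearEquiv.self_trans_symm]
  simp

/-- Coassociativity of `Δ_B`, with the last leg in `M(AB)`. -/
theorem leg12_T₂_leg23_comulFusion : (leg12 K.T₂.toLinearMap * leg23 (comulFusion K α) :
      Module.End ℂ ((B ⊗[ℂ] B) ⊗[ℂ] (A ⊗[ℂ] B))) =
    leg23 (comulFusion K α) * leg12 K.T₂.toLinearMap := by
  have h1 : (leg12 K.T₂.toLinearMap * leg23 (legR12 K.T₁.toLinearMap) :
      Module.End ℂ ((B ⊗[ℂ] B) ⊗[ℂ] (B ⊗[ℂ] A))) =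
      leg23 (legR12 K.T₁.toLinearMap) * leg12 K.T₂.toLinearMap := by
    rw [← legR12_leg12, ← legR12_leg23, ← legR12_mul, ← legR12_mul, K.leg12_T₂_leg23_T₁]
  have h2 : ∀ s : (B ⊗[ℂ] B) ⊗[ℂ] (B ⊗[ℂ] A), leg23 (comulFusion K α)
      ((twistEquiv α).toLinearMap.lTensor (B ⊗[ℂ] B) s) =
      (twistEquiv α).toLinearMap.lTensor (B ⊗[ℂ] B) (leg23 (legR12 K.T₁.toLinearMap) s) := by
    intro s
    induction s with
    | zero => simp
    | add s t hs ht => simp only [map_add, hs, ht]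
    | tmul s z =>
      induction s with
      | zero => simp
      | add s t hs ht => simp only [map_add, TensorProduct.add_tmul, hs, ht]
      | tmul p q =>
        rw [LinearMap.lTensor_tmul, leg23_tmul, leg23_tmul, ← LinearMap.lTensor_tmul,
          comulFusion_lTensor, rTensor_lTensor_comm]
  apply LinearMap.ext
  intro t
  obtain ⟨t, rfl⟩ : ∃ s, (twistEquiv α).toLinearMap.lTensor (B ⊗[ℂ] B) s = t :=
    LinearMap.lTensor_surjective _ (twistEquiv α).surjective t
  have h3 := congrArg (fun f => (twistEquiv α).toLinearMap.lTensor (B ⊗[ℂ] B) (f t)) h1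
  simp only [Module.End.mul_apply] at h3 ⊢
  rw [h2]
  have h4 : ∀ s : (B ⊗[ℂ] B) ⊗[ℂ] (B ⊗[ℂ] A), leg12 K.T₂.toLinearMap
      ((twistEquiv α).toLinearMap.lTensor (B ⊗[ℂ] B) s) =
      (twistEquiv α).toLinearMap.lTensor (B ⊗[ℂ] B) (leg12 K.T₂.toLinearMap s) :=
    fun s => rTensor_lTensor_comm _ _ s
  rw [h4, h4, h2, h3]

/-- `a ⊗ b ⊗ x ↦ Δ_#(ab)(1 ⊗ x)`, that is, `∑ (a₍₁₎ ⊗ 1)Γ(a₍₂₎)Δ_B(b)(1 ⊗ x)`, on `A ⊗ (B ⊗ AB)`. -/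
def smashFusion : Module.End ℂ (A ⊗[ℂ] (B ⊗[ℂ] (A ⊗[ℂ] B))) :=
  γ.coactFusion * (comulFusion K α).lTensor A

/-- `y ⊗ z ↦ Δ_#(y)(1 ⊗ z)`. -/
def smashT₁ : Module.End ℂ ((A ⊗[ℂ] B) ⊗[ℂ] (A ⊗[ℂ] B)) :=
  (assoc ℂ A B (A ⊗[ℂ] B)).symm.toLinearMap ∘ₗ γ.smashFusion α ∘ₗ
    (assoc ℂ A B (A ⊗[ℂ] B)).toLinearMap

/-- The identification of `(A ⊗ B) ⊗ B` with `B ⊗ (A ⊗ B)`, sending `a ⊗ d ⊗ b` to `d ⊗ a ⊗ b`. -/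
def swapFirst : (A ⊗[ℂ] B) ⊗[ℂ] B ≃ₗ[ℂ] B ⊗[ℂ] (A ⊗[ℂ] B) :=
  (comm ℂ A B).rTensor B ≪≫ₗ assoc ℂ B A B

theorem swapFirst_tmul (a : A) (d b : B) : swapFirst ((a ⊗ₜ d) ⊗ₜ b) = d ⊗ₜ (a ⊗ₜ b) := rfl

/-- `d ⊗ (a ⊗ b) ↦ P(d ⊗ a)Δ_B(b) = ∑ ((d ◁ a₍₁₎) ⊗ 1)Γ(a₍₂₎)Δ_B(b)`: the part of `(d ⊗ 1)Δ_#(ab)`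
that is left in `B ⊗ AB` when the factors from `A` in the first leg are moved to the left of `d`. -/
def smashT₂B : Module.End ℂ (B ⊗[ℂ] (A ⊗[ℂ] B)) :=
  swapFirst.conj (leg23 K.T₂.toLinearMap * leg12 (γ.flipP α))

theorem smashT₂B_swapFirst (t : (A ⊗[ℂ] B) ⊗[ℂ] B) : γ.smashT₂B α (swapFirst t) =
    swapFirst (leg23 K.T₂.toLinearMap (leg12 (γ.flipP α) t)) := by
  rw [smashT₂B, LinearEquiv.conj_apply_apply, LinearEquiv.symm_apply_apply, Module.End.mul_apply]

/-- `x ⊗ y ↦ (x ⊗ 1)Δ_#(y)`. For `x = cd` and `y = ab` this is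
`∑ (c a₍₁₎ ⊗ 1)((d ◁ a₍₂₎) ⊗ 1)Γ(a₍₃₎)Δ_B(b)`. -/
def smashT₂ : Module.End ℂ ((A ⊗[ℂ] B) ⊗[ℂ] (A ⊗[ℂ] B)) :=
  leg23 (γ.smashT₂B α) * leg13 (legR12 H.T₂.toLinearMap)

theorem smashFusion_isCovered (η : B ⊗[ℂ] (A ⊗[ℂ] B)) :
    H.IsCovered
      (γ.coactMul ∘ₗ (TensorProduct.mk ℂ A (B ⊗[ℂ] (A ⊗[ℂ] B))).flip (comulFusion K α η))
      (γ.smashFusion α ∘ₗ (TensorProduct.mk ℂ A (B ⊗[ℂ] (A ⊗[ℂ] B))).flip η) :=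
  γ.coactFusion_isCovered (comulFusion K α η)

/-- The part of coassociativity of `Δ_#` that involves the factor `T₂` of `A` in `smashT₂`. -/
theorem leg12_T₂_leg23_smashT₁ :
    (leg12 (legR12 H.T₂.toLinearMap) * leg23 (γ.smashT₁ α) :
      Module.End ℂ ((A ⊗[ℂ] (A ⊗[ℂ] B)) ⊗[ℂ] (A ⊗[ℂ] B))) =
    leg23 (γ.smashT₁ α) * leg12 (legR12 H.T₂.toLinearMap) := by
  let κ : (A ⊗[ℂ] A) ⊗[ℂ] (B ⊗[ℂ] (A ⊗[ℂ] B)) ≃ₗ[ℂ] (A ⊗[ℂ] (A ⊗[ℂ] B)) ⊗[ℂ] (A ⊗[ℂ] B) :=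
    (assoc ℂ (A ⊗[ℂ] A) B (A ⊗[ℂ] B)).symm ≪≫ₗ (assoc ℂ A A B).rTensor (A ⊗[ℂ] B)
  have hκ : ∀ s b z, κ (s ⊗ₜ (b ⊗ₜ z)) = assoc ℂ A A B (s ⊗ₜ b) ⊗ₜ z := fun s b z => rfl
  clear_value κ
  have h1 : ∀ t, κ (leg12 H.T₂.toLinearMap t) = leg12 (legR12 H.T₂.toLinearMap) (κ t) := by
    intro t
    induction t with
    | zero => simp
    | add s t hs ht => simp only [map_add, hs, ht]
    | tmul s t =>
      induction t with
      | zero => simp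
      | add s t hs ht => simp only [map_add, TensorProduct.tmul_add, hs, ht]
      | tmul b z => rw [leg12_tmul, hκ, hκ, leg12_tmul, legR12_assoc, leg12_tmul]
  have h2 : ∀ t, κ (leg23 (γ.smashFusion α) t) = leg23 (γ.smashT₁ α) (κ t) := by
    intro t
    induction t with
    | zero => simp
    | add s t hs ht => simp only [map_add, hs, ht]
    | tmul s t =>
      induction t with
      | zero => simp
      | add s t hs ht => simp only [map_add, TensorProduct.tmul_add, hs, ht]
      | tmul b z =>
        induction s with
        | zero => simp
        | add s t hs ht => simp only [map_add, TensorProduct.add_tmul, hs, ht]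
        | tmul c a =>
          rw [leg23_tmul, hκ, TensorProduct.assoc_tmul, leg23_tmul]
          simp only [smashT₁, LinearMap.comp_apply, LinearEquiv.coe_coe, TensorProduct.assoc_tmul]
          generalize γ.smashFusion α (a ⊗ₜ (b ⊗ₜ z)) = s
          induction s with
          | zero => simp
          | add s t hs ht => simp only [map_add, hs, ht]
          | tmul p t =>
            induction t with
            | zero => simp
            | add s t hs ht => simp only [map_add, TensorProduct.tmul_add, hs, ht]
            | tmul q z => simp [hκ]
  apply LinearMap.ext
  intro t
  obtain ⟨t, rfl⟩ := κ.surjective t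
  have h3 := congrArg (fun f => κ (f t)) (leg12_T₂_leg23_of_isCovered (γ.smashFusion_isCovered α))
  simp only [Module.End.mul_apply, h1, h2] at h3 ⊢
  exact h3

/-- The part of coassociativity of `Δ_#` that involves the factors `P` and `T₂` of `B` in `smashT₂`.
Applying the injective `τ₁₃` replaces `P` by `Rᵒᵖ` and `coactFusion` by `T₁`; the operators that
have to change places act on different factors or commute by coassociativity. -/
theorem T₂_flipP_smashFusion :
    (leg23 (legR12 K.T₂.toLinearMap) * leg12 (γ.flipP α) * leg13 (γ.smashFusion α) :
      Module.End ℂ ((A ⊗[ℂ] B) ⊗[ℂ] (B ⊗[ℂ] (A ⊗[ℂ] B)))) =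
    leg13 (γ.smashFusion α) * (leg23 (legR12 K.T₂.toLinearMap) * leg12 (γ.flipP α)) := by
  -- the operators on `A ⊗ B ⊗ (B ⊗ AB)` of which the two sides are composed
  let τ : Module.End ℂ ((A ⊗[ℂ] B) ⊗[ℂ] (B ⊗[ℂ] (A ⊗[ℂ] B))) := leg13 (legR12 γ.tau)
  let G : Module.End ℂ ((A ⊗[ℂ] B) ⊗[ℂ] (B ⊗[ℂ] (A ⊗[ℂ] B))) := leg13 γ.coactFusion
  let D : Module.End ℂ ((A ⊗[ℂ] B) ⊗[ℂ] (B ⊗[ℂ] (A ⊗[ℂ] B))) := leg23 (legR12 K.T₂.toLinearMap)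
  let C : Module.End ℂ ((A ⊗[ℂ] B) ⊗[ℂ] (B ⊗[ℂ] (A ⊗[ℂ] B))) :=
    leg13 (legR13 (legR12 H.T₁.toLinearMap))
  let U : Module.End ℂ ((A ⊗[ℂ] B) ⊗[ℂ] (B ⊗[ℂ] (A ⊗[ℂ] B))) :=
    (comulFusion K α).lTensor (A ⊗[ℂ] B)
  let P : Module.End ℂ ((A ⊗[ℂ] B) ⊗[ℂ] (B ⊗[ℂ] (A ⊗[ℂ] B))) := leg12 (γ.flipP α)
  let R : Module.End ℂ ((A ⊗[ℂ] B) ⊗[ℂ] (B ⊗[ℂ] (A ⊗[ℂ] B))) := leg12 α.rop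
  have hτ : τ * (D * P) = D * τ * R := by
    have h := congrArg (fun f => (legR12 f : Module.End ℂ ((A ⊗[ℂ] B) ⊗[ℂ] (B ⊗[ℂ] (A ⊗[ℂ] B)))))
      (γ.tau_T₂_flipP (α := α))
    simpa only [legR12_mul, legR12_leg12, legR12_leg13, legR12_leg23] using h
  have hτG : τ * G = C * τ := by
    simp only [τ, G, C, ← leg13_mul, tau_mul_coactFusion]
  have hRG : R * G = G * R := leg12_rop_leg13_of_isCovered α γ.coactFusion_isCovered
  have hRU : R * U = U * R := leg12_lTensor_comm _ _
  have hPU : P * U = U * P := leg12_lTensor_comm _ _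
  have hCD : C * D = D * C := leg13_legR13_leg23_legR12 _ _
  have hUD : D * U = U * D := by
    simp only [D, U]
    rw [← leg23_lTensor, ← leg23_mul, ← leg23_mul]
    congr 1
    apply LinearMap.ext
    intro t
    obtain ⟨t, rfl⟩ := (assoc ℂ B B (A ⊗[ℂ] B)).surjective t
    have h1 : ∀ t, (comulFusion K α).lTensor B (assoc ℂ B B (A ⊗[ℂ] B) t) =
        assoc ℂ B B (A ⊗[ℂ] B) (leg23 (comulFusion K α) t) := by
      intro t
      simp [leg23]
    rw [Module.End.mul_apply, Module.End.mul_apply, h1, legR12_assoc, legR12_assoc, h1,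
      ← Module.End.mul_apply, leg12_T₂_leg23_comulFusion, Module.End.mul_apply]
  have hinj : Function.Injective τ := by
    have h : (legR12 γ.tauEquiv.symm.toLinearMap * legR12 γ.tau :
        Module.End ℂ (A ⊗[ℂ] (B ⊗[ℂ] (A ⊗[ℂ] B)))) = 1 := by
      rw [← legR12_mul, ← legR12_one]
      congr 1
      apply LinearMap.ext
      intro t
      exact γ.tauEquiv.symm_apply_apply t
    refine Function.LeftInverse.injective
      (g := leg13 (legR12 γ.tauEquiv.symm.toLinearMap)) fun t => ?_
    rw [← Module.End.mul_apply, ← leg13_mul, h, leg13_one, Module.End.one_apply]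
  have hQ : (leg13 (γ.smashFusion α) : Module.End ℂ ((A ⊗[ℂ] B) ⊗[ℂ] (B ⊗[ℂ] (A ⊗[ℂ] B)))) =
      G * U := by
    rw [smashFusion, leg13_mul, leg13_lTensor]
  have key : τ * (D * P * (G * U)) = τ * (G * U * (D * P)) := by
    calc τ * (D * P * (G * U)) = τ * (D * P) * (G * U) := by simp only [mul_assoc]
      _ = D * τ * (R * G) * U := by rw [hτ]; simp only [mul_assoc]
      _ = D * (τ * G) * (R * U) := by rw [hRG]; simp only [mul_assoc]
      _ = C * D * τ * (R * U) := by rw [hτG, hCD]; simp only [mul_assoc]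
      _ = C * (τ * (D * P)) * U := by rw [hτ, hRU]; simp only [mul_assoc]; rw [hRU]
      _ = C * τ * (D * U) * P := by simp only [mul_assoc]; rw [hPU]
      _ = τ * G * U * D * P := by rw [hτG, hUD]; simp only [mul_assoc]
      _ = _ := by simp only [mul_assoc]
  rw [hQ]
  apply LinearMap.ext
  intro t
  apply hinj
  exact congrArg (fun f => f t) key

/-- `T₂_flipP_smashFusion` with the tensor factors in the order in which `smashT₂B` and `smashT₁`
act. -/
theorem leg12_smashT₂B_leg23_smashT₁ :
    (leg12 (γ.smashT₂B α) * leg23 (γ.smashT₁ α) :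
      Module.End ℂ ((B ⊗[ℂ] (A ⊗[ℂ] B)) ⊗[ℂ] (A ⊗[ℂ] B))) =
    leg23 (γ.smashT₁ α) * leg12 (γ.smashT₂B α) := by
  let κ : (A ⊗[ℂ] B) ⊗[ℂ] (B ⊗[ℂ] (A ⊗[ℂ] B)) ≃ₗ[ℂ] (B ⊗[ℂ] (A ⊗[ℂ] B)) ⊗[ℂ] (A ⊗[ℂ] B) :=
    (assoc ℂ (A ⊗[ℂ] B) B (A ⊗[ℂ] B)).symm ≪≫ₗ swapFirst.rTensor (A ⊗[ℂ] B)
  have hκ : ∀ s b z, κ (s ⊗ₜ (b ⊗ₜ z)) = swapFirst (s ⊗ₜ b) ⊗ₜ z := fun s b z => rfl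
  have hκ' : ∀ s z, κ (assoc ℂ (A ⊗[ℂ] B) B (A ⊗[ℂ] B) (s ⊗ₜ z)) = swapFirst s ⊗ₜ z := by
    intro s z
    simp [κ]
  clear_value κ
  have h1 : ∀ t, κ ((leg23 (legR12 K.T₂.toLinearMap) * leg12 (γ.flipP α) :
      Module.End ℂ ((A ⊗[ℂ] B) ⊗[ℂ] (B ⊗[ℂ] (A ⊗[ℂ] B)))) t) =
      leg12 (γ.smashT₂B α) (κ t) := by
    rw [← legR12_leg23, ← legR12_leg12, ← legR12_mul]
    intro t
    obtain ⟨t, rfl⟩ := (assoc ℂ (A ⊗[ℂ] B) B (A ⊗[ℂ] B)).surjective t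
    rw [legR12_assoc]
    induction t with
    | zero => simp
    | add s t hs ht => simp only [map_add, hs, ht]
    | tmul s z => rw [leg12_tmul, hκ', hκ', leg12_tmul, smashT₂B_swapFirst,
      Module.End.mul_apply]
  have h2 : ∀ t, κ (leg13 (γ.smashFusion α) t) = leg23 (γ.smashT₁ α) (κ t) := by
    intro t
    induction t with
    | zero => simp
    | add s t hs ht => simp only [map_add, hs, ht]
    | tmul s t =>
      induction t with
      | zero => simp
      | add s t hs ht => simp only [map_add, TensorProduct.tmul_add, hs, ht]
      | tmul b z =>
        induction s with
        | zero => simp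
        | add s t hs ht => simp only [map_add, TensorProduct.add_tmul, hs, ht]
        | tmul a d =>
          rw [leg13_tmul, hκ, swapFirst_tmul, leg23_tmul]
          simp only [smashT₁, LinearMap.comp_apply, LinearEquiv.coe_coe, TensorProduct.assoc_tmul]
          generalize γ.smashFusion α (a ⊗ₜ (b ⊗ₜ z)) = s
          induction s with
          | zero => simp
          | add s t hs ht => simp only [map_add, hs, ht]
          | tmul p t =>
            induction t with
            | zero => simp
            | add s t hs ht => simp only [map_add, TensorProduct.tmul_add, hs, ht]
            | tmul q z => simp [hκ, swapFirst_tmul]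
  apply LinearMap.ext
  intro t
  obtain ⟨t, rfl⟩ := κ.surjective t
  have h3 := congrArg (fun f => κ (f t)) (γ.T₂_flipP_smashFusion α)
  rw [Module.End.mul_apply, Module.End.mul_apply, ← h1, ← h2, ← h2, ← h1]
  exact h3

/-- Coassociativity of `Δ_#`, as commutation of its two canonical maps. -/
theorem leg12_smashT₂_leg23_smashT₁ :
    (leg12 (γ.smashT₂ α) * leg23 (γ.smashT₁ α) :
      Module.End ℂ (((A ⊗[ℂ] B) ⊗[ℂ] (A ⊗[ℂ] B)) ⊗[ℂ] (A ⊗[ℂ] B))) =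
    leg23 (γ.smashT₁ α) * leg12 (γ.smashT₂ α) := by
  rw [smashT₂, leg12_mul, mul_assoc, leg12_leg13_comm (γ.leg12_T₂_leg23_smashT₁ α), ← mul_assoc,
    leg12_leg23_comm (γ.leg12_smashT₂B_leg23_smashT₁ α), mul_assoc]

end LeftComoduleCoalgebra

section Legs

variable {L M N : Type*} [AddCommGroup L] [Module ℂ L] [AddCommGroup M] [Module ℂ M]
  [AddCommGroup N] [Module ℂ N]

theorem leg12_surjective {f : Module.End ℂ (L ⊗[ℂ] M)} (hf : Function.Surjective f) :
    Function.Surjective (leg12 f : Module.End ℂ ((L ⊗[ℂ] M) ⊗[ℂ] N)) :=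
  LinearMap.rTensor_surjective _ hf

theorem leg13_surjective {f : Module.End ℂ (L ⊗[ℂ] N)} (hf : Function.Surjective f) :
    Function.Surjective (leg13 f : Module.End ℂ ((L ⊗[ℂ] M) ⊗[ℂ] N)) := by
  intro t
  obtain ⟨s, hs⟩ := LinearMap.rTensor_surjective M hf ((rightComm ℂ L M N) t)
  refine ⟨rightComm ℂ L N M s, ?_⟩
  have h1 : rightComm ℂ L M N (rightComm ℂ L N M s) = s := (rightComm ℂ L N M).symm_apply_apply s
  have h2 : rightComm ℂ L N M (rightComm ℂ L M N t) = t := (rightComm ℂ L M N).symm_apply_apply t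
  simp only [leg13, LinearMap.comp_apply, LinearEquiv.coe_coe]
  rw [h1, hs, h2]

theorem leg23_surjective {f : Module.End ℂ (M ⊗[ℂ] N)} (hf : Function.Surjective f) :
    Function.Surjective (leg23 f : Module.End ℂ ((L ⊗[ℂ] M) ⊗[ℂ] N)) := by
  intro t
  obtain ⟨s, hs⟩ := LinearMap.lTensor_surjective L hf (assoc ℂ L M N t)
  refine ⟨(assoc ℂ L M N).symm s, ?_⟩
  simp [leg23, hs]

theorem legR12_surjective {f : Module.End ℂ (L ⊗[ℂ] M)} (hf : Function.Surjective f) :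
    Function.Surjective (legR12 f : Module.End ℂ (L ⊗[ℂ] (M ⊗[ℂ] N))) :=
  (assoc ℂ L M N).surjective.comp ((leg12_surjective hf).comp (assoc ℂ L M N).symm.surjective)

theorem legR13_surjective {f : Module.End ℂ (L ⊗[ℂ] N)} (hf : Function.Surjective f) :
    Function.Surjective (legR13 f : Module.End ℂ (L ⊗[ℂ] (M ⊗[ℂ] N))) :=
  (assoc ℂ L M N).surjective.comp ((leg13_surjective hf).comp (assoc ℂ L M N).symm.surjective)

end Legs

namespace LeftComoduleCoalgebra

variable {A : Type u} [NonUnitalRing A] [Module ℂ A] [IsScalarTower ℂ A A] [SMulCommClass ℂ A A]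
variable {B : Type v} [NonUnitalRing B] [Module ℂ B] [IsScalarTower ℂ B B] [SMulCommClass ℂ B B]
variable {H : RegularMultiplierHopf A} {K : RegularMultiplierHopf B}
variable (γ : LeftComoduleCoalgebra H K) (α : RightModuleAlgebra B H)

theorem smashT₁_surjective : Function.Surjective (γ.smashT₁ α) := by
  have h1 : Function.Surjective (comulFusion K α) :=
    (LinearMap.lTensor_surjective B (twistEquiv α).surjective).comp
      ((legR12_surjective K.T₁.surjective).comp
        (LinearMap.lTensor_surjective B (twistEquiv α).symm.surjective))
  have h2 : Function.Surjective γ.coactFusion :=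
    ((legR12_surjective γ.tauEquiv.symm.surjective).comp
      (legR13_surjective (legR12_surjective H.T₁.surjective))).comp
        (legR12_surjective γ.tau_surjective)
  exact (assoc ℂ A B (A ⊗[ℂ] B)).symm.surjective.comp
    ((h2.comp (LinearMap.lTensor_surjective A h1)).comp (assoc ℂ A B (A ⊗[ℂ] B)).surjective)

variable {γ α} in
theorem smashT₂_surjective (htwist : γ.TwistCondition α) : Function.Surjective (γ.smashT₂ α) := by
  have h1 : Function.Surjective (γ.flipP α) := by
    rw [htwist.flipP_eq]
    exact γ.tau_surjective.comp α.r.surjective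
  have h2 : Function.Surjective (γ.smashT₂B α) :=
    swapFirst.surjective.comp (((leg23_surjective K.T₂.surjective).comp
      (leg12_surjective h1)).comp swapFirst.symm.surjective)
  exact (leg23_surjective h2).comp (leg13_surjective (legR12_surjective H.T₂.surjective))

theorem mulLeftA_tmul (a : A) (x : A ⊗[ℂ] B) : mulLeftA (a ⊗ₜ x) = (μₗ a).rTensor B x := by
  induction x with
  | zero => simp
  | add s t hs ht => simp only [map_add, TensorProduct.tmul_add, hs, ht]
  | tmul p q => simp [mulLeftA]

/-! ### Compatibility of the two canonical maps -/

/-- `d ⊗ a ⊗ (b ⊗ x) ↦ (d ◁ a)b ⊗ x`. -/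
def actMul : B ⊗[ℂ] (A ⊗[ℂ] (B ⊗[ℂ] (A ⊗[ℂ] B))) →ₗ[ℂ] B ⊗[ℂ] (A ⊗[ℂ] B) :=
  (LinearMap.mul' ℂ B).rTensor (A ⊗[ℂ] B) ∘ₗ (assoc ℂ B B (A ⊗[ℂ] B)).symm.toLinearMap ∘ₗ
    (TensorProduct.lift α.act).rTensor (B ⊗[ℂ] (A ⊗[ℂ] B)) ∘ₗ
      (assoc ℂ B A (B ⊗[ℂ] (A ⊗[ℂ] B))).symm.toLinearMap

theorem actMul_tmul (d : B) (a : A) (η : B ⊗[ℂ] (A ⊗[ℂ] B)) :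
    actMul α (d ⊗ₜ (a ⊗ₜ η)) = (μₗ (α.act d a)).rTensor (A ⊗[ℂ] B) η := by
  induction η with
  | zero => simp
  | add s t hs ht => simp only [map_add, TensorProduct.tmul_add, hs, ht]
  | tmul p q => simp [actMul]

theorem actMul_act (d : B) (e : A) (t : A ⊗[ℂ] (B ⊗[ℂ] (A ⊗[ℂ] B))) :
    actMul α (α.act d e ⊗ₜ t) = actMul α (d ⊗ₜ (μₗ e).rTensor (B ⊗[ℂ] (A ⊗[ℂ] B)) t) := by
  induction t with
  | zero => simp
  | add s t hs ht => simp only [map_add, TensorProduct.tmul_add, hs, ht]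
  | tmul p q =>
    rw [LinearMap.rTensor_tmul, actMul_tmul, actMul_tmul, ← α.act_mul, LinearMap.mulLeft_apply]

/-- `(b ⊗ a) ⊗ (b' ⊗ x) ↦ bb' ⊗ ax`. -/
def tensorMul : (B ⊗[ℂ] A) ⊗[ℂ] (B ⊗[ℂ] (A ⊗[ℂ] B)) →ₗ[ℂ] B ⊗[ℂ] (A ⊗[ℂ] B) :=
  TensorProduct.map (LinearMap.mul' ℂ B) mulLeftA ∘ₗ
    (TensorProduct.tensorTensorTensorComm ℂ B A B (A ⊗[ℂ] B)).toLinearMap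

theorem tensorMul_tmul (b : B) (a : A) (η : B ⊗[ℂ] (A ⊗[ℂ] B)) :
    tensorMul ((b ⊗ₜ a) ⊗ₜ η) =
      (mulLeftA ∘ₗ TensorProduct.mk ℂ A (A ⊗[ℂ] B) a).lTensor B ((μₗ b).rTensor (A ⊗[ℂ] B) η) := by
  induction η with
  | zero => simp
  | add s t hs ht => simp only [map_add, TensorProduct.tmul_add, hs, ht]
  | tmul p q => simp [tensorMul]

/-- `(β ⊗ 1)(Γ(a)η) = ((β ⊗ 1)Γ(a))η`. -/
theorem mul_coactMul (β : B) (a : A) (η : B ⊗[ℂ] (A ⊗[ℂ] B)) :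
    (μₗ β).rTensor (A ⊗[ℂ] B) (γ.coactMul (a ⊗ₜ η)) = tensorMul (γ.Top (a ⊗ₜ β) ⊗ₜ η) := by
  induction η with
  | zero => simp
  | add s t hs ht => simp only [map_add, TensorProduct.tmul_add, hs, ht]
  | tmul b x =>
    have h : ∀ s : B ⊗[ℂ] A, (assoc ℂ B A (A ⊗[ℂ] B) ((μₗ β).rTensor A s ⊗ₜ x)) =
        (μₗ β).rTensor (A ⊗[ℂ] (A ⊗[ℂ] B)) (assoc ℂ B A (A ⊗[ℂ] B) (s ⊗ₜ x)) := by
      intro s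
      induction s with
      | zero => simp
      | add s t hs ht => simp only [map_add, TensorProduct.add_tmul, hs, ht]
      | tmul p q => simp
    rw [coactMul_tmul, rTensor_lTensor_comm, ← h, mul_T]
    generalize γ.Top (a ⊗ₜ β) = s
    induction s with
    | zero => simp
    | add s t hs ht => simp only [map_add, TensorProduct.add_tmul, hs, ht]
    | tmul p q => simp [tensorMul_tmul]

/-- `∑ (d ◁ a₍₁₎)Γ(a₍₂₎)η = P(d ⊗ a)η`. -/
theorem actMul_coactFusion (d : B) (a : A) (η : B ⊗[ℂ] (A ⊗[ℂ] B)) :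
    actMul α (d ⊗ₜ γ.coactFusion (a ⊗ₜ η)) = tensorMul (γ.P α (d ⊗ₜ a) ⊗ₜ η) := by
  have hd : d ∈ Submodule.span ℂ {z : B | ∃ b a, z = α.act b a} := by rw [α.unital]; trivial
  induction hd using Submodule.span_induction with
  | zero => simp
  | add x y _ _ hx hy => simp only [map_add, TensorProduct.add_tmul, hx, hy]
  | smul c x _ hx => simp only [← TensorProduct.smul_tmul', map_smul, hx]
  | mem d hd =>
    obtain ⟨d, e, rfl⟩ := hd
    have h1 := γ.coactFusion_isCovered η e a
    rw [LinearMap.comp_apply, LinearMap.flip_apply, TensorProduct.mk_apply] at h1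
    rw [actMul_act, h1]
    have h2 : γ.P α (α.act d e ⊗ₜ a) = γ.Top (α.twistOp (α.act d e ⊗ₜ a)) := rfl
    rw [h2, α.twistOp_act]
    generalize H.T₂ (e ⊗ₜ a) = s
    induction s with
    | zero => simp
    | add s t hs ht => simp only [map_add, TensorProduct.tmul_add, TensorProduct.add_tmul, hs, ht]
    | tmul u v =>
      rw [LinearMap.lTensor_tmul, actMul_tmul, LinearMap.comp_apply, LinearMap.flip_apply,
        TensorProduct.mk_apply, mul_coactMul]
      simp

theorem exists_twistEquiv_eq (z : A ⊗[ℂ] B) : ∃ s : B ⊗[ℂ] A, twistEquiv α s = z :=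
  (twistEquiv α).surjective z

theorem comulFusion_twist (b b' : B) (a : A) :
    comulFusion K α (b ⊗ₜ α.twist (b' ⊗ₜ a)) =
      α.twist.lTensor B (assoc ℂ B B A (K.T₁ (b ⊗ₜ b') ⊗ₜ a)) := by
  have h := comulFusion_lTensor (K := K) α (b ⊗ₜ (b' ⊗ₜ a))
  have h1 : (twistEquiv α).toLinearMap = α.twist := by
    apply TensorProduct.ext'
    intro b a
    exact twistEquiv_tmul α b a
  rw [h1, LinearMap.lTensor_tmul, legR12_tmul] at h
  exact h

/-- `(β ⊗ 1)Δ_B(b)(1 ⊗ z) = T₂(β ⊗ b)(1 ⊗ z)`, with `a` multiplied on the left into the second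
factor. -/
theorem mul_comulFusion (β b : B) (a : A) (z : A ⊗[ℂ] B) :
    (mulLeftA ∘ₗ TensorProduct.mk ℂ A (A ⊗[ℂ] B) a).lTensor B
      ((μₗ β).rTensor (A ⊗[ℂ] B) (comulFusion K α (b ⊗ₜ z))) =
    (α.smashMul ∘ₗ (TensorProduct.mk ℂ (A ⊗[ℂ] B) (A ⊗[ℂ] B)).flip z ∘ₗ
      TensorProduct.mk ℂ A B a).lTensor B (K.T₂ (β ⊗ₜ b)) := by
  obtain ⟨s, rfl⟩ := exists_twistEquiv_eq α z
  induction s with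
  | zero => simp
  | add s t hs ht =>
    simp only [map_add, TensorProduct.tmul_add, LinearMap.comp_add, LinearMap.add_comp,
      LinearMap.lTensor_add, LinearMap.add_apply, hs, ht]
  | tmul b'' a'' =>
    rw [twistEquiv_tmul, comulFusion_twist, rTensor_lTensor_comm]
    have h : ∀ s : B ⊗[ℂ] B, (μₗ β).rTensor (B ⊗[ℂ] A) (assoc ℂ B B A (s ⊗ₜ a'')) =
        assoc ℂ B B A ((μₗ β).rTensor B s ⊗ₜ a'') := by
      intro s
      induction s with
      | zero => simp
      | add s t hs ht => simp only [map_add, TensorProduct.add_tmul, hs, ht]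
      | tmul p q => simp
    rw [h, ← K.T₂_T₁]
    generalize K.T₂ (β ⊗ₜ b) = s
    induction s with
    | zero => simp
    | add s t hs ht => simp only [map_add, TensorProduct.add_tmul, hs, ht]
    | tmul p q =>
      simp only [LinearMap.lTensor_tmul, LinearMap.mulRight_apply, TensorProduct.assoc_tmul,
        LinearMap.comp_apply, TensorProduct.mk_apply, LinearMap.flip_apply, mulLeftA_tmul,
        α.twist_mul_left, α.smashMul_tmul_left]

/-- `∑ (d ◁ a₍₁₎)Γ(a₍₂₎)Δ_B(b)(1 ⊗ z)` is `smashT₂B` of `d ⊗ ab`, multiplied by `z`. -/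
theorem actMul_smashFusion (d : B) (a : A) (b : B) (z : A ⊗[ℂ] B) :
    actMul α (d ⊗ₜ γ.smashFusion α (a ⊗ₜ (b ⊗ₜ z))) =
      (α.smashMul ∘ₗ (TensorProduct.mk ℂ (A ⊗[ℂ] B) (A ⊗[ℂ] B)).flip z).lTensor B
        (γ.smashT₂B α (d ⊗ₜ (a ⊗ₜ b))) := by
  have h1 : γ.smashFusion α (a ⊗ₜ (b ⊗ₜ z)) = γ.coactFusion (a ⊗ₜ comulFusion K α (b ⊗ₜ z)) := by
    rw [smashFusion, Module.End.mul_apply, LinearMap.lTensor_tmul]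
  rw [h1, actMul_coactFusion, ← swapFirst_tmul, smashT₂B_swapFirst, leg12_tmul, flipP_apply,
    TensorProduct.comm_tmul]
  generalize γ.P α (d ⊗ₜ a) = s
  induction s with
  | zero => simp
  | add s t hs ht => simp only [map_add, TensorProduct.add_tmul, hs, ht]
  | tmul β a' =>
    rw [tensorMul_tmul, mul_comulFusion, TensorProduct.comm_tmul, leg23_tmul, LinearEquiv.coe_coe]
    generalize K.T₂ (β ⊗ₜ b) = s
    induction s with
    | zero => simp
    | add s t hs ht => simp only [map_add, hs, ht]
    | tmul p q => simp [swapFirst_tmul]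

/-- `(x ⊗ 1)(Δ_#(y)(1 ⊗ z)) = ((x ⊗ 1)Δ_#(y))(1 ⊗ z)`. -/
theorem mul_smashT₁ (x y z : A ⊗[ℂ] B) :
    (α.smashMul ∘ₗ TensorProduct.mk ℂ (A ⊗[ℂ] B) (A ⊗[ℂ] B) x).rTensor (A ⊗[ℂ] B)
      (γ.smashT₁ α (y ⊗ₜ z)) =
    (α.smashMul ∘ₗ (TensorProduct.mk ℂ (A ⊗[ℂ] B) (A ⊗[ℂ] B)).flip z).lTensor (A ⊗[ℂ] B)
      (γ.smashT₂ α (x ⊗ₜ y)) := by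
  induction x with
  | zero => simp
  | add s t hs ht =>
    simp only [map_add, LinearMap.comp_add, LinearMap.rTensor_add, LinearMap.add_apply,
      TensorProduct.add_tmul, hs, ht]
  | tmul c d =>
    induction y with
    | zero => simp
    | add s t hs ht => simp only [map_add, TensorProduct.add_tmul, TensorProduct.tmul_add, hs, ht]
    | tmul a b =>
      have h1 : ∀ t : A ⊗[ℂ] (B ⊗[ℂ] (A ⊗[ℂ] B)),
          (α.smashMul ∘ₗ TensorProduct.mk ℂ (A ⊗[ℂ] B) (A ⊗[ℂ] B) (c ⊗ₜ d)).rTensor (A ⊗[ℂ] B)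
            ((assoc ℂ A B (A ⊗[ℂ] B)).symm t) =
          (assoc ℂ A B (A ⊗[ℂ] B)).symm ((actMul α ∘ₗ TensorProduct.mk ℂ B _ d).lTensor A
            (assoc ℂ A A (B ⊗[ℂ] (A ⊗[ℂ] B)) (H.T₂.toLinearMap.rTensor (B ⊗[ℂ] (A ⊗[ℂ] B))
              ((assoc ℂ A A (B ⊗[ℂ] (A ⊗[ℂ] B))).symm (c ⊗ₜ t))))) := by
        intro t
        induction t with
        | zero => simp
        | add s t hs ht => simp only [map_add, TensorProduct.tmul_add, hs, ht]
        | tmul u s =>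
          induction s with
          | zero => simp
          | add s t hs ht => simp only [map_add, TensorProduct.tmul_add, hs, ht]
          | tmul v w =>
            rw [TensorProduct.assoc_symm_tmul, LinearMap.rTensor_tmul, LinearMap.comp_apply,
              TensorProduct.mk_apply, α.smashMul_tmul_left, α.mulLeftB_tmul, rTensor_lTensor_comm,
              α.twist_spec, TensorProduct.assoc_symm_tmul, LinearMap.rTensor_tmul,
              LinearEquiv.coe_coe]
            generalize H.T₂ (c ⊗ₜ u) = s
            induction s with
            | zero => simp
            | add s t hs ht => simp only [map_add, TensorProduct.add_tmul, hs, ht]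
            | tmul p q => simp [actMul_tmul]
      have h2 := (γ.smashFusion_isCovered α (b ⊗ₜ z)).T₂_rTensor c a
      have h3 : γ.smashT₁ α ((a ⊗ₜ b) ⊗ₜ z) =
          (assoc ℂ A B (A ⊗[ℂ] B)).symm (γ.smashFusion α (a ⊗ₜ (b ⊗ₜ z))) := rfl
      rw [LinearMap.comp_apply, LinearMap.flip_apply, TensorProduct.mk_apply] at h2
      rw [h3, h1, h2, LinearEquiv.apply_symm_apply, smashT₂, Module.End.mul_apply, leg13_tmul,
        legR12_tmul, LinearEquiv.coe_coe]
      generalize H.T₂ (c ⊗ₜ a) = s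
      induction s with
      | zero => simp
      | add s t hs ht => simp only [map_add, TensorProduct.add_tmul, hs, ht]
      | tmul u v =>
        rw [LinearMap.lTensor_tmul, LinearMap.lTensor_tmul, LinearMap.comp_apply,
          LinearMap.comp_apply, LinearMap.flip_apply, TensorProduct.mk_apply,
          TensorProduct.mk_apply, actMul_smashFusion, TensorProduct.assoc_tmul,
          LinearMap.rTensor_tmul, LinearMap.flip_apply, TensorProduct.mk_apply, leg23_tmul]
        generalize γ.smashT₂B α (d ⊗ₜ (v ⊗ₜ b)) = s
        induction s with
        | zero => simp
        | add s t hs ht => simp only [map_add, TensorProduct.tmul_add, hs, ht]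
        | tmul p q => simp

end LeftComoduleCoalgebra

namespace LeftComoduleCoalgebra

variable {A : Type u} [NonUnitalRing A] [Module ℂ A] [IsScalarTower ℂ A A] [SMulCommClass ℂ A A]
variable {B : Type v} [NonUnitalRing B] [Module ℂ B] [IsScalarTower ℂ B B] [SMulCommClass ℂ B B]
variable {H : RegularMultiplierHopf A} {K : RegularMultiplierHopf B}
variable (γ : LeftComoduleCoalgebra H K) (α : RightModuleAlgebra B H)

/-! ### Multiplicativity -/

/-- The factor `T₂` of `A` in `smashT₂` is multiplicative in `AB`, by coassociativity. -/
theorem legR12_T₂_isMultiplicative :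
    IsMultiplicative α.smashMul (legR12 H.T₂.toLinearMap : Module.End ℂ (A ⊗[ℂ] (A ⊗[ℂ] B))) := by
  intro c y y'
  induction y with
  | zero => simp
  | add s t hs ht => simp only [map_add, TensorProduct.add_tmul, TensorProduct.tmul_add, hs, ht]
  | tmul a b =>
    induction y' with
    | zero => simp
    | add s t hs ht => simp only [map_add, TensorProduct.tmul_add, LinearMap.add_apply, hs, ht]
    | tmul a' b' =>
      rw [α.smashMul_tmul, legR12_tmul, LinearEquiv.coe_coe]
      have h1 : ∀ s : A ⊗[ℂ] B,
          legR12 H.T₂.toLinearMap (c ⊗ₜ TensorProduct.map (μₗ a) (μᵣ b') s) =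
          (assoc ℂ A A B) ((TensorProduct.map (H.mulComul₂ ∘ₗ
            TensorProduct.mk ℂ (A ⊗[ℂ] A) A (H.T₂ (c ⊗ₜ a))) (μᵣ b')) s) := by
        intro s
        induction s with
        | zero => simp
        | add s t hs ht => simp only [map_add, TensorProduct.tmul_add, hs, ht]
        | tmul p q =>
          rw [TensorProduct.map_tmul, legR12_tmul, LinearEquiv.coe_coe, LinearMap.mulLeft_apply,
            H.T₂_mul₂]
          rfl
      rw [h1]
      generalize H.T₂ (c ⊗ₜ a) = t
      induction t with
      | zero => simp
      | add s t hs ht =>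
        simp only [map_add, TensorProduct.add_tmul, LinearMap.comp_add, TensorProduct.map_add_left,
          LinearMap.add_apply, hs, ht]
      | tmul u f =>
        rw [TensorProduct.assoc_tmul, fuse_tmul, legR12_tmul, LinearEquiv.coe_coe]
        have h2 : ∀ s : A ⊗[ℂ] B, assoc ℂ A A B ((TensorProduct.map (H.mulComul₂ ∘ₗ
            TensorProduct.mk ℂ (A ⊗[ℂ] A) A (u ⊗ₜ f)) (μᵣ b')) s) =
            (TensorProduct.map (μₗ f) (μᵣ b')).lTensor A (assoc ℂ A A B
              (H.T₂.toLinearMap.rTensor B ((assoc ℂ A A B).symm (u ⊗ₜ s)))) := by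
          intro s
          induction s with
          | zero => simp
          | add s t hs ht => simp only [map_add, TensorProduct.tmul_add, hs, ht]
          | tmul p q =>
            rw [TensorProduct.map_tmul, LinearMap.comp_apply, TensorProduct.mk_apply,
              H.mulComul₂_tmul, TensorProduct.assoc_symm_tmul, LinearMap.rTensor_tmul,
              LinearEquiv.coe_coe]
            generalize H.T₂ (u ⊗ₜ p) = s
            induction s with
            | zero => simp
            | add s t hs ht => simp only [map_add, TensorProduct.add_tmul, hs, ht]
            | tmul k l => simp
        have h3 := (α.twist_isCovered b).T₂_rTensor u a'
        rw [LinearMap.comp_apply, TensorProduct.mk_apply] at h3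
        rw [h2, h3, LinearEquiv.apply_symm_apply]
        generalize H.T₂ (u ⊗ₜ a') = s
        induction s with
        | zero => simp
        | add s t hs ht => simp only [map_add, TensorProduct.add_tmul, hs, ht]
        | tmul k l => simp [α.smashMul_tmul]

/-- `x ⊗ a ↦ xa`, the right multiplication of `A` on the smash product. -/
def smashMulA : (A ⊗[ℂ] B) ⊗[ℂ] A →ₗ[ℂ] A ⊗[ℂ] B :=
  mulLeftA ∘ₗ α.twist.lTensor A ∘ₗ (assoc ℂ A B A).toLinearMap

theorem smashMulA_tmul (x : A ⊗[ℂ] B) (a : A) : smashMulA α (x ⊗ₜ a) = α.mulRightA a x := by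
  induction x with
  | zero => simp
  | add s t hs ht => simp only [map_add, TensorProduct.add_tmul, hs, ht]
  | tmul p q =>
    rw [α.mulRightA_tmul, ← mulLeftA_tmul]
    rfl

/-- `x ⊗ b ↦ xb`, the right multiplication of `B` on the smash product. -/
def smashMulB : (A ⊗[ℂ] B) ⊗[ℂ] B →ₗ[ℂ] A ⊗[ℂ] B :=
  (LinearMap.mul' ℂ B).lTensor A ∘ₗ (assoc ℂ A B B).toLinearMap

theorem smashMulB_tmul (x : A ⊗[ℂ] B) (b : B) : smashMulB (x ⊗ₜ b) = (μᵣ b).lTensor A x := by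
  induction x with
  | zero => simp
  | add s t hs ht => simp only [map_add, TensorProduct.add_tmul, hs, ht]
  | tmul p q => simp [smashMulB]

theorem smashMulA_assoc (x : A ⊗[ℂ] B) (a a' : A) :
    smashMulA α (smashMulA α (x ⊗ₜ a) ⊗ₜ a') =
      smashMulA α (x ⊗ₜ LinearMap.mul' ℂ A (a ⊗ₜ a')) := by
  simp only [smashMulA_tmul, LinearMap.mul'_apply]
  induction x with
  | zero => simp
  | add s t hs ht => simp only [map_add, hs, ht]
  | tmul p q =>
    rw [α.mulRightA_tmul, α.mulRightA_tmul, ← α.rTensor_mulRightA, ← α.twist_mul_right]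

theorem smashMulB_assoc (x : A ⊗[ℂ] B) (b b' : B) :
    smashMulB (smashMulB (x ⊗ₜ b) ⊗ₜ b') = smashMulB (x ⊗ₜ LinearMap.mul' ℂ B (b ⊗ₜ b')) := by
  simp only [smashMulB_tmul, LinearMap.mul'_apply]
  rw [← LinearMap.lTensor_comp_apply]
  congr 2
  ext
  simp [mul_assoc]

theorem smashMul_twist (x : A ⊗[ℂ] B) (b : B) (a : A) :
    α.smashMul (x ⊗ₜ α.twist (b ⊗ₜ a)) = smashMulA α (smashMulB (x ⊗ₜ b) ⊗ₜ a) := by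
  rw [smashMulA_tmul, smashMulB_tmul]
  induction x with
  | zero => simp
  | add s t hs ht => simp only [map_add, TensorProduct.add_tmul, hs, ht]
  | tmul p q =>
    rw [α.smashMul_tmul_left, ← α.twist_mul_left, LinearMap.lTensor_tmul, α.mulRightA_tmul,
      LinearMap.mulRight_apply]

theorem smashMul_tmul_eq (x : A ⊗[ℂ] B) (a : A) (b : B) :
    α.smashMul (x ⊗ₜ (a ⊗ₜ b)) = smashMulB (smashMulA α (x ⊗ₜ a) ⊗ₜ b) := by
  rw [α.smashMul_tmul_right, smashMulA_tmul, smashMulB_tmul]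

theorem T₂_isMultiplicative (K : RegularMultiplierHopf B) :
    IsMultiplicative (LinearMap.mul' ℂ B) K.T₂.toLinearMap := by
  intro c f p
  rw [LinearMap.mul'_apply, LinearEquiv.coe_coe, K.T₂_mul₂]
  generalize K.T₂ (c ⊗ₜ f) = t
  induction t with
  | zero => simp
  | add s t hs ht => simp only [map_add, TensorProduct.add_tmul, hs, ht]
  | tmul u v =>
    rw [K.mulComul₂_tmul, fuse_tmul]
    rfl

variable {γ α}

theorem MulCondition.isMultiplicative (h : γ.MulCondition α) :
    IsMultiplicative (LinearMap.mul' ℂ A) (γ.P α) := by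
  intro d a a'
  have h1 := congrArg (fun f => f (d ⊗ₜ (a ⊗ₜ a'))) h
  simp only [LinearMap.comp_apply, LinearMap.lTensor_tmul] at h1
  have h2 : γ.P₁₂ α (d ⊗ₜ (a ⊗ₜ a')) = assoc ℂ B A A (γ.P α (d ⊗ₜ a) ⊗ₜ a') := rfl
  rw [h1, h2]
  generalize γ.P α (d ⊗ₜ a) = s
  induction s with
  | zero => simp
  | add s t hs ht => simp only [map_add, TensorProduct.add_tmul, hs, ht]
  | tmul δ p =>
    have h3 : γ.P₁₃ α (δ ⊗ₜ (p ⊗ₜ a')) =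
        (comm ℂ A A).toLinearMap.lTensor B (assoc ℂ B A A (γ.P α (δ ⊗ₜ a') ⊗ₜ p)) := rfl
    rw [TensorProduct.assoc_tmul, h3, fuse_tmul]
    generalize γ.P α (δ ⊗ₜ a') = s
    induction s with
    | zero => simp
    | add s t hs ht => simp only [map_add, TensorProduct.add_tmul, hs, ht]
    | tmul ε q => simp

variable (γ α)

/-- On `ab`, the operators attached to `smashT₂B` are those of `a` and `b` in succession. -/
theorem fuse_smashT₂B_tmul (a : A) (b : B) :
    fuse α.smashMul (γ.smashT₂B α) (a ⊗ₜ b) =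
      fuse smashMulB K.T₂.toLinearMap b * fuse (smashMulA α) (γ.P α) a := by
  apply TensorProduct.ext'
  intro d v
  rw [Module.End.mul_apply, fuse_tmul, fuse_tmul, ← swapFirst_tmul, smashT₂B_swapFirst, leg12_tmul,
    flipP_apply, TensorProduct.comm_tmul]
  generalize γ.P α (d ⊗ₜ a) = s
  induction s with
  | zero => simp
  | add s t hs ht => simp only [map_add, TensorProduct.add_tmul, hs, ht]
  | tmul δ p =>
    rw [TensorProduct.comm_tmul, leg23_tmul, LinearMap.lTensor_tmul, fuse_tmul]
    generalize K.T₂.toLinearMap (δ ⊗ₜ b) = s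
    induction s with
    | zero => simp
    | add s t hs ht => simp only [map_add, hs, ht]
    | tmul k l => simp [swapFirst_tmul, smashMul_tmul_eq]

variable {γ α}

/-- On `ba`, the operators attached to `smashT₂B` are those of `b` and `a` in succession. This is
where the exchange relation `r_flipP_T₂` enters. -/
theorem fuse_smashT₂B_twist (hcomul : γ.ComulCondition α) (htwist : γ.TwistCondition α) (a : A)
    (b : B) : fuse α.smashMul (γ.smashT₂B α) (α.twist (b ⊗ₜ a)) =
      fuse (smashMulA α) (γ.P α) a * fuse smashMulB K.T₂.toLinearMap b := by
  apply TensorProduct.ext'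
  intro d v
  have h1 : ∀ s : A ⊗[ℂ] B, d ⊗ₜ s = swapFirst (((TensorProduct.mk ℂ A B).flip d).rTensor B s) := by
    intro s
    induction s with
    | zero => simp
    | add s t hs ht => simp only [map_add, TensorProduct.tmul_add, hs, ht]
    | tmul p q => simp [swapFirst_tmul]
  have h2 : ((TensorProduct.mk ℂ A B).flip d).rTensor B (α.twist (b ⊗ₜ a)) =
      leg13 α.r.toLinearMap ((a ⊗ₜ d) ⊗ₜ b) := by
    rw [leg13_tmul]; rfl
  have h3 := congrArg (fun f => f ((a ⊗ₜ d) ⊗ₜ b)) (r_flipP_T₂ hcomul htwist)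
  simp only [Module.End.mul_apply] at h3
  rw [fuse_tmul, h1, smashT₂B_swapFirst, h2, ← h3, leg23_tmul, Module.End.mul_apply, fuse_tmul]
  generalize K.T₂.toLinearMap (d ⊗ₜ b) = s
  induction s with
  | zero => simp
  | add s t hs ht => simp only [map_add, hs, ht]
  | tmul δ β =>
    rw [LinearMap.rTensor_tmul, TensorProduct.mk_apply, leg12_tmul, flipP_apply,
      TensorProduct.comm_tmul, LinearMap.lTensor_tmul, fuse_tmul]
    generalize γ.P α (δ ⊗ₜ a) = s
    induction s with
    | zero => simp
    | add s t hs ht => simp only [map_add, TensorProduct.add_tmul, hs, ht]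
    | tmul ε p =>
      have h4 : α.r (p ⊗ₜ β) = α.twist (β ⊗ₜ p) := rfl
      rw [TensorProduct.comm_tmul, leg13_tmul, LinearEquiv.coe_coe, h4, LinearMap.lTensor_tmul,
        LinearMap.comp_apply, LinearMap.comp_apply, TensorProduct.mk_apply, TensorProduct.mk_apply,
        ← smashMul_twist]
      generalize α.twist (β ⊗ₜ p) = s
      induction s with
      | zero => simp
      | add s t hs ht => simp only [map_add, TensorProduct.tmul_add, hs, ht]
      | tmul k l => simp [swapFirst_tmul]

/-- By the exchange relation, it suffices to know multiplicativity on `A`, which is the condition on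
`P(ι ⊗ m_A)`, and on `B`, which is that of `Δ_B`. -/
theorem smashT₂B_isMultiplicative (hmul : γ.MulCondition α) (hcomul : γ.ComulCondition α)
    (htwist : γ.TwistCondition α) : IsMultiplicative α.smashMul (γ.smashT₂B α) := by
  apply IsMultiplicative.of_fuse_mul
  · exact α.smashMul_assoc
  · intro y h
    exact (α.smash_nondegenerate K).right y h
  intro y y'
  induction y with
  | zero => simp
  | add s t hs ht => simp only [map_add, TensorProduct.add_tmul, mul_add, hs, ht]
  | tmul a b =>
    induction y' with
    | zero => simp
    | add s t hs ht => simp only [map_add, TensorProduct.tmul_add, add_mul, hs, ht]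
    | tmul a' b' =>
      have h1 : ∀ s : A ⊗[ℂ] B, fuse α.smashMul (γ.smashT₂B α)
          (TensorProduct.map (μₗ a) (μᵣ b') s) = fuse smashMulB K.T₂.toLinearMap b' *
            fuse α.smashMul (γ.smashT₂B α) s * fuse (smashMulA α) (γ.P α) a := by
        intro s
        induction s with
        | zero => simp
        | add s t hs ht => simp only [map_add, mul_add, add_mul, hs, ht]
        | tmul p q =>
          have hA := hmul.isMultiplicative.fuse_mul (smashMulA_assoc α) a p
          have hB := (T₂_isMultiplicative K).fuse_mul (smashMulB_assoc (A := A)) q b'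
          rw [LinearMap.mul'_apply] at hA hB
          rw [TensorProduct.map_tmul, fuse_smashT₂B_tmul, fuse_smashT₂B_tmul,
            LinearMap.mulLeft_apply, LinearMap.mulRight_apply, hA, hB]
          simp only [mul_assoc]
      rw [α.smashMul_tmul, h1, fuse_smashT₂B_twist hcomul htwist, fuse_smashT₂B_tmul,
        fuse_smashT₂B_tmul]
      simp only [mul_assoc]

theorem smashT₂_isMultiplicative (hmul : γ.MulCondition α) (hcomul : γ.ComulCondition α)
    (htwist : γ.TwistCondition α) : IsMultiplicative α.smashMul (γ.smashT₂ α) :=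
  (legR12_T₂_isMultiplicative α).leg23_mul_leg13 (smashT₂B_isMultiplicative hmul hcomul htwist)

variable (γ α)

/-! ### The defining formula -/

/-- `b ↦ (x ↦ bx)`, the left multiplication of `B` on the smash product. -/
def mulLeftBHom : B →ₗ[ℂ] Module.End ℂ (A ⊗[ℂ] B) where
  toFun b := α.mulLeftB b
  map_add' b b' := by
    simp only [RightModuleAlgebra.mulLeftB, map_add, LinearMap.comp_add, LinearMap.rTensor_add]
  map_smul' c b := by
    simp only [RightModuleAlgebra.mulLeftB, map_smul, LinearMap.comp_smul, LinearMap.rTensor_smul,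
      RingHom.id_apply]

theorem mulLeftBHom_apply (b : B) (x : A ⊗[ℂ] B) : mulLeftBHom α b x = α.mulLeftB b x := rfl

/-- `Δ_B(b)(1 ⊗ b'z) = (Δ_B(b)(1 ⊗ b'))(1 ⊗ z)`. -/
theorem comulFusion_mulLeftB (b b' : B) (z : A ⊗[ℂ] B) :
    comulFusion K α (b ⊗ₜ α.mulLeftB b' z) =
      ((mulLeftBHom α).flip z).lTensor B (K.T₁ (b ⊗ₜ b')) := by
  obtain ⟨s, rfl⟩ := exists_twistEquiv_eq α z
  induction s with
  | zero => simp
  | add s t hs ht =>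
    simp only [map_add, TensorProduct.tmul_add, LinearMap.lTensor_add, LinearMap.add_apply, hs, ht]
  | tmul b'' a =>
    have h := K.T₁_mulRight b'' (b ⊗ₜ b')
    rw [LinearMap.lTensor_tmul, LinearMap.mulRight_apply] at h
    rw [twistEquiv_tmul, ← α.twist_mul_left, comulFusion_twist, h]
    generalize K.T₁ (b ⊗ₜ b') = s
    induction s with
    | zero => simp
    | add s t hs ht => simp only [map_add, TensorProduct.add_tmul, hs, ht]
    | tmul p q => simp [mulLeftBHom_apply, α.twist_mul_left]

theorem middleT_tmul (u v : A) (p q : B) : γ.middleT ((u ⊗ₜ v) ⊗ₜ (p ⊗ₜ q)) =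
    (assoc ℂ A B (A ⊗[ℂ] B)).symm (u ⊗ₜ assoc ℂ B A B (γ.T (v ⊗ₜ p) ⊗ₜ q)) := by
  simp [middleT]

/-- `(a' ⊗ 1)Δ_#(ab)(1 ⊗ b'z) = (ι ⊗ T ⊗ ι)((a' ⊗ 1)Δ_A(a) ⊗ Δ_B(b)(1 ⊗ b'))(1 ⊗ z)`. -/
theorem mulLeft_smashT₁ (a a' : A) (b b' : B) (z : A ⊗[ℂ] B) :
    ((μₗ a').rTensor B).rTensor (A ⊗[ℂ] B) (γ.smashT₁ α ((a ⊗ₜ b) ⊗ₜ α.mulLeftB b' z)) =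
      (α.smashMul ∘ₗ (TensorProduct.mk ℂ (A ⊗[ℂ] B) (A ⊗[ℂ] B)).flip z).lTensor (A ⊗[ℂ] B)
        (γ.middleT (H.T₂ (a' ⊗ₜ a) ⊗ₜ K.T₁ (b ⊗ₜ b'))) := by
  have h1 : ∀ t : A ⊗[ℂ] (B ⊗[ℂ] (A ⊗[ℂ] B)), ((μₗ a').rTensor B).rTensor (A ⊗[ℂ] B)
      ((assoc ℂ A B (A ⊗[ℂ] B)).symm t) =
      (assoc ℂ A B (A ⊗[ℂ] B)).symm ((μₗ a').rTensor (B ⊗[ℂ] (A ⊗[ℂ] B)) t) := by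
    intro t
    induction t with
    | zero => simp
    | add s t hs ht => simp only [map_add, hs, ht]
    | tmul u s =>
      induction s with
      | zero => simp
      | add s t hs ht => simp only [map_add, TensorProduct.tmul_add, hs, ht]
      | tmul v w => simp
  have h2 : γ.smashT₁ α ((a ⊗ₜ b) ⊗ₜ α.mulLeftB b' z) = (assoc ℂ A B (A ⊗[ℂ] B)).symm
      (γ.smashFusion α (a ⊗ₜ (b ⊗ₜ α.mulLeftB b' z))) := rfl
  have h3 := γ.smashFusion_isCovered α (b ⊗ₜ α.mulLeftB b' z) a' a
  rw [LinearMap.comp_apply, LinearMap.flip_apply, TensorProduct.mk_apply] at h3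
  rw [h2, h1, h3, comulFusion_mulLeftB]
  generalize H.T₂ (a' ⊗ₜ a) = s
  induction s with
  | zero => simp
  | add s t hs ht => simp only [map_add, TensorProduct.add_tmul, hs, ht]
  | tmul u v =>
    generalize K.T₁ (b ⊗ₜ b') = s
    induction s with
    | zero => simp
    | add s t hs ht =>
      simp only [map_add, LinearMap.comp_add, LinearMap.lTensor_add, LinearMap.add_apply,
        TensorProduct.tmul_add, hs, ht]
    | tmul p q =>
      rw [middleT_tmul, LinearMap.lTensor_tmul, LinearMap.lTensor_tmul, LinearMap.comp_apply,
        LinearMap.flip_apply, LinearMap.flip_apply, TensorProduct.mk_apply, mulLeftBHom_apply,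
        coactMul_tmul]
      generalize γ.T (v ⊗ₜ p) = s
      induction s with
      | zero => simp
      | add s t hs ht => simp only [map_add, TensorProduct.tmul_add, TensorProduct.add_tmul, hs, ht]
      | tmul k l => simp [mulLeftA_tmul, α.smashMul_tmul_left]

theorem mem_span_mulLeftB (K : RegularMultiplierHopf B) (z : A ⊗[ℂ] B) :
    z ∈ Submodule.span ℂ {z : A ⊗[ℂ] B | ∃ b x, z = α.mulLeftB b x} := by
  obtain ⟨s, rfl⟩ := exists_twistEquiv_eq α z
  induction s with
  | zero => simp
  | add s t hs ht => rw [map_add]; exact add_mem hs ht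
  | tmul b a =>
    obtain ⟨e, he⟩ := K.exists_left_unit {b}
    refine Submodule.subset_span ⟨e, α.twist (b ⊗ₜ a), ?_⟩
    rw [twistEquiv_tmul, ← α.twist_mul_left, he b (by simp)]

end LeftComoduleCoalgebra

namespace LeftComoduleCoalgebra

variable {A : Type u} [NonUnitalRing A] [Module ℂ A] [IsScalarTower ℂ A A] [SMulCommClass ℂ A A]
variable {B : Type v} [NonUnitalRing B] [Module ℂ B] [IsScalarTower ℂ B B] [SMulCommClass ℂ B B]
variable {H : RegularMultiplierHopf A} {K : RegularMultiplierHopf B}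
variable (γ : LeftComoduleCoalgebra H K) (α : RightModuleAlgebra B H)

/-! ### The coproduct of the smash product -/

/-- `smashT₁` as an operator on `AB ⊗ AB`, where `AB` carries the algebra structure of the smash
product. -/
def canonical₁ : Module.End ℂ (α.Smash ⊗[ℂ] α.Smash) := γ.smashT₁ α

/-- `smashT₂` as an operator on `AB ⊗ AB`, where `AB` carries the algebra structure of the smash
product. -/
def canonical₂ : Module.End ℂ (α.Smash ⊗[ℂ] α.Smash) := γ.smashT₂ α

theorem mul'_smash :
    LinearMap.mul' ℂ α.Smash = (α.smashMul : α.Smash ⊗[ℂ] α.Smash →ₗ[ℂ] α.Smash) := by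
  apply TensorProduct.ext'
  intro x y
  rfl

variable {γ α} in
theorem canonical₂_isMultiplicative (hmul : γ.MulCondition α) (hcomul : γ.ComulCondition α)
    (htwist : γ.TwistCondition α) :
    IsMultiplicative (LinearMap.mul' ℂ α.Smash) (γ.canonical₂ α) := by
  rw [mul'_smash]
  exact smashT₂_isMultiplicative hmul hcomul htwist

theorem mul_canonical₁ (x y z : α.Smash) :
    (μₗ x).rTensor α.Smash (γ.canonical₁ α (y ⊗ₜ z)) =
      (μᵣ z).lTensor α.Smash (γ.canonical₂ α (x ⊗ₜ y)) :=
  γ.mul_smashT₁ α x y z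

theorem leg12_canonical₂_leg23_canonical₁ : (leg12 (γ.canonical₂ α) * leg23 (γ.canonical₁ α) :
      Module.End ℂ ((α.Smash ⊗[ℂ] α.Smash) ⊗[ℂ] α.Smash)) =
    leg23 (γ.canonical₁ α) * leg12 (γ.canonical₂ α) :=
  γ.leg12_smashT₂_leg23_smashT₁ α

/-- The defining formula of `Δ_#` in terms of its canonical map, with the last leg applied to
`z`. -/
theorem smashA_canonical₁ (a a' : A) (b b' : B) (z : α.Smash) :
    (α.smashA a').left.rTensor α.Smash
      (γ.canonical₁ α (α.toSmash (a ⊗ₜ b) ⊗ₜ (α.smashB b').left z)) =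
    (μᵣ z).lTensor α.Smash (TensorProduct.congr α.toSmash α.toSmash
      (γ.middleT (H.T₂ (a' ⊗ₜ a) ⊗ₜ K.T₁ (b ⊗ₜ b')))) := by
  have h : ∀ t, TensorProduct.congr α.toSmash α.toSmash t = t := by
    intro t
    induction t with
    | zero => rw [map_zero]; rfl
    | add s t hs ht => simp only [map_add, hs, ht]; rfl
    | tmul p q => rfl
  rw [h]
  exact γ.mulLeft_smashT₁ α a a' b b' z

theorem smashB_span (K : RegularMultiplierHopf B) (z : α.Smash) :
    z ∈ Submodule.span ℂ {z : α.Smash | ∃ b x, z = (α.smashB b).left x} :=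
  mem_span_mulLeftB α K z

theorem smashA_left_cancel (H' : RegularMultiplierHopf A) (x : α.Smash)
    (h : ∀ a, (α.smashA a).left x = 0) : x = 0 :=
  eq_zero_of_rTensor (V := A) (W := B) (z := x) (fun a : A => μₗ a) H'.mulLeft_cancel h

/-- An element `m` of `M(AB ⊗ AB)` is determined by the products `(a' ⊗ 1)m(1 ⊗ b')`. -/
theorem multiplier_ext (K : RegularMultiplierHopf B) {m n : Multiplier (α.Smash ⊗[ℂ] α.Smash)}
    (h : ∀ a' b', Multiplier.tmul (α.smashA a') 1 * m * Multiplier.tmul 1 (α.smashB b') =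
      Multiplier.tmul (α.smashA a') 1 * n * Multiplier.tmul 1 (α.smashB b')) : m = n := by
  have hX : NondegenerateProduct α.Smash := α.smash_nondegenerate K
  apply Multiplier.ext_left (hX.tensor hX)
  intro x
  induction x with
  | zero => simp
  | add s t hs ht => simp only [map_add, hs, ht]
  | tmul u z =>
    have hz := smashB_span α K z
    induction hz using Submodule.span_induction with
    | zero => simp
    | add x y _ _ hx hy => simp only [map_add, TensorProduct.tmul_add, hx, hy]
    | smul c x _ hx => simp only [TensorProduct.tmul_smul, map_smul, hx]
    | mem z hz =>
      obtain ⟨b, z, rfl⟩ := hz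
      apply RegularMultiplierHopf.eq_of_rTensor (fun a' : A => (α.smashA a').left)
        (smashA_left_cancel α H)
      intro a'
      have h1 := congrArg (fun m => Multiplier.left m (u ⊗ₜ z)) (h a' b)
      exact h1

end LeftComoduleCoalgebra

end Bicross

end

open Bicross

theorem theorem3p14
    {A : Type*} [NonUnitalRing A] [Module ℂ A] [IsScalarTower ℂ A A] [SMulCommClass ℂ A A]
    {B : Type*} [NonUnitalRing B] [Module ℂ B] [IsScalarTower ℂ B B] [SMulCommClass ℂ B B]
    (H : RegularMultiplierHopf A) (K : RegularMultiplierHopf B)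
    (α : RightModuleAlgebra B H) (γ : LeftComoduleCoalgebra H K)
    (hmul : γ.MulCondition α) (hcomul : γ.ComulCondition α) (htwist : γ.TwistCondition α) :
    ∃ Δ : α.Smash →ₙₐ[ℂ] Multiplier (α.Smash ⊗[ℂ] α.Smash),
      γ.IsSmashCoproduct α Δ ∧
      (∀ Δ' : α.Smash →ₗ[ℂ] Multiplier (α.Smash ⊗[ℂ] α.Smash),
        γ.IsSmashCoproduct α Δ' → ∀ x, Δ' x = Δ x) ∧
      IsNondegenerate Δ ∧
      IsCoassociative Δ := by
  have hX : NondegenerateProduct α.Smash := α.smash_nondegenerate K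
  obtain ⟨Δ, hnd, hco, hΔ⟩ := exists_coproduct (X := α.Smash) (T₁ := γ.canonical₁ α)
    (T₂ := γ.canonical₂ α) hX (α.exists_left_unit K) (α.exists_right_unit K)
    (γ.smashT₁_surjective α)
    (LeftComoduleCoalgebra.smashT₂_surjective htwist) (γ.mul_canonical₁ α)
    (LeftComoduleCoalgebra.canonical₂_isMultiplicative hmul hcomul htwist)
    (γ.leg12_canonical₂_leg23_canonical₁ α)
  have hsmash : γ.IsSmashCoproduct α Δ := by
    intro a a' b b'
    apply Multiplier.ext_left (hX.tensor hX)
    intro x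
    induction x with
    | zero => simp
    | add s t hs ht => simp only [map_add, hs, ht]
    | tmul u z =>
      rw [Multiplier.mul_left, Multiplier.mul_left, Multiplier.tmul_left, Multiplier.tmul_left,
        TensorProduct.map_tmul, Multiplier.one_left, hΔ, Multiplier.of_left, mul_tmul_eq,
        ← rTensor_lTensor_comm, ← γ.smashA_canonical₁ α a a' b b' z]
      generalize γ.canonical₁ α (α.toSmash (a ⊗ₜ b) ⊗ₜ (α.smashB b').left z) = t
      induction t with
      | zero => simp
      | add s t hs ht => simp only [map_add, hs, ht]
      | tmul p q =>
        have h1 : (α.smashA a').left (p * u) = (α.smashA a').left p * u :=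
          (α.smashMul_rTensor a' p u).symm
        simp [h1]
  refine ⟨Δ, hsmash, ?_, hnd, hco⟩
  intro Δ' hΔ' x
  obtain ⟨t, rfl⟩ := α.toSmash.surjective x
  induction t with
  | zero => simp
  | add s t hs ht => simp only [map_add, hs, ht]
  | tmul a b =>
    apply LeftComoduleCoalgebra.multiplier_ext α K
    intro a' b'
    rw [hΔ' a a' b b', hsmash a a' b b']
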